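/- **Setting.** A single server serves $K$ priority classes $1,\dots,K$ (class $1$ highest), non-preemptively, first come first served within a class. Class-$l$ jobs arrive according to a Poisson process with rate $\lambda_l>0$ and have i.i.d. exponential service times with mean $1/\mu_l$, all independent, and $\sum_l\lambda_l/\mu_l<1$. Fix a class $k$ and $p\in(0,1)$. Let $R_{k,n}$ be the response (sojourn) time of the $n$-th class-$k$ job in the system started empty, let $R_{k,\infty}$ be the steady-state response time (the limit in distribution of $R_{k,n}$ as $n\to\infty$), $F$ its distribution function, and $Q(p)=\inf\{\gamma:F(\gamma)\ge p\}$. A (regenerative) cycle starts with an empty system at time $0$ and ends with the first departure that leaves the server idle; $\alpha_k$ is the number of class-$k$ jobs served in a cycle. **Importance sampling.** Let $f^A_l,f^S_l$ be the (exponential) densities of inter-arrival and service times, and let $\tilde f^A_l,\tilde f^S_l$ be probability densities on $[0,\infty)$ that are positive almost everywhere on $(0,\infty)$; let $G^A_l,\tilde G^A_l$ be the tail functions of $f^A_l,\tilde f^A_l$. Service times of classes $l\le k$ are realized upon arrival, those of classes $l>k$ upon entering service. An importance sampling (IS) cycle is generated from $\tilde f^A_l,\tilde f^S_l$ until the time $\tau_k$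 of the first class-$k$ arrival at which $R'>\gamma_{\max}$, where $\gamma_{\max}$ is a fixed real number and $R'$ is the total service time of the jobs of classes $l\le k$ waiting (including the arriving job) plus the remaining service time of the job in service; after $\tau_k$ all times not yet realized, including the residual inter-arrival times, are generated from the original distribution. With $A_{l,n},S_{l,n}$ the inter-arrival and service times of class $l$, $N^A_l(t)$ and $N^S_l(t)$ the numbers of class-$l$ jobs that have arrived, respectively entered service, by time $t$, and $H_l$ the time since the last class-$l$ arrival (or since $0$) at time $t\wedge\tau_k$, let $$L(t)=\frac{\prod_{l=1}^K\Big(\prod_{n=1}^{N^A_l(t\wedge\tau_k)}f^A_l(A_{l,n})\,G^A_l(H_l)\Big)\prod_{l=1}^k\prod_{n=1}^{N^A_l(t\wedge\tau_k)}f^S_l(S_{l,n})\prod_{l=k+1}^K\prod_{n=1}^{N^S_l(t\wedge\tau_k)}f^S_l(S_{l,n})}{\prod_{l=1}^K\Big(\prod_{n=1}^{N^A_l(t\wedge\tau_k)}\tilde f^A_l(A_{l,n})\,\tilde G^A_l(H_l)\Big)\prod_{l=1}^k\prod_{n=1}^{N^A_l(t\wedge\tau_k)}\tilde f^S_l(S_{l,n})\prod_{l=k+1}^K\prod_{n=1}^{N^S_l(t\wedge\tau_k)}\tilde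 f^S_l(S_{l,n})}.$$ **Estimator.** Generate i.i.d. IS cycles and, independently, i.i.d. cycles of the original system. For the $i$-th IS cycle, with $\tilde\alpha^i_k$ class-$k$ jobs, response times $\tilde R^i_{k,n}$ and times $\tilde E^i_{k,n}$ of entering service, put $\tilde Y_{k,i}(\gamma)=\sum_{n=1}^{\tilde\alpha^i_k}L(\tilde E^i_{k,n})1_{\{\tilde R^i_{k,n}>\gamma\}}$, where $L$ is computed from that cycle. Let $\alpha^i_k$ be the number of class-$k$ jobs in the $i$-th original cycle, and set $$\hat P_m(\gamma)=\frac{m^{-1}\sum_{i=1}^m\tilde Y_{k,i}(\gamma)}{m^{-1}\sum_{i=1}^m\alpha^i_k},\qquad \hat Q_m(p)=\inf\{\gamma\ge0:\hat P_m(\gamma)<1-p\},$$ $$Z_{k,i}(\gamma)=\tilde Y_{k,i}(\gamma)-P(R_{k,\infty}>\gamma)\,\alpha^i_k,\qquad \sigma^2(\gamma)=\operatorname{Var}(Z_{k,1}(\gamma)).$$ **Theorem.** Suppose that there are constants $\varepsilon,M>0$ such that for all $\gamma$ in some neighborhood of $Q(p)$, $F''(\gamma)$ exists, $|F''(\gamma)|\le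 M$ and $E\big[|Z_{k,1}(\gamma)|^{2+\varepsilon}\big]\le M$. Then, as $m\to\infty$, $$\frac{\sqrt m\,\big(\hat Q_m(p)-Q(p)\big)}{\sigma(Q(p))/\big(E[\alpha_k]\,F'(Q(p))\big)}\Rightarrow N(0,1),$$ and $\hat Q_m(p)\to Q(p)$ in probability. -/

import Mathlib

open MeasureTheory ProbabilityTheory Filter Topology

noncomputable section

namespace PriorityQueue

/-! ### Random input -/

/-- The input of a simulation run with `K` job classes: `(w l n).1` is the time between the
`(n-1)`-th and the `n`-th arrival of class `l`, and `(w l n).2` is the service time of the `n`-th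
class-`l` job. Jobs of a class are numbered from `0`, and class `0` has the highest priority. -/
abbrev Drive (K : ℕ) := Fin K → ℕ → ℝ × ℝ

/-- The distribution on the real line with density `g`. -/
def densityLaw (g : ℝ → ℝ) : Measure ℝ :=
  volume.withDensity fun x => ENNReal.ofReal (g x)

/-- All inter-arrival times and service times are independent; those of class `l` have densities
`gA l` and `gS l`. -/
def driveLaw {K : ℕ} (gA gS : Fin K → ℝ → ℝ) : Measure (Drive K) :=
  Measure.infinitePi fun l : Fin K => Measure.infinitePi fun _ : ℕ =>
    (densityLaw (gA l)).prod (densityLaw (gS l))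

/-- Exponential densities with rates `r l`. -/
def expDensity {K : ℕ} (r : Fin K → ℝ) : Fin K → ℝ → ℝ :=
  fun l x => exponentialPDFReal (r l) x

/-- Poisson arrivals with rates `lam l`, exponential service times with rates `mu l`. -/
def nominalLaw {K : ℕ} (lam mu : Fin K → ℝ) : Measure (Drive K) :=
  driveLaw (expDensity lam) (expDensity mu)

/-- An admissible importance sampling density: a probability density on `[0, ∞)` that is
positive almost everywhere there, so that likelihood ratios with respect to it exist. -/
structure IsSamplingDensity (g : ℝ → ℝ) : Prop where
  measurable : Measurable g
  nonneg : ∀ x, 0 ≤ g x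
  eq_zero_of_neg : ∀ x, x < 0 → g x = 0
  pos : ∀ᵐ x, 0 < x → 0 < g x
  lintegral_eq_one : ∫⁻ x, ENNReal.ofReal (g x) = 1

/-! ### Dynamics of the non-preemptive priority queue, with the switching change of measure

The simulation is event driven: each step processes the next arrival or the next departure. A run
uses the input `w` (drawn from the importance distribution) up to the switching time `τ` and the
input `v` (drawn from the original distribution) afterwards. The original system is a run that is
switched from the start. The target class is `k`; the service times of classes `l ≤ k` are realized
upon arrival, those of classes `l > k` upon entering service. -/

/-- State of the simulation after some number of events. -/
structure State (K : ℕ) where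
  /-- current time `t` -/
  time : ℝ
  /-- number of arrivals of each class by time `t` -/
  arr : Fin K → ℕ
  /-- number of jobs of each class that have entered service by time `t` -/
  ent : Fin K → ℕ
  /-- epoch of the next arrival of each class -/
  next : Fin K → ℝ
  /-- departure epoch of the job in service, `none` if the server is idle -/
  dep : Option ℝ
  /-- whether the run has switched to the original distribution, i.e. whether `τ ≤ t` -/
  switched : Bool
  /-- `t ∧ τ` -/
  obsTime : ℝ
  /-- number of arrivals of each class by time `t ∧ τ` -/
  obsArr : Fin K → ℕ
  /-- number of jobs of each class that have entered service by time `t ∧ τ` -/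
  obsEnt : Fin K → ℕ

variable {K : ℕ}

/-- The input currently in use. -/
def input (w v : Drive K) (switched : Bool) : Drive K :=
  if switched then v else w

/-- Time `0`: no jobs in the system. -/
def initial (w v : Drive K) (switched : Bool) : State K where
  time := 0
  arr := fun _ => 0
  ent := fun _ => 0
  next := fun l => (input w v switched l 0).1
  dep := none
  switched := switched
  obsTime := 0
  obsArr := fun _ => 0
  obsEnt := fun _ => 0

/-- Keep the stopped quantities (those at `t ∧ τ`) up to date. -/
def observe (s : State K) : State K :=
  if s.switched then s
  else { s with obsTime := s.time, obsArr := s.arr, obsEnt := s.ent }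

/-- Service time of the `n`-th class-`l` job, seen when it enters service in state `s`. -/
def serviceTime (k : Fin K) (w v : Drive K) (s : State K) (l : Fin K) (n : ℕ) : ℝ :=
  if l ≤ k then (if n < s.obsArr l then (w l n).2 else (v l n).2)
  else (input w v s.switched l n).2

/-- The class-`l` job that is first in line (first come, first served within a class) enters
service now. -/
def enter (k : Fin K) (w v : Drive K) (l : Fin K) (s : State K) : State K :=
  observe { s with
    ent := Function.update s.ent l (s.ent l + 1)
    dep := some (s.time + serviceTime k w v s l (s.ent l)) }

/-- `R'`: total service time of the jobs of classes `l ≤ k` that wait in the queues, plus the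
remaining service time of the job in service. -/
def backlog (k : Fin K) (w : Drive K) (s : State K) : ℝ :=
  (∑ l ∈ Finset.univ.filter (fun l => l ≤ k), ∑ n ∈ Finset.Ico (s.ent l) (s.arr l), (w l n).2)
    + (s.dep.getD s.time - s.time)

/-- At the arrival of a class-`k` job with `R' > γmax`, switch to the original distribution: from
now on service times that are not yet realized come from `v`, and so do the remaining times to the
next arrivals (the original inter-arrival times are memoryless). -/
def switchIfNeeded (k : Fin K) (γmax : ℝ) (w v : Drive K) (l : Fin K) (s : State K) : State K :=
  open Classical in
  if s.switched = false ∧ l = k ∧ γmax < backlog k w s then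
    { s with switched := true, next := fun j => s.time + (v j (s.arr j)).1 }
  else s

/-- The next arrival, which is of class `l`. -/
def arrive (k : Fin K) (γmax : ℝ) (w v : Drive K) (l : Fin K) (s : State K) : State K :=
  let s₁ : State K := observe { s with
    time := s.next l
    arr := Function.update s.arr l (s.arr l + 1)
    next := Function.update s.next l (s.next l + (input w v s.switched l (s.arr l + 1)).1) }
  let s₂ : State K := if s₁.dep.isNone then enter k w v l s₁ else s₁
  switchIfNeeded k γmax w v l s₂

/-- Departure at time `t`: the server takes the highest-priority waiting job, if there is one. -/
def depart (k : Fin K) (w v : Drive K) (t : ℝ) (s : State K) : State K :=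
  let s₁ : State K := observe { s with time := t, dep := none }
  let waiting : Finset (Fin K) := Finset.univ.filter fun l => s.ent l < s.arr l
  if h : waiting.Nonempty then enter k w v (waiting.min' h) s₁ else s₁

/-- The class of the next arrival (`k` is only a default value). -/
def nextClass (k : Fin K) (s : State K) : Fin K :=
  open Classical in
  let first : Finset (Fin K) := Finset.univ.filter fun l => ∀ j, s.next l ≤ s.next j
  if h : first.Nonempty then first.min' h else k

/-- Process the next event. -/
def step (k : Fin K) (γmax : ℝ) (w v : Drive K) (s : State K) : State K :=
  open Classical in
  match s.dep with
  | none => arrive k γmax w v (nextClass k s) s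
  | some t =>
      if s.next (nextClass k s) < t then arrive k γmax w v (nextClass k s) s
      else depart k w v t s

/-- State after each number of events. -/
def path (k : Fin K) (γmax : ℝ) (w v : Drive K) (switched : Bool) : ℕ → State K
  | 0 => initial w v switched
  | j + 1 => step k γmax w v (path k γmax w v switched j)

/-- Run under the switching change of measure. -/
def samplingPath (k : Fin K) (γmax : ℝ) (u : Drive K × Drive K) : ℕ → State K :=
  path k γmax u.1 u.2 false

/-- Run of the original system, driven by `v` alone (no switching takes place). -/
def nominalPath (k : Fin K) (v : Drive K) : ℕ → State K :=
  path k 0 v v true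

/-! ### Response times and regenerative cycles -/

/-- Number of events until the `n`-th class-`k` job has arrived. -/
def arrivalStep (k : Fin K) (x : ℕ → State K) (n : ℕ) : ℕ :=
  sInf {j | n < (x j).arr k}

/-- Number of events until the `n`-th class-`k` job has entered service. -/
def entryStep (k : Fin K) (x : ℕ → State K) (n : ℕ) : ℕ :=
  sInf {j | n < (x j).ent k}

/-- Response time of the `n`-th class-`k` job: its departure epoch (known as soon as it enters
service, as the server is non-preemptive) minus its arrival epoch. -/
def responseTime (k : Fin K) (x : ℕ → State K) (n : ℕ) : ℝ :=
  (x (entryStep k x n)).dep.getD 0 - (x (arrivalStep k x n)).time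

/-- Number of events in the regenerative cycle, which ends with the first departure that leaves
the server idle. -/
def cycleStep (x : ℕ → State K) : ℕ :=
  sInf {j | 0 < j ∧ (x j).dep = none}

/-- `α_k`: number of class-`k` jobs served in the cycle. -/
def cycleCount (k : Fin K) (x : ℕ → State K) : ℕ :=
  (x (cycleStep x)).ent k

/-! ### Likelihood ratio and estimators -/

/-- Tail probability of the density `g`. -/
def tail (g : ℝ → ℝ) (t : ℝ) : ℝ :=
  ∫ x in Set.Ioi t, g x

/-- Age `H_l` of the current class-`l` inter-arrival time at time `t ∧ τ`. -/
def age (w : Drive K) (s : State K) (l : Fin K) : ℝ :=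
  s.obsTime - ∑ n ∈ Finset.range (s.obsArr l), (w l n).1

/-- Likelihood of what has been realized by time `t ∧ τ` if inter-arrival and service times have
densities `gA` and `gS`. -/
def likelihood (gA gS : Fin K → ℝ → ℝ) (k : Fin K) (w : Drive K) (s : State K) : ℝ :=
  (∏ l, (∏ n ∈ Finset.range (s.obsArr l), gA l (w l n).1) * tail (gA l) (age w s l))
    * (∏ l ∈ Finset.univ.filter (fun l => l ≤ k),
        ∏ n ∈ Finset.range (s.obsArr l), gS l (w l n).2)
    * (∏ l ∈ Finset.univ.filter (fun l => k < l),
        ∏ n ∈ Finset.range (s.obsEnt l), gS l (w l n).2)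

/-- Likelihood ratio `L` of the original with respect to the importance distribution. -/
def likelihoodRatio (lam mu : Fin K → ℝ) (gA gS : Fin K → ℝ → ℝ) (k : Fin K) (w : Drive K)
    (s : State K) : ℝ :=
  likelihood (expDensity lam) (expDensity mu) k w s / likelihood gA gS k w s

/-- `Ỹ_k(γ)`: the sum, over the class-`k` jobs of an importance sampling cycle with response time
greater than `γ`, of the likelihood ratios at their times of entering service. -/
def weightedCount (lam mu : Fin K → ℝ) (gA gS : Fin K → ℝ → ℝ) (k : Fin K) (γmax : ℝ)
    (u : Drive K × Drive K) (γ : ℝ) : ℝ :=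
  open Classical in
  let x := samplingPath k γmax u
  ∑ n ∈ Finset.range (cycleCount k x),
    likelihoodRatio lam mu gA gS k u.1 (x (entryStep k x n)) *
      (if γ < responseTime k x n then 1 else 0)

/-- Estimator of the tail probability of the steady-state response time, from the first `m₁`
importance sampling cycles (input `U i`) and the first `m₂` original cycles (input `X i`). -/
def tailEstimator (lam mu : Fin K → ℝ) (gA gS : Fin K → ℝ → ℝ) (k : Fin K) (γmax : ℝ)
    (U : ℕ → Drive K × Drive K) (X : ℕ → Drive K) (m₁ m₂ : ℕ) (γ : ℝ) : ℝ :=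
  ((m₁ : ℝ)⁻¹ * ∑ i ∈ Finset.range m₁, weightedCount lam mu gA gS k γmax (U i) γ) /
    ((m₂ : ℝ)⁻¹ * ∑ i ∈ Finset.range m₂, (cycleCount k (nominalPath k (X i)) : ℝ))

/-- Quantile estimator; levels `γ` of response times range over `[0, ∞)`. -/
def quantileEstimator (lam mu : Fin K → ℝ) (gA gS : Fin K → ℝ → ℝ) (k : Fin K) (γmax : ℝ)
    (U : ℕ → Drive K × Drive K) (X : ℕ → Drive K) (m₁ m₂ : ℕ) (p : ℝ) : ℝ :=
  sInf {γ : ℝ | 0 ≤ γ ∧ tailEstimator lam mu gA gS k γmax U X m₁ m₂ γ < 1 - p}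

/-- `Q(p) = inf {γ : F(γ) ≥ p}` for the distribution function `F` of `ν`. -/
def quantile (ν : Measure ℝ) (p : ℝ) : ℝ :=
  sInf {γ : ℝ | p ≤ cdf ν γ}

/-- `Z_k(γ)` for an importance sampling cycle and an original cycle, where `ν` is the law of
the steady-state response time. -/
def centered (lam mu : Fin K → ℝ) (gA gS : Fin K → ℝ → ℝ) (k : Fin K) (γmax : ℝ)
    (ν : Measure ℝ) (u : Drive K × Drive K) (v : Drive K) (γ : ℝ) : ℝ :=
  weightedCount lam mu gA gS k γmax u γ
    - ν.real (Set.Ioi γ) * (cycleCount k (nominalPath k v) : ℝ)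

end PriorityQueue

end

/-! The quantile estimator inverts a monotone function of the level, so its distribution function is
the probability that an i.i.d. sum is negative, and the ordinary central limit theorem suffices.
Write q(γ) = P(R > γ) for the steady-state tail, d = F'(Q), c = σ(Q)/(E[α] d) and g_m = Q + c x/√m.
Since Y(γ) is nonincreasing in γ, the event that the ratio at g_m is below 1 - p = q(Q) lies between
{√m (Q̂_m - Q)/c < x} and {√m (Q̂_m - Q)/c ≤ x}. With a positive denominator it says that ∑
(Y_i(g_m) - q(Q) α_i) < 0. Divided by σ√m, this sum is the sum of three terms: the normalized sum of
the Z_i(Q), which is asymptotically normal; the normalized sum of the Z_i(g_m) - Z_i(Q), whose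
second moment vanishes; and the drift √m (q(g_m) - q(Q))/σ times the mean of the α_i, which tends to
-x. Hence the limit is Φ(x) (`tendsto_measureReal_sum_lt`, `ratioQuantile_clt`). The second moment
vanishes because a monotone process with continuous mean is almost surely continuous at a given
point, and it is dominated by its values at two neighbouring levels (`tendsto_integral_sq_sub`).

The heart of the matter is E[Z(γ)] = 0, that is E[Y(γ)] = q(γ) E[α], which has two halves.

Unbiasedness of the weights (`lintegral_weightedCount`). The job with index n is weighted by the
likelihood ratio at the earlier of its entry into service and the switch. Fix the event number and
the numbers of arrivals and entries at that moment. What is then known of the input is the values of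
finitely many single times, and that every current inter-arrival time exceeds its age
(`Core.same_run`). So the ratio is a product of density ratios times ratios of tails, and by
memorylessness the unrealized part, including the residual inter-arrival times, may be drawn afresh
from the original law. `lintegral_graft` is this statement for abstract product measures,
`lintegral_splice` for queue inputs; summing over the countable partition `stopEvent` gives the
claim.

Regeneration (`tsum_measure_lateEvent`). With all ratios equal to 1, `lintegral_splice` becomes the
strong Markov property at the end of the first cycle. It yields a renewal equation, in the job
index, for f n = P(R_n > γ). Convolving f with the tail probabilities of α telescopes to the partial
sums of the expected number of late jobs per cycle. As f is known to converge to q(γ), dominated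
convergence identifies the total; no renewal theorem is needed.

Cycles are finite because, by the law of large numbers and stability, work cannot keep up with time
(`exists_idle_gt`). The norming constants are nondegenerate. A class-k job that finds the system
empty has its own exponential service time as response time, which bounds the slope of F from below
(`deriv_cdf_pos`). And α takes different values with positive probability and is independent of Y,
so the variance of Z is positive (`variance_sub_pos`). Square integrability of Z passes to Y and α
by freezing one of the two independent variables. -/

noncomputable section
namespace PriorityQueue

/-! ### Product measures: splicing, change of density and memoryless residuals -/

section Product

open Classical in
/-- Coordinates in `I` from the first point, all others from the second one. -/
def pick {ι : Type*} (I : Finset ι) (x y : ι → ℝ) : ι → ℝ := fun j => if j ∈ I then x j else y j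

lemma measurable_pick {ι : Type*} (I : Finset ι) :
    Measurable fun p : (ι → ℝ) × (ι → ℝ) => pick I p.1 p.2 := by
  refine measurable_pi_lambda _ fun j => ?_
  unfold pick
  split_ifs <;> fun_prop

variable {ι : Type*} (m m' : ι → Measure ℝ) [∀ j, IsProbabilityMeasure (m j)]
  [∀ j, IsProbabilityMeasure (m' j)]

-- Boxes determine a product measure, and the preimage of a box under `pick` is a product of two
-- boxes, one for each source.
open Classical in
lemma map_pick_infinitePi (I : Finset ι) :
    ((Measure.infinitePi m).prod (Measure.infinitePi m')).map (fun p => pick I p.1 p.2)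
      = Measure.infinitePi (fun j => if j ∈ I then m j else m' j) := by
  have : ∀ j, IsProbabilityMeasure (if j ∈ I then m j else m' j) := fun j => by
    split_ifs <;> infer_instance
  refine Measure.eq_infinitePi _ fun s t ht => ?_
  rw [Measure.map_apply (measurable_pick I) (.pi s.countable_toSet fun _ _ => ht _)]
  have : (fun p : (ι → ℝ) × (ι → ℝ) => pick I p.1 p.2) ⁻¹' Set.pi s t
      = (Set.pi (s.filter (· ∈ I) : Finset ι) t) ×ˢ (Set.pi (s.filter (· ∉ I) : Finset ι) t) := by
    ext p
    simp only [Set.mem_preimage, Set.mem_pi, Set.mem_prod, Finset.coe_filter, Set.mem_ofPred_eq,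
      pick, Finset.mem_coe]
    constructor
    · intro h
      refine ⟨fun j hj => ?_, fun j hj => ?_⟩
      · simpa [hj.2] using h j hj.1
      · simpa [hj.2] using h j hj.1
    · rintro ⟨h1, h2⟩ j hj
      split_ifs with hI
      · exact h1 j ⟨hj, hI⟩
      · exact h2 j ⟨hj, hI⟩
  rw [this, Measure.prod_prod, Measure.infinitePi_pi _ (fun i _ => ht i),
    Measure.infinitePi_pi _ (fun i _ => ht i)]
  rw [← Finset.prod_filter_mul_prod_filter_not s (· ∈ I)]
  congr 1
  · exact Finset.prod_congr rfl fun j hj => by simp [(Finset.mem_filter.1 hj).2]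
  · exact Finset.prod_congr rfl fun j hj => by simp [(Finset.mem_filter.1 hj).2]

-- Resampling every coordinate except `j` from an independent copy does not change the law. In this
-- form coordinate `j` is independent of the rest, so the integral over a box factors and only the
-- factor at `j` sees the density.
open Classical in
lemma withDensity_eval_infinitePi (j : ι) (g : ℝ → ENNReal) (hg : Measurable g)
    [IsProbabilityMeasure ((m j).withDensity g)] :
    (Measure.infinitePi m).withDensity (fun x => g (x j))
      = Measure.infinitePi (Function.update m j ((m j).withDensity g)) := by
  have : ∀ i, IsProbabilityMeasure (Function.update m j ((m j).withDensity g) i) := fun i => by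
    by_cases h : i = j
    · subst h; simpa
    · simp [h]; infer_instance
  have hself : ((Measure.infinitePi m).prod (Measure.infinitePi m)).map
      (fun p => pick {j} p.1 p.2) = Measure.infinitePi m := by
    rw [map_pick_infinitePi]; simp
  refine Measure.eq_infinitePi _ fun s t ht => ?_
  have hbox : MeasurableSet (Set.pi (s : Set ι) t) := .pi s.countable_toSet fun _ _ => ht _
  set t' : Set ℝ := if j ∈ s then t j else Set.univ with ht'
  have mt' : MeasurableSet t' := by rw [ht']; split_ifs; exacts [ht j, .univ]
  have hbox' : MeasurableSet (Set.pi (s.erase j : Finset ι) t) :=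
    .pi (s.erase j).countable_toSet fun _ _ => ht _
  rw [withDensity_apply _ hbox, ← lintegral_indicator hbox]
  have hmeas : Measurable ((Set.pi (s : Set ι) t).indicator fun x : ι → ℝ => g (x j)) :=
    (hg.comp (measurable_pi_apply j)).indicator hbox
  rw [← hself, lintegral_map hmeas (measurable_pick _)]
  have key : ∀ p : (ι → ℝ) × (ι → ℝ),
      (Set.pi (s : Set ι) t).indicator (fun x => g (x j)) (pick {j} p.1 p.2)
        = t'.indicator g (p.1 j) * (Set.pi (s.erase j : Finset ι) t).indicator 1 p.2 := by
    intro p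
    have hmem : pick {j} p.1 p.2 ∈ Set.pi (s : Set ι) t ↔
        p.1 j ∈ t' ∧ p.2 ∈ Set.pi (s.erase j : Finset ι) t := by
      simp only [Set.mem_pi, pick, Finset.mem_singleton, Finset.mem_coe, Finset.mem_erase]
      constructor
      · intro h
        refine ⟨?_, fun i hi => by simpa [hi.1] using h i hi.2⟩
        rw [ht']
        split_ifs with hj
        · simpa using h j hj
        · trivial
      · rintro ⟨h1, h2⟩ i hi
        by_cases hij : i = j
        · subst hij; simpa [ht', hi] using h1
        · simpa [hij] using h2 i ⟨hij, hi⟩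
    by_cases h1 : p.1 j ∈ t' <;> by_cases h2 : p.2 ∈ Set.pi (s.erase j : Finset ι) t <;>
      simp only [Set.indicator, hmem, h1, h2, and_true, and_false, if_true, if_false, mul_zero,
        mul_one, Pi.one_apply]
    simp [pick]
  simp_rw [key]
  have mg : Measurable fun x : ι → ℝ => t'.indicator g (x j) :=
    (hg.indicator mt').comp (measurable_pi_apply j)
  rw [lintegral_prod_mul mg.aemeasurable (measurable_one.indicator hbox').aemeasurable, lintegral_indicator_one hbox',
    Measure.infinitePi_pi _ (fun i _ => ht i)]
  have e1 : ∫⁻ x, t'.indicator g (x j) ∂Measure.infinitePi m = ((m j).withDensity g) t' := by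
    rw [withDensity_apply _ mt', ← lintegral_indicator mt',
      ← (measurePreserving_eval_infinitePi m j).lintegral_comp (hg.indicator mt')]
  rw [e1]
  have e2 : ∏ i ∈ s.erase j, (m i) (t i)
      = ∏ i ∈ s.erase j, Function.update m j ((m j).withDensity g) i (t i) :=
    Finset.prod_congr rfl fun i hi => by simp [(Finset.mem_erase.1 hi).1]
  rw [e2]
  by_cases hj : j ∈ s
  · rw [← Finset.mul_prod_erase s _ hj]; simp [ht', hj]
  · simp [ht', hj, measure_univ]

open Classical in
lemma withDensity_prod_infinitePi (I : Finset ι) (g : ι → ℝ → ENNReal)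
    (hg : ∀ j ∈ I, Measurable (g j)) (h : ∀ j ∈ I, (m j).withDensity (g j) = m' j) :
    (Measure.infinitePi m).withDensity (fun x => ∏ j ∈ I, g j (x j))
      = Measure.infinitePi (fun j => if j ∈ I then m' j else m j) := by
  induction I using Finset.induction_on with
  | empty => simp
  | insert j I hj ih =>
    have : ∀ j, IsProbabilityMeasure (if j ∈ I then m' j else m j) := fun j => by
      split_ifs <;> infer_instance
    have ih' := ih (fun i hi => hg i (Finset.mem_insert_of_mem hi))
      (fun i hi => h i (Finset.mem_insert_of_mem hi))
    have hgj := hg j (Finset.mem_insert_self _ _)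
    have hprod : Measurable (fun x : ι → ℝ => ∏ i ∈ I, g i (x i)) :=
      Finset.measurable_fun_prod _ fun i hi =>
        (hg i (Finset.mem_insert_of_mem hi)).comp (measurable_pi_apply i)
    have hfun : (fun x : ι → ℝ => ∏ i ∈ insert j I, g i (x i))
        = (fun x => ∏ i ∈ I, g i (x i)) * fun x => g j (x j) := by
      ext x; simp [Finset.prod_insert hj, mul_comm]
    have mgj : Measurable fun x : ι → ℝ => g j (x j) := hgj.comp (measurable_pi_apply j)
    rw [hfun, withDensity_mul _ hprod mgj, ih']
    have hval : (if j ∈ I then m' j else m j).withDensity (g j) = m' j := by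
      simp [hj, h j (Finset.mem_insert_self _ _)]
    have : IsProbabilityMeasure ((if j ∈ I then m' j else m j).withDensity (g j)) := by
      rw [hval]; infer_instance
    rw [withDensity_eval_infinitePi (fun j => if j ∈ I then m' j else m j) j (g j) hgj]
    congr 1
    ext1 i
    by_cases hi : i = j
    · subst hi; simp only [Function.update_self, hval]; simp
    · simp [hi]

open Classical in
/-- Adding `h j` to the coordinates in `R`. -/
def shiftOn (R : Finset ι) (h : ι → ℝ) (y : ι → ℝ) : ι → ℝ :=
  fun j => if j ∈ R then h j + y j else y j

lemma measurable_shiftOn (R : Finset ι) (h : ι → ℝ) : Measurable (shiftOn R h) := by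
  refine measurable_pi_lambda _ fun j => ?_
  unfold shiftOn
  split_ifs <;> fun_prop

/-- A law on the line with the residual life property of exponential laws. -/
structure Memoryless (μ : Measure ℝ) : Prop where
  tail_ne_zero : ∀ h, 0 ≤ h → μ (Set.Ioi h) ≠ 0
  map_add : ∀ h, 0 ≤ h → μ.map (fun x => h + x)
    = μ.withDensity (fun x => (μ (Set.Ioi h))⁻¹ * (Set.Ioi h).indicator 1 x)

/-- Coordinatewise memorylessness: a shift by the age is conditioning on exceeding the age. The
conditioning constants are moved to the left as a product of tails, the form in which they cancel
against the tail ratios of the likelihood. -/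
lemma lintegral_shiftOn_infinitePi (R : Finset ι) (hR : ∀ j ∈ R, Memoryless (m j))
    (h : ι → ℝ) (h0 : ∀ j ∈ R, 0 ≤ h j) (F : (ι → ℝ) → ENNReal) (hF : Measurable F) :
    (∏ j ∈ R, m j (Set.Ioi (h j))) * ∫⁻ y, F (shiftOn R h y) ∂Measure.infinitePi m
      = ∫⁻ y, (Set.pi (R : Set ι) fun j => Set.Ioi (h j)).indicator F y ∂Measure.infinitePi m := by
  classical
  set m'' : ι → Measure ℝ := fun j => if j ∈ R then (m j).map (fun x => h j + x) else m j with hm''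
  have : ∀ j, IsProbabilityMeasure (m'' j) := fun j => by
    simp only [hm'']
    split_ifs
    · exact Measure.isProbabilityMeasure_map (by fun_prop)
    · infer_instance
  have hmeas : ∀ j, Measurable fun x : ℝ => (m j (Set.Ioi (h j)))⁻¹ *
      (Set.Ioi (h j)).indicator (1 : ℝ → ENNReal) x := fun j =>
    (measurable_one.indicator measurableSet_Ioi).const_mul _
  have h1 := withDensity_prod_infinitePi m m'' R
    (fun j x => (m j (Set.Ioi (h j)))⁻¹ * (Set.Ioi (h j)).indicator 1 x)
    (fun j _ => hmeas j) (fun j hj => by simp [hm'', hj, (hR j hj).map_add _ (h0 j hj)])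
  have h2 : (Measure.infinitePi m).map (shiftOn R h)
      = Measure.infinitePi (fun j => if j ∈ R then m'' j else m j) := by
    have := Measure.infinitePi_map_pi m (f := fun j x => if j ∈ R then h j + x else x)
      (fun j => by split_ifs <;> fun_prop)
    refine Eq.trans this ?_
    congr 1
    ext1 j
    by_cases hj : j ∈ R
    · simp [hm'', hj]
    · simp [hj]
  have mprod : Measurable fun x : ι → ℝ => ∏ j ∈ R, ((m j (Set.Ioi (h j)))⁻¹ *
      (Set.Ioi (h j)).indicator (1 : ℝ → ENNReal) (x j)) :=
    Finset.measurable_fun_prod _ fun i _ => (hmeas i).comp (measurable_pi_apply i)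
  rw [← lintegral_map hF (measurable_shiftOn R h), h2, ← h1,
    lintegral_withDensity_eq_lintegral_mul _ mprod hF, ← lintegral_const_mul _ (mprod.mul hF)]
  refine lintegral_congr fun y => ?_
  rw [Pi.mul_apply, Finset.prod_mul_distrib, ← mul_assoc, ← mul_assoc, ← Finset.prod_mul_distrib]
  rw [Finset.prod_congr rfl fun j hj => ENNReal.mul_inv_cancel
    ((hR j hj).tail_ne_zero _ (h0 j hj)) (measure_ne_top _ _)]
  rw [Finset.prod_const_one, one_mul]
  by_cases hy : y ∈ Set.pi (R : Set ι) fun j => Set.Ioi (h j)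
  · rw [Set.indicator_of_mem hy, Finset.prod_eq_one, one_mul]
    intro j hj
    rw [Set.indicator_of_mem (hy j hj)]; rfl
  · rw [Set.indicator_of_notMem hy]
    simp only [Set.mem_pi, not_forall] at hy
    obtain ⟨j, hj, hy⟩ := hy
    rw [Finset.prod_eq_zero hj (Set.indicator_of_notMem hy _), zero_mul]

open Classical in
/-- Coordinates in `I` from `w`, residuals beyond `h` at `R`, all others from `v`. -/
def graft (I R : Finset ι) (h : ι → ℝ) (w v : ι → ℝ) : ι → ℝ :=
  fun j => if j ∈ I then w j else if j ∈ R then h j + v j else v j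

/-- Change of measure at a stopping event: `E` depends on the coordinates in `I` and on the
coordinates in `R` being beyond their ages `h`. -/
theorem lintegral_graft [Countable ι] (I R : Finset ι) (hIR : Disjoint I R)
    (hm0 : ∀ j, ∀ᵐ x ∂m j, 0 < x) (hm0' : ∀ j, ∀ᵐ x ∂m' j, 0 < x)
    (g : ι → ℝ → ENNReal) (hg : ∀ j ∈ I, Measurable (g j))
    (hgm : ∀ j ∈ I, (m' j).withDensity (g j) = m j)
    (hR : ∀ j ∈ R, Memoryless (m j)) (hR' : ∀ j ∈ R, ∀ h, 0 ≤ h → m' j (Set.Ioi h) ≠ 0)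
    (ha : ∀ j ∈ R, NullSingletonClass (m j)) (ha' : ∀ j ∈ R, NullSingletonClass (m' j))
    (E : Set (ι → ℝ)) (hE : MeasurableSet E) (h : (ι → ℝ) → ι → ℝ)
    (hh : Measurable h)
    (hE1 : ∀ x ∈ E, ∀ j ∈ R, 0 ≤ h x j ∧ h x j ≤ x j)
    (hE2 : ∀ x ∈ E, ∀ x', (∀ j, 0 < x j) → (∀ j, 0 < x' j) → (∀ j ∈ I, x' j = x j) →
      (∀ j ∈ R, h x j < x' j) → x' ∈ E ∧ ∀ j ∈ R, h x' j = h x j)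
    (F : (ι → ℝ) → ENNReal) (hF : Measurable F) :
    ∫⁻ p, E.indicator (fun w => (∏ j ∈ I, g j (w j)) *
        ∏ j ∈ R, (m j (Set.Ioi (h w j)) / m' j (Set.Ioi (h w j)))) p.1 *
        F (graft I R (h p.1) p.1 p.2)
        ∂((Measure.infinitePi m').prod (Measure.infinitePi m))
      = ∫⁻ v, E.indicator F v ∂Measure.infinitePi m := by
  classical
  have hpos : ∀ᵐ x ∂Measure.infinitePi m, ∀ j, 0 < x j := ae_all_iff.2 fun j =>
    (measurePreserving_eval_infinitePi m j).quasiMeasurePreserving.ae (hm0 j)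
  have hpos' : ∀ᵐ x ∂Measure.infinitePi m', ∀ j, 0 < x j := ae_all_iff.2 fun j =>
    (measurePreserving_eval_infinitePi m' j).quasiMeasurePreserving.ae (hm0' j)
  -- `hE1` gives only a weak inequality between age and coordinate, whereas `hE2` needs a strict
  -- one; the absence of atoms closes the gap.
  have hne : ∀ (c : ι → ℝ), ∀ᵐ x ∂Measure.infinitePi m, ∀ j ∈ R, x j ≠ c j := by
    intro c
    refine ae_all_iff.2 fun j => ?_
    by_cases hj : j ∈ R
    · have := ha j hj
      have := (measurePreserving_eval_infinitePi m j).quasiMeasurePreserving.ae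
        (p := fun y => y ≠ c j) (by simp only [ae_iff, not_not]; exact measure_singleton _)
      filter_upwards [this] with x hx _ using hx
    · exact Eventually.of_forall fun x h => absurd h hj
  have hne' : ∀ (c : ι → ℝ), ∀ᵐ x ∂Measure.infinitePi m', ∀ j ∈ R, x j ≠ c j := by
    intro c
    refine ae_all_iff.2 fun j => ?_
    by_cases hj : j ∈ R
    · have := ha' j hj
      have := (measurePreserving_eval_infinitePi m' j).quasiMeasurePreserving.ae
        (p := fun y => y ≠ c j) (by simp only [ae_iff, not_not]; exact measure_singleton _)
      filter_upwards [this] with x hx _ using hx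
    · exact Eventually.of_forall fun x h => absurd h hj
  set ratio : (ι → ℝ) → ENNReal := fun w =>
    ∏ j ∈ R, (m j (Set.Ioi (h w j)) / m' j (Set.Ioi (h w j))) with hratio
  have htail : ∀ μ : Measure ℝ, Measurable fun t : ℝ => μ (Set.Ioi t) := fun μ =>
    Antitone.measurable fun a b hab => measure_mono (Set.Ioi_subset_Ioi hab)
  have mratio : Measurable ratio := Finset.measurable_fun_prod _ fun j _ =>
    ((htail (m j)).comp ((measurable_pi_apply j).comp hh)).div
      ((htail (m' j)).comp ((measurable_pi_apply j).comp hh))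
  have mgraft : Measurable fun p : (ι → ℝ) × (ι → ℝ) => graft I R (h p.1) p.1 p.2 := by
    refine measurable_pi_lambda _ fun j => ?_
    have : Measurable fun p : (ι → ℝ) × (ι → ℝ) => h p.1 j :=
      (measurable_pi_apply j).comp (hh.comp measurable_fst)
    unfold graft
    split_ifs <;> fun_prop
  have mdens : Measurable fun w : ι → ℝ => ∏ j ∈ I, g j (w j) :=
    Finset.measurable_fun_prod _ fun j hj => (hg j hj).comp (measurable_pi_apply j)
  set A : (ι → ℝ) → ENNReal := fun w => E.indicator ratio w *
    ∫⁻ v, F (graft I R (h w) w v) ∂Measure.infinitePi m with hA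
  have mA : Measurable A := (mratio.indicator hE).mul (hF.comp mgraft).lintegral_prod_right'
  have mind : Measurable (E.indicator fun w : ι → ℝ => (∏ j ∈ I, g j (w j)) * ratio w) :=
    (mdens.mul mratio).indicator hE
  have mint : Measurable fun p : (ι → ℝ) × (ι → ℝ) =>
      E.indicator (fun w => (∏ j ∈ I, g j (w j)) * ratio w) p.1 *
        F (graft I R (h p.1) p.1 p.2) := (mind.comp measurable_fst).mul (hF.comp mgraft)
  rw [lintegral_prod _ mint.aemeasurable]
  have step1 : ∀ w, ∫⁻ v, E.indicator (fun w => (∏ j ∈ I, g j (w j)) * ratio w) w *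
      F (graft I R (h w) w v) ∂Measure.infinitePi m = (∏ j ∈ I, g j (w j)) * A w := by
    intro w
    have : Measurable fun v : ι → ℝ => F (graft I R (h w) w v) :=
      hF.comp (mgraft.comp measurable_prodMk_left)
    rw [lintegral_const_mul _ this]
    by_cases hw : w ∈ E
    · simp only [hA, Set.indicator_of_mem hw, mul_assoc]
    · simp [hA, Set.indicator_of_notMem hw]
  simp only [step1]
  have hhyb := withDensity_prod_infinitePi m' m I g hg hgm
  have hRHS : Measure.infinitePi m
      = ((Measure.infinitePi m).prod (Measure.infinitePi m)).map fun p => pick I p.1 p.2 := by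
    rw [map_pick_infinitePi]; simp
  have hLHS := map_pick_infinitePi m m' I
  -- The densities turn the law of the coordinates in `I` from `m'` into `m`. From here on these
  -- coordinates `x` are fixed and only the rest `r` still has law `m'`.
  have : ∫⁻ w, (∏ j ∈ I, g j (w j)) * A w ∂Measure.infinitePi m'
      = ∫⁻ x, ∫⁻ r, A (pick I x r) ∂Measure.infinitePi m' ∂Measure.infinitePi m := by
    have e := lintegral_withDensity_eq_lintegral_mul (Measure.infinitePi m') mdens mA
    simp only [Pi.mul_apply] at e
    have mAp : Measurable fun p : (ι → ℝ) × (ι → ℝ) => A (pick I p.1 p.2) :=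
      mA.comp (measurable_pick I)
    rw [← e, hhyb, ← hLHS, lintegral_map mA (measurable_pick I),
      lintegral_prod _ mAp.aemeasurable]
  rw [this]
  have mEp : Measurable fun p : (ι → ℝ) × (ι → ℝ) => E.indicator F (pick I p.1 p.2) :=
    (hF.indicator hE).comp (measurable_pick I)
  conv_rhs => rw [hRHS, lintegral_map (hF.indicator hE) (measurable_pick I),
      lintegral_prod _ mEp.aemeasurable]
  refine lintegral_congr_ae ?_
  filter_upwards [hpos] with x hx
  by_cases hex : ∃ r0 : ι → ℝ, (∀ j, 0 < r0 j) ∧ pick I x r0 ∈ E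
  swap
  · push Not at hex
    rw [lintegral_congr_ae (g := fun _ => 0), lintegral_congr_ae (g := fun _ => 0)
      (μ := Measure.infinitePi m)]
    · simp
    · filter_upwards [hpos] with r hr
      exact Set.indicator_of_notMem (hex r hr) _
    · filter_upwards [hpos'] with r hr
      simp [hA, Set.indicator_of_notMem (hex r hr)]
  obtain ⟨r0, hr0, hr0E⟩ := hex
  have ppos : ∀ r : ι → ℝ, (∀ j, 0 < r j) → ∀ j, 0 < pick I x r j := by
    intro r hr j
    unfold pick
    split_ifs
    exacts [hx j, hr j]
  have pI : ∀ r r' : ι → ℝ, ∀ j ∈ I, pick I x r j = pick I x r' j := by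
    intro r r' j hj
    simp [pick, hj]
  have pR : ∀ r : ι → ℝ, ∀ j ∈ R, pick I x r j = r j := by
    intro r j hj
    have : j ∉ I := fun hI => Finset.disjoint_left.1 hIR hI hj
    simp [pick, this]
  set H := h (pick I x r0) with hH
  have H0 : ∀ j ∈ R, 0 ≤ H j := fun j hj => (hE1 _ hr0E j hj).1
  have fwd : ∀ r : ι → ℝ, (∀ j, 0 < r j) → pick I x r ∈ E → ∀ j ∈ R, h (pick I x r) j = H j := by
    intro r hr hrE j hj
    -- A common continuation beyond both age vectors: by `hE2` from either side, its ages equal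
    -- those at `r` and those at `r0`. So the ages are constant on the section of `E`, which is
    -- therefore a box up to a null set.
    set r1 : ι → ℝ := fun j => max 0 (max (H j) (h (pick I x r) j)) + 1
    have hr1 : ∀ j, 0 < r1 j := fun j => by positivity
    have a1 := hE2 _ hr0E (pick I x r1) (ppos _ hr0) (ppos _ hr1) (pI _ _) (fun i hi => by
      rw [pR _ i hi]
      exact lt_of_le_of_lt ((le_max_left _ _).trans (le_max_right _ _)) (lt_add_one _))
    have a2 := hE2 _ hrE (pick I x r1) (ppos _ hr) (ppos _ hr1) (pI _ _) (fun i hi => by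
      rw [pR _ i hi]
      exact lt_of_le_of_lt ((le_max_right _ _).trans (le_max_right _ _)) (lt_add_one _))
    rw [← a2.2 j hj, a1.2 j hj]
  have bwd : ∀ r : ι → ℝ, (∀ j, 0 < r j) → (∀ j ∈ R, H j < r j) → pick I x r ∈ E := by
    intro r hr hrR
    exact (hE2 _ hr0E _ (ppos _ hr0) (ppos _ hr) (pI _ _) (fun j hj => by
      rw [pR _ j hj]; exact hrR j hj)).1
  set B : Set (ι → ℝ) := Set.pi (R : Set ι) fun j => Set.Ioi (H j) with hB
  have mB : MeasurableSet B := .pi R.countable_toSet fun _ _ => measurableSet_Ioi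
  have hiff : ∀ r : ι → ℝ, (∀ j, 0 < r j) → (∀ j ∈ R, r j ≠ H j) →
      (pick I x r ∈ E ↔ r ∈ B) := by
    intro r hr hrne
    constructor
    · intro hrE j hj
      have := (hE1 _ hrE j hj).2
      rw [fwd r hr hrE j hj, pR _ j hj] at this
      exact lt_of_le_of_ne this (hrne j hj).symm
    · intro hrB
      exact bwd r hr hrB
  set F' : (ι → ℝ) → ENNReal := fun v => F (pick I x v) with hF'
  have mF' : Measurable F' := hF.comp ((measurable_pick I).comp measurable_prodMk_left)
  have hL : ∫⁻ r, A (pick I x r) ∂Measure.infinitePi m'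
      = (∏ j ∈ R, m j (Set.Ioi (H j))) *
        ∫⁻ v, F' (shiftOn R H v) ∂Measure.infinitePi m := by
    have : ∫⁻ r, A (pick I x r) ∂Measure.infinitePi m'
        = ∫⁻ r, B.indicator (fun _ => (∏ j ∈ R, (m j (Set.Ioi (H j)) / m' j (Set.Ioi (H j)))) *
          ∫⁻ v, F' (shiftOn R H v) ∂Measure.infinitePi m) r ∂Measure.infinitePi m' := by
      refine lintegral_congr_ae ?_
      filter_upwards [hpos', hne' H] with r hr hrne
      by_cases hrE : pick I x r ∈ E
      · rw [Set.indicator_of_mem ((hiff r hr hrne).1 hrE)]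
        simp only [hA, Set.indicator_of_mem hrE]
        have hfr := fwd r hr hrE
        congr 1
        · exact Finset.prod_congr rfl fun j hj => by rw [hfr j hj]
        · refine lintegral_congr fun v => ?_
          simp only [hF']
          congr 1
          ext j
          by_cases hj : j ∈ I
          · simp [graft, pick, hj]
          · by_cases hj' : j ∈ R
            · simp [graft, pick, hj, hj', shiftOn, hfr j hj']
            · simp [graft, pick, hj, hj', shiftOn]
      · rw [Set.indicator_of_notMem (fun hb => hrE ((hiff r hr hrne).2 hb))]
        simp [hA, Set.indicator_of_notMem hrE]
    -- The box has `m'`-mass equal to the product of the sampling tails, which cancels the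
    -- denominators of the ratio.
    rw [this, lintegral_indicator_const mB, hB,
      Measure.infinitePi_pi _ (fun _ _ => measurableSet_Ioi), mul_comm, ← mul_assoc,
      ← Finset.prod_mul_distrib]
    congr 1
    refine Finset.prod_congr rfl fun j hj => ?_
    exact ENNReal.mul_div_cancel (hR' j hj _ (H0 j hj)) (measure_ne_top _ _)
  rw [hL, lintegral_shiftOn_infinitePi m R hR H H0 F' mF']
  refine lintegral_congr_ae ?_
  filter_upwards [hpos, hne H] with v hv hvne
  by_cases hvE : pick I x v ∈ E
  · rw [Set.indicator_of_mem hvE, Set.indicator_of_mem ((hiff v hv hvne).1 hvE)]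
  · rw [Set.indicator_of_notMem hvE,
      Set.indicator_of_notMem (fun hb => hvE ((hiff v hv hvne).2 hb))]

end Product

end PriorityQueue
end

noncomputable section
namespace PriorityQueue
variable {K : ℕ}

/-! ### The queue driven by a single input -/

/-- The part of the simulation state that describes the queue. -/
@[ext]
structure Core (K : ℕ) where
  time : ℝ
  arr : Fin K → ℕ
  ent : Fin K → ℕ
  next : Fin K → ℝ
  dep : Option ℝ

/-- The queue in a simulation state. -/
def State.core (s : State K) : Core K := ⟨s.time, s.arr, s.ent, s.next, s.dep⟩

open Classical in
/-- The first class among those with the earliest next arrival. -/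
def firstClass (k : Fin K) (next : Fin K → ℝ) : Fin K :=
  let first : Finset (Fin K) := Finset.univ.filter fun l => ∀ j, next l ≤ next j
  if h : first.Nonempty then first.min' h else k

lemma nextClass_eq (k : Fin K) (s : State K) : nextClass k s = firstClass k s.next := rfl

lemma firstClass_spec (k : Fin K) (next : Fin K → ℝ) :
    (∀ j, next (firstClass k next) ≤ next j) ∧
      ∀ j < firstClass k next, next (firstClass k next) < next j := by
  classical
  set first : Finset (Fin K) := Finset.univ.filter fun l => ∀ j, next l ≤ next j with hfirst
  have hne : first.Nonempty := by
    obtain ⟨l, -, hl⟩ := Finset.exists_min_image Finset.univ next ⟨k, Finset.mem_univ k⟩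
    exact ⟨l, by simp only [hfirst, Finset.mem_filter]; exact ⟨Finset.mem_univ _, fun j => hl j (Finset.mem_univ j)⟩⟩
  have heq : firstClass k next = first.min' hne := by
    unfold firstClass
    exact dif_pos hne
  have hmem : ∀ j, next (firstClass k next) ≤ next j := by
    have := Finset.min'_mem first hne
    rw [← heq, hfirst, Finset.mem_filter] at this
    exact this.2
  refine ⟨hmem, fun j hj => ?_⟩
  by_contra hlt
  push Not at hlt
  have : j ∈ first := by
    simp only [hfirst, Finset.mem_filter, Finset.mem_univ, true_and]
    exact fun i => hlt.trans (hmem i)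
  have := Finset.min'_le first j this
  rw [← heq] at this
  exact absurd hj (not_lt.2 this)

/-- Minimality together with the tie rule pins the class down, so later arguments can use these
inequalities instead of a minimum over a filtered set. -/
lemma firstClass_eq (k : Fin K) (next : Fin K → ℝ) (l : Fin K) (h1 : ∀ j, next l ≤ next j)
    (h2 : ∀ j < l, next l < next j) : firstClass k next = l := by
  obtain ⟨s1, s2⟩ := firstClass_spec k next
  rcases lt_trichotomy (firstClass k next) l with h | h | h
  · exact absurd (h2 _ h) (not_lt.2 (s1 l))
  · exact h
  · exact absurd (s2 _ h) (not_lt.2 (h1 _))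

namespace Core

/-- The queue at time `0`. -/
def start (v : Drive K) : Core K := ⟨0, fun _ => 0, fun _ => 0, fun l => (v l 0).1, none⟩

/-- Arrival of a class-`l` job. -/
def arrive (v : Drive K) (l : Fin K) (c : Core K) : Core K where
  time := c.next l
  arr := Function.update c.arr l (c.arr l + 1)
  next := Function.update c.next l (c.next l + (v l (c.arr l + 1)).1)
  ent := if c.dep.isNone then Function.update c.ent l (c.ent l + 1) else c.ent
  dep := if c.dep.isNone then some (c.next l + (v l (c.ent l)).2) else c.dep

/-- Departure at time `t`. -/
def depart (v : Drive K) (t : ℝ) (c : Core K) : Core K :=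
  let waiting : Finset (Fin K) := Finset.univ.filter fun l => c.ent l < c.arr l
  if h : waiting.Nonempty then
    { c with
      time := t
      ent := Function.update c.ent (waiting.min' h) (c.ent (waiting.min' h) + 1)
      dep := some (t + (v (waiting.min' h) (c.ent (waiting.min' h))).2) }
  else { c with time := t, dep := none }

/-- Process the next event. -/
def step (k : Fin K) (v : Drive K) (c : Core K) : Core K :=
  match c.dep with
  | none => arrive v (firstClass k c.next) c
  | some t => if c.next (firstClass k c.next) < t then arrive v (firstClass k c.next) c
      else depart v t c

/-- The queue after each number of events. -/
def run (k : Fin K) (v : Drive K) : ℕ → Core K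
  | 0 => start v
  | j + 1 => step k v (run k v j)

/-- The highest waiting class is `m`. -/
def IsHead (c : Core K) (m : Fin K) : Prop :=
  c.ent m < c.arr m ∧ ∀ l < m, c.arr l ≤ c.ent l

lemma depart_of_isHead (v : Drive K) (t : ℝ) (c : Core K) (m : Fin K) (hm : c.IsHead m) :
    depart v t c = { c with
      time := t
      ent := Function.update c.ent m (c.ent m + 1)
      dep := some (t + (v m (c.ent m)).2) } := by
  have hne : (Finset.univ.filter fun l => c.ent l < c.arr l).Nonempty :=
    ⟨m, by simp [hm.1]⟩
  have hmin : (Finset.univ.filter fun l => c.ent l < c.arr l).min' hne = m := by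
    apply le_antisymm
    · exact Finset.min'_le _ _ (by simp [hm.1])
    · refine Finset.le_min' _ _ _ fun l hl => ?_
      by_contra h
      exact absurd (Finset.mem_filter.1 hl).2 (not_lt.2 (hm.2 l (not_le.1 h)))
  unfold depart
  simp only [hne, dite_true, hmin]

lemma depart_of_empty (v : Drive K) (t : ℝ) (c : Core K) (hc : ∀ l, c.arr l ≤ c.ent l) :
    depart v t c = { c with time := t, dep := none } := by
  have hne : ¬ (Finset.univ.filter fun l => c.ent l < c.arr l).Nonempty := by
    rintro ⟨l, hl⟩
    exact absurd (Finset.mem_filter.1 hl).2 (not_lt.2 (hc l))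
  unfold depart
  simp only [hne, dite_false]

lemma exists_isHead (c : Core K) : (∃ m, c.IsHead m) ∨ ∀ l, c.arr l ≤ c.ent l := by
  by_cases h : ∀ l, c.arr l ≤ c.ent l
  · exact Or.inr h
  · push Not at h
    obtain ⟨l, hl⟩ := h
    have hne : (Finset.univ.filter fun l => c.ent l < c.arr l).Nonempty := ⟨l, by simp [hl]⟩
    refine Or.inl ⟨_, (Finset.mem_filter.1 (Finset.min'_mem _ hne)).2, fun i hi => ?_⟩
    by_contra hlt
    exact absurd hi (not_lt.2 (Finset.min'_le _ i (by simpa using hlt)))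

/-- The earliest next arrival is of class `l`, ties being broken in favour of the smaller class. -/
def IsNext (c : Core K) (l : Fin K) : Prop :=
  (∀ j, c.next l ≤ c.next j) ∧ ∀ j < l, c.next l < c.next j

/-- The four kinds of events. -/
inductive Event (v : Drive K) (c : Core K) : Core K → Prop
  | arriveIdle (l : Fin K) (hl : c.IsNext l) (hd : c.dep = none) : Event v c
      { time := c.next l
        arr := Function.update c.arr l (c.arr l + 1)
        next := Function.update c.next l (c.next l + (v l (c.arr l + 1)).1)
        ent := Function.update c.ent l (c.ent l + 1)
        dep := some (c.next l + (v l (c.ent l)).2) }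
  | arriveBusy (l : Fin K) (t : ℝ) (hl : c.IsNext l) (hd : c.dep = some t) (ht : c.next l < t) :
      Event v c
      { time := c.next l
        arr := Function.update c.arr l (c.arr l + 1)
        next := Function.update c.next l (c.next l + (v l (c.arr l + 1)).1)
        ent := c.ent
        dep := some t }
  | departBusy (t : ℝ) (m : Fin K) (hd : c.dep = some t) (ht : ∀ j, t ≤ c.next j)
      (hm : c.IsHead m) : Event v c
      { time := t
        arr := c.arr
        next := c.next
        ent := Function.update c.ent m (c.ent m + 1)
        dep := some (t + (v m (c.ent m)).2) }
  | departIdle (t : ℝ) (hd : c.dep = some t) (ht : ∀ j, t ≤ c.next j)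
      (hm : ∀ l, c.arr l ≤ c.ent l) : Event v c
      { time := t
        arr := c.arr
        next := c.next
        ent := c.ent
        dep := none }

lemma step_event (k : Fin K) (v : Drive K) (c : Core K) : Event v c (step k v c) := by
  have hl : c.IsNext (firstClass k c.next) := firstClass_spec k c.next
  rcases hd : c.dep with _ | t
  · have : step k v c = arrive v (firstClass k c.next) c := by unfold step; rw [hd]
    rw [this]
    unfold arrive
    simp only [hd, Option.isNone_none, if_true]
    exact Event.arriveIdle _ hl hd
  · have hs : step k v c = if c.next (firstClass k c.next) < t then
        arrive v (firstClass k c.next) c else depart v t c := by unfold step; rw [hd]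
    rw [hs]
    split_ifs with ht
    · unfold arrive
      simp only [hd, Option.isNone_some, Bool.false_eq_true, if_false]
      exact Event.arriveBusy _ t hl hd ht
    · have ht' : ∀ j, t ≤ c.next j := fun j => (not_lt.1 ht).trans (hl.1 j)
      rcases exists_isHead c with ⟨m, hm⟩ | hm
      · rw [depart_of_isHead v t c m hm]
        exact Event.departBusy t m hd ht' hm
      · rw [depart_of_empty v t c hm]
        exact Event.departIdle t hd ht' hm

/-- Converse of `step_event`: the relation `Event` is the graph of `step`. Two runs are compared by
exhibiting, for an event of one, the matching event of the other. -/
lemma step_eq_of_event (k : Fin K) (v : Drive K) (c c' : Core K) (h : Event v c c') :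
    step k v c = c' := by
  have nx : ∀ l, c.IsNext l → firstClass k c.next = l := fun l hl => firstClass_eq k _ l hl.1 hl.2
  cases h with
  | arriveIdle l hl hd =>
    have : step k v c = arrive v l c := by unfold step; rw [hd, nx l hl]
    rw [this]; unfold arrive; simp [hd]
  | arriveBusy l t hl hd ht =>
    have : step k v c = arrive v l c := by unfold step; rw [hd, nx l hl]; simp [ht]
    rw [this]; unfold arrive; simp [hd]
  | departBusy t m hd ht hm =>
    have : step k v c = depart v t c := by
      unfold step; rw [hd]; simp only [not_lt.2 (ht _), if_false]
    rw [this, depart_of_isHead v t c m hm]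
  | departIdle t hd ht hm =>
    have : step k v c = depart v t c := by
      unfold step; rw [hd]; simp only [not_lt.2 (ht _), if_false]
    rw [this, depart_of_empty v t c hm]

end Core

/-! ### Partial sums of the input and invariants of the dynamics -/

/-- All inter-arrival and service times are positive. -/
def Pos (v : Drive K) : Prop := ∀ l n, 0 < (v l n).1 ∧ 0 < (v l n).2

/-- Time of the `n`-th arrival of class `l`, counted from `1`. -/
def arrivalSum (v : Drive K) (l : Fin K) (n : ℕ) : ℝ := ∑ i ∈ Finset.range n, (v l i).1

/-- Total service time of the first `n` jobs of class `l`. -/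
def serviceSum (v : Drive K) (l : Fin K) (n : ℕ) : ℝ := ∑ i ∈ Finset.range n, (v l i).2

lemma arrivalSum_succ (v : Drive K) (l : Fin K) (n : ℕ) :
    arrivalSum v l (n + 1) = arrivalSum v l n + (v l n).1 := Finset.sum_range_succ _ _

lemma serviceSum_succ (v : Drive K) (l : Fin K) (n : ℕ) :
    serviceSum v l (n + 1) = serviceSum v l n + (v l n).2 := Finset.sum_range_succ _ _

lemma Pos.arrivalSum_mono {v : Drive K} (hv : Pos v) (l : Fin K) : Monotone (arrivalSum v l) :=
  monotone_nat_of_le_succ fun n => by rw [arrivalSum_succ]; linarith [(hv l n).1]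

lemma Pos.serviceSum_mono {v : Drive K} (hv : Pos v) (l : Fin K) : Monotone (serviceSum v l) :=
  monotone_nat_of_le_succ fun n => by rw [serviceSum_succ]; linarith [(hv l n).2]

namespace Core

/-- Invariants of the dynamics. -/
structure Inv (v : Drive K) (j : ℕ) (c : Core K) : Prop where
  time_nonneg : 0 ≤ c.time
  next_eq : ∀ l, c.next l = arrivalSum v l (c.arr l + 1)
  time_le_next : ∀ l, c.time ≤ c.next l
  le_time : ∀ l, arrivalSum v l (c.arr l) ≤ c.time
  time_lt_dep : ∀ t, c.dep = some t → c.time < t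
  ent_le : ∀ l, c.ent l ≤ c.arr l
  idle : c.dep = none → ∀ l, c.ent l = c.arr l
  count : j + (if c.dep.isSome then 1 else 0) = ∑ l, c.arr l + ∑ l, c.ent l

lemma sum_update_succ (f : Fin K → ℕ) (l : Fin K) :
    ∑ i, Function.update f l (f l + 1) i = ∑ i, f i + 1 := by
  rw [Finset.sum_update_of_mem (Finset.mem_univ l),
    ← Finset.add_sum_erase Finset.univ f (Finset.mem_univ l), Finset.sdiff_singleton_eq_erase]
  ring

lemma inv_start {v : Drive K} (hv : Pos v) : Inv v 0 (start v) where
  time_nonneg := le_rfl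
  next_eq l := by simp [start, arrivalSum]
  time_le_next l := by simp [start, (hv l 0).1.le]
  le_time l := by simp [start, arrivalSum]
  time_lt_dep t h := by simp [start] at h
  ent_le l := le_rfl
  idle _ l := rfl
  count := by simp [start]

/-- The field `count` holds because each event is an arrival or a departure, and the departures so
far are the entries minus the job in service, if any. The other fields say that the clock stays
between the last and the next arrival of each class. -/
lemma Inv.event {v : Drive K} (hv : Pos v) {j : ℕ} {c c' : Core K} (h : Inv v j c)
    (he : Event v c c') : Inv v (j + 1) c' := by
  have hnext : ∀ l i, Function.update c.next l (c.next l + (v l (c.arr l + 1)).1) i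
      = arrivalSum v i (Function.update c.arr l (c.arr l + 1) i + 1) := by
    intro l i
    by_cases hi : i = l
    · subst hi; simp [arrivalSum_succ, h.next_eq]
    · simp [hi, h.next_eq]
  have htn : ∀ l, c.IsNext l → ∀ i, c.next l ≤
      Function.update c.next l (c.next l + (v l (c.arr l + 1)).1) i := by
    intro l hl i
    by_cases hi : i = l
    · subst hi; simp [(hv i _).1.le]
    · simp [hi, hl.1 i]
  have hlt : ∀ l, c.IsNext l → ∀ i,
      arrivalSum v i (Function.update c.arr l (c.arr l + 1) i) ≤ c.next l := by
    intro l hl i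
    by_cases hi : i = l
    · subst hi; simp [h.next_eq]
    · simp only [Function.update_of_ne hi]; exact (h.le_time i).trans (h.time_le_next l)
  have hcount := h.count
  cases he with
  | arriveIdle l hl hd =>
    refine ⟨h.time_nonneg.trans (h.time_le_next l), hnext l, htn l hl, hlt l hl, ?_, ?_, ?_, ?_⟩
    · rintro t ht
      simp only [Option.some.injEq] at ht
      subst ht
      linarith [(hv l (c.ent l)).2]
    · intro i
      by_cases hi : i = l
      · subst hi; simp [h.ent_le]
      · simp [hi, h.ent_le]
    · simp
    · simp only [hd, Option.isSome_none, Bool.false_eq_true, if_false] at hcount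
      simp only [sum_update_succ, Option.isSome_some, if_true]
      omega
  | arriveBusy l t hl hd ht =>
    refine ⟨h.time_nonneg.trans (h.time_le_next l), hnext l, htn l hl, hlt l hl, ?_, ?_, ?_, ?_⟩
    · rintro t' ht'
      simp only [Option.some.injEq] at ht'
      subst ht'
      exact ht
    · intro i
      by_cases hi : i = l
      · subst hi; simp; exact (h.ent_le i).trans (Nat.le_succ _)
      · simp [hi, h.ent_le]
    · simp
    · simp only [hd, Option.isSome_some, if_true] at hcount
      simp only [sum_update_succ, Option.isSome_some, if_true]
      omega
  | departBusy t m hd ht hm =>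
    have htt := h.time_lt_dep t hd
    refine ⟨h.time_nonneg.trans htt.le, h.next_eq, ht, fun l => (h.le_time l).trans htt.le, ?_, ?_,
      ?_, ?_⟩
    · rintro t' ht'
      simp only [Option.some.injEq] at ht'
      subst ht'
      linarith [(hv m (c.ent m)).2]
    · intro i
      by_cases hi : i = m
      · subst hi; simp; exact hm.1
      · simp [hi, h.ent_le]
    · simp
    · simp only [hd, Option.isSome_some, if_true] at hcount
      simp only [sum_update_succ, Option.isSome_some, if_true]
      omega
  | departIdle t hd ht hm =>
    have htt := h.time_lt_dep t hd
    refine ⟨h.time_nonneg.trans htt.le, h.next_eq, ht, fun l => (h.le_time l).trans htt.le, ?_,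
      h.ent_le, fun _ l => le_antisymm (h.ent_le l) (hm l), ?_⟩
    · simp
    · simp only [hd, Option.isSome_some, if_true] at hcount
      simp only [Option.isSome_none, Bool.false_eq_true, if_false]
      omega

lemma inv_run (k : Fin K) {v : Drive K} (hv : Pos v) (j : ℕ) : Inv v j (run k v j) := by
  induction j with
  | zero => exact inv_start hv
  | succ j ih => exact ih.event hv (step_event k v _)

lemma Event.arr_le {v : Drive K} {c c' : Core K} (he : Event v c c') (l : Fin K) :
    c.arr l ≤ c'.arr l := by
  cases he with
  | arriveIdle m =>
    by_cases h : l = m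
    · subst h; simp
    · simp [h]
  | arriveBusy m =>
    by_cases h : l = m
    · subst h; simp
    · simp [h]
  | departBusy => rfl
  | departIdle => rfl

lemma Event.ent_le {v : Drive K} {c c' : Core K} (he : Event v c c') (l : Fin K) :
    c.ent l ≤ c'.ent l := by
  cases he with
  | arriveIdle m =>
    by_cases h : l = m
    · subst h; simp
    · simp [h]
  | arriveBusy => rfl
  | departBusy t m =>
    by_cases h : l = m
    · subst h; simp
    · simp [h]
  | departIdle => rfl

lemma Event.time_le {v : Drive K} {c c' : Core K} {j : ℕ} (hi : Inv v j c) (he : Event v c c') :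
    c.time ≤ c'.time := by
  cases he with
  | arriveIdle l => exact hi.time_le_next l
  | arriveBusy l => exact hi.time_le_next l
  | departBusy t m hd => exact (hi.time_lt_dep t hd).le
  | departIdle t hd => exact (hi.time_lt_dep t hd).le

lemma run_event (k : Fin K) (v : Drive K) (j : ℕ) : Event v (run k v j) (run k v (j + 1)) :=
  step_event k v _

lemma arr_mono (k : Fin K) (v : Drive K) (l : Fin K) : Monotone fun j => (run k v j).arr l :=
  monotone_nat_of_le_succ fun j => (run_event k v j).arr_le l

lemma ent_mono (k : Fin K) (v : Drive K) (l : Fin K) : Monotone fun j => (run k v j).ent l :=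
  monotone_nat_of_le_succ fun j => (run_event k v j).ent_le l

lemma time_mono (k : Fin K) {v : Drive K} (hv : Pos v) : Monotone fun j => (run k v j).time :=
  monotone_nat_of_le_succ fun j => (run_event k v j).time_le (inv_run k hv j)

end Core

/-! ### The realized part of the input determines the path -/

/-- Whether the service time of the `n`-th class-`l` job has been realized. -/
def Realized (k : Fin K) (a e : Fin K → ℕ) (l : Fin K) (n : ℕ) : Prop :=
  if l ≤ k then n < a l else n < e l

/-- Agreement of two inputs on what has been realized. -/
structure Agree (k : Fin K) (a e : Fin K → ℕ) (w w' : Drive K) : Prop where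
  arrival : ∀ l, ∀ n < a l, (w' l n).1 = (w l n).1
  service : ∀ l n, Realized k a e l n → (w' l n).2 = (w l n).2

lemma Agree.arrivalSum_eq {k : Fin K} {a e : Fin K → ℕ} {w w' : Drive K} (h : Agree k a e w w')
    {l : Fin K} {n : ℕ} (hn : n ≤ a l) : arrivalSum w' l n = arrivalSum w l n :=
  Finset.sum_congr rfl fun i hi => h.arrival l i ((Finset.mem_range.1 hi).trans_le hn)

namespace Core

/-- Equality of queues up to the epochs of future arrivals. -/
structure Same (c c' : Core K) : Prop where
  time : c'.time = c.time
  arr : c'.arr = c.arr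
  ent : c'.ent = c.ent
  dep : c'.dep = c.dep

/-- The run up to event `i` is determined by what has been realized by then. -/
theorem same_run (k : Fin K) {w w' : Drive K} (hw : Pos w) (hw' : Pos w') (i : ℕ)
    (hag : Agree k (run k w i).arr (run k w i).ent w w')
    (hres : ∀ l, (run k w i).time < arrivalSum w' l ((run k w i).arr l + 1)) (j : ℕ) (hj : j ≤ i) :
    Same (run k w j) (run k w' j) := by
  induction j with
  | zero => exact ⟨rfl, rfl, rfl, rfl⟩
  | succ j ih =>
    have ih := ih (by omega)
    have I := inv_run k hw j
    have I' := inv_run k hw' j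
    have hnext : ∀ l, (run k w j).arr l < (run k w i).arr l →
        (run k w' j).next l = (run k w j).next l := by
      intro l hl
      rw [I.next_eq, I'.next_eq, ih.arr, hag.arrivalSum_eq hl]
    -- An arrival that occurs by event `i` has the same epoch under both inputs; any other is, under
    -- `w'`, later than event `i`, so it cannot interfere with the events up to `i`.
    have hlarge : ∀ l, (run k w' j).next l = (run k w j).next l ∨
        (run k w i).time < (run k w' j).next l := by
      intro l
      rcases lt_or_eq_of_le (arr_mono k w l (show j ≤ i by omega)) with h | h
      · exact Or.inl (hnext l h)
      · right
        rw [I'.next_eq, ih.arr]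
        simp only at h
        rw [h]; exact hres l
    -- For classes up to `k` service times are realized on arrival, and a job that has entered has
    -- arrived; so entry implies realization in either case.
    have hserv : ∀ l n, n < (run k w (j + 1)).ent l → (w' l n).2 = (w l n).2 := by
      intro l n hn
      have he := hn.trans_le (ent_mono k w l hj)
      refine hag.service l n ?_
      unfold Realized
      split_ifs
      exacts [he.trans_le ((inv_run k hw i).ent_le l), he]
    have hti : (run k w (j + 1)).time ≤ (run k w i).time := time_mono k hw hj
    have harr : ∀ l, (run k w (j + 1)).arr l ≤ (run k w i).arr l := fun l => arr_mono k w l hj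
    have hev := run_event k w j
    have hisnext : ∀ l, (run k w j).IsNext l → (run k w j).arr l < (run k w i).arr l →
        (run k w j).next l ≤ (run k w i).time → (run k w' j).IsNext l := by
      intro l hl h1 h2
      rw [IsNext, hnext l h1]
      constructor
      · intro m
        rcases hlarge m with h | h
        · rw [h]; exact hl.1 m
        · exact h2.trans h.le
      · intro m hm
        rcases hlarge m with h | h
        · rw [h]; exact hl.2 m hm
        · exact h2.trans_lt h
    have htle : ∀ t, t ≤ (run k w i).time → (∀ m, t ≤ (run k w j).next m) →
        ∀ m, t ≤ (run k w' j).next m := by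
      intro t h1 h2 m
      rcases hlarge m with h | h
      · rw [h]; exact h2 m
      · exact h1.trans h.le
    have hhead : ∀ m, (run k w j).IsHead m → (run k w' j).IsHead m := by
      intro m hm
      unfold IsHead
      rw [ih.ent, ih.arr]
      exact hm
    revert hti harr hserv
    generalize hc : run k w (j + 1) = c at hev
    intro hserv hti harr
    have fin : ∀ c', Event w' (run k w' j) c' → Same c c' → Same c (run k w' (j + 1)) := by
      intro c' h1 h2
      have : run k w' (j + 1) = c' := step_eq_of_event k w' _ _ h1
      rw [this]; exact h2
    cases hev with
    | arriveIdle l hl hd =>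
      have h1 : (run k w j).arr l < (run k w i).arr l := by
        have := harr l; simp at this; omega
      refine fin _ (Event.arriveIdle l (hisnext l hl h1 hti) (ih.dep.trans hd)) ⟨?_, ?_, ?_, ?_⟩
      · exact hnext l h1
      · simp [ih.arr]
      · simp [ih.ent]
      · simp only [hnext l h1, ih.ent]
        rw [hserv l _ (by simp)]
    | arriveBusy l t hl hd ht =>
      have h1 : (run k w j).arr l < (run k w i).arr l := by
        have := harr l; simp at this; omega
      refine fin _ (Event.arriveBusy l t (hisnext l hl h1 hti) (ih.dep.trans hd)
        (by rw [hnext l h1]; exact ht)) ⟨?_, ?_, ?_, ?_⟩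
      · exact hnext l h1
      · simp [ih.arr]
      · exact ih.ent
      · rfl
    | departBusy t m hd ht hm =>
      refine fin _ (Event.departBusy t m (ih.dep.trans hd) (htle t hti ht) (hhead m hm))
        ⟨rfl, ih.arr, ?_, ?_⟩
      · simp [ih.ent]
      · simp only [ih.ent]
        rw [hserv m _ (by simp)]
    | departIdle t hd ht hm =>
      refine fin _ (Event.departIdle t (ih.dep.trans hd) (htle t hti ht)
        (by rw [ih.arr, ih.ent]; exact hm)) ⟨rfl, ih.arr, ih.ent, rfl⟩

end Core

end PriorityQueue
end

noncomputable section
namespace PriorityQueue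
variable {K : ℕ}

/-! ### Simulation paths in terms of single runs -/

/-- Agreement with `d` is required only at the indices that the step may read. This covers both the
original system, with `d` equal to `v`, and a run after the switch, with `d` the splice of `w` and
`v`. -/
lemma core_step_of_switched (k : Fin K) (γmax : ℝ) (w v d : Drive K) (s : State K)
    (hs : s.switched = true)
    (hnext : ∀ l, (v l (s.arr l + 1)).1 = (d l (s.arr l + 1)).1)
    (hserv : ∀ l, (if l ≤ k then (if s.ent l < s.obsArr l then (w l (s.ent l)).2
      else (v l (s.ent l)).2) else (v l (s.ent l)).2) = (d l (s.ent l)).2) :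
    (step k γmax w v s).core = Core.step k d s.core ∧ (step k γmax w v s).switched = true ∧
      (step k γmax w v s).obsTime = s.obsTime ∧ (step k γmax w v s).obsArr = s.obsArr ∧
      (step k γmax w v s).obsEnt = s.obsEnt := by
  obtain ⟨time, arr, ent, next, dep, sw, oT, oA, oE⟩ := s
  simp only at hs hnext hserv
  subst hs
  rcases dep with _ | t
  · simp [step, arrive, observe, enter, switchIfNeeded, State.core, Core.step, Core.arrive, input,
      serviceTime, nextClass_eq, hnext, hserv]
  · by_cases ht : next (firstClass k next) < t
    · simp [step, arrive, observe, switchIfNeeded, State.core, Core.step, Core.arrive, input,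
        nextClass_eq, hnext, ht]
    · by_cases hw : (Finset.univ.filter fun l => ent l < arr l).Nonempty
      · have e2 : Core.depart d t ⟨time, arr, ent, next, some t⟩ = _ := dif_pos hw
        simp [step, depart, observe, enter, State.core, Core.step, input,
          serviceTime, nextClass_eq, hserv, ht, hw, e2]
      · have e2 : Core.depart d t ⟨time, arr, ent, next, some t⟩ = _ := dif_neg hw
        simp [step, depart, observe, State.core, Core.step,
          nextClass_eq, ht, hw, e2]

/-- The backlog as a function of the queue. -/
def Core.backlog (k : Fin K) (w : Drive K) (c : Core K) : ℝ :=
  (∑ l ∈ Finset.univ.filter (fun l => l ≤ k), ∑ n ∈ Finset.Ico (c.ent l) (c.arr l), (w l n).2)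
    + (c.dep.getD c.time - c.time)

/-- The event number `j + 1` of the run triggers the switch. -/
def SwitchAt (k : Fin K) (γmax : ℝ) (w : Drive K) (j : ℕ) : Prop :=
  (Core.run k w (j + 1)).arr k ≠ (Core.run k w j).arr k ∧
    γmax < (Core.run k w (j + 1)).backlog k w

/-- The simulation has not switched and its observations are up to date. -/
structure Unswitched (w : Drive K) (s : State K) (c : Core K) : Prop where
  core : s.core = c
  switched : s.switched = false
  obsTime : s.obsTime = s.time
  obsArr : s.obsArr = s.arr
  obsEnt : s.obsEnt = s.ent

/-- The simulation has switched in a state where the queue is `c`. -/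
structure JustSwitched (v : Drive K) (s : State K) (c : Core K) : Prop where
  same : Core.Same c s.core
  next : ∀ l, s.next l = c.time + (v l (c.arr l)).1
  switched : s.switched = true
  obsTime : s.obsTime = c.time
  obsArr : s.obsArr = c.arr
  obsEnt : s.obsEnt = c.ent

lemma unswitched_observe (w : Drive K) (s : State K) (hs : s.switched = false) :
    Unswitched w (observe s) s.core := by
  obtain ⟨time, arr, ent, next, dep, sw, oT, oA, oE⟩ := s
  simp only at hs
  subst hs
  exact ⟨rfl, rfl, rfl, rfl, rfl⟩

lemma Unswitched.enter {w : Drive K} {s : State K} {c : Core K} (h : Unswitched w s c) (k : Fin K)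
    (v : Drive K) (l : Fin K) (hl : c.ent l < c.arr l) :
    Unswitched w (enter k w v l s) { c with
      ent := Function.update c.ent l (c.ent l + 1)
      dep := some (c.time + (w l (c.ent l)).2) } := by
  obtain ⟨hc, hs, h1, h2, h3⟩ := h
  subst hc
  have hserv : serviceTime k w v s l (s.ent l) = (w l (s.ent l)).2 := by
    unfold serviceTime
    rw [h2, if_pos (show s.ent l < s.arr l from hl), hs]
    simp [input]
  unfold PriorityQueue.enter
  rw [hserv]
  exact unswitched_observe w _ hs

/-- An arrival before the switching condition is checked. -/
def arriveOnly (k : Fin K) (w v : Drive K) (l : Fin K) (s : State K) : State K :=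
  let s₁ : State K := observe { s with
    time := s.next l
    arr := Function.update s.arr l (s.arr l + 1)
    next := Function.update s.next l (s.next l + (input w v s.switched l (s.arr l + 1)).1) }
  if s₁.dep.isNone then enter k w v l s₁ else s₁

lemma arrive_eq (k : Fin K) (γmax : ℝ) (w v : Drive K) (l : Fin K) (s : State K) :
    arrive k γmax w v l s = switchIfNeeded k γmax w v l (arriveOnly k w v l s) := rfl

lemma Unswitched.arriveOnly {w : Drive K} {s : State K} {c : Core K} (h : Unswitched w s c)
    (k : Fin K) (v : Drive K) (l : Fin K) (hent : c.ent l ≤ c.arr l) :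
    Unswitched w (arriveOnly k w v l s) (Core.arrive w l c) := by
  obtain ⟨hc, hs, h1, h2, h3⟩ := h
  subst hc
  set s0 : State K := { s with
    time := s.next l
    arr := Function.update s.arr l (s.arr l + 1)
    next := Function.update s.next l (s.next l + (input w v s.switched l (s.arr l + 1)).1) } with hs0
  have e0 : input w v s.switched = w := by rw [hs]; rfl
  have h0 : Unswitched w (observe s0) s0.core := unswitched_observe w s0 hs
  have hdep : (observe s0).dep = s.dep := congrArg Core.dep h0.core
  have hdef : PriorityQueue.arriveOnly k w v l s
      = if (observe s0).dep.isNone then PriorityQueue.enter k w v l (observe s0)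
        else observe s0 := rfl
  rw [hdef, hdep]
  by_cases hd : s.dep.isNone
  · rw [if_pos hd]
    have h3 := h0.enter k v l (by
      simp only [hs0, State.core, Function.update_self]; exact Nat.lt_succ_of_le hent)
    convert h3 using 1
    simp [Core.arrive, State.core, hd, hs0, e0]
  · rw [if_neg hd]
    convert h0 using 1
    simp [Core.arrive, State.core, hd, hs0, e0]

lemma Unswitched.switchIfNeeded {w : Drive K} {s : State K} {c : Core K} (h : Unswitched w s c)
    (k : Fin K) (γmax : ℝ) (v : Drive K) (l : Fin K) :
    (¬ (l = k ∧ γmax < c.backlog k w) ∧ Unswitched w (switchIfNeeded k γmax w v l s) c) ∨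
    ((l = k ∧ γmax < c.backlog k w) ∧ JustSwitched v (switchIfNeeded k γmax w v l s) c) := by
  have hb : PriorityQueue.backlog k w s = c.backlog k w := by rw [← h.core]; rfl
  unfold PriorityQueue.switchIfNeeded
  rw [hb]
  by_cases hc : l = k ∧ γmax < c.backlog k w
  · right
    refine ⟨hc, ?_⟩
    rw [if_pos ⟨h.switched, hc⟩]
    obtain ⟨h0, hs, h1, h2, h3⟩ := h
    subst h0
    exact ⟨⟨rfl, rfl, rfl, rfl⟩, fun _ => rfl, rfl, h1, h2, h3⟩
  · left
    refine ⟨hc, ?_⟩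
    rw [if_neg (fun hh => hc hh.2)]
    exact h

lemma Unswitched.depart {w : Drive K} {s : State K} {c : Core K} (h : Unswitched w s c)
    (k : Fin K) (v : Drive K) (t : ℝ) :
    Unswitched w (depart k w v t s) (Core.depart w t c) := by
  obtain ⟨hc, hs, h1, h2, h3⟩ := h
  subst hc
  set s0 : State K := { s with time := t, dep := none } with hs0
  have h0 : Unswitched w (observe s0) s0.core := unswitched_observe w s0 hs
  by_cases hw : (Finset.univ.filter fun l => s.ent l < s.arr l).Nonempty
  · have e1 : PriorityQueue.depart k w v t s = PriorityQueue.enter k w v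
        ((Finset.univ.filter fun l => s.ent l < s.arr l).min' hw) (observe s0) := by
      have ha : (observe s0).arr = s.arr := congrArg Core.arr h0.core
      have he : (observe s0).ent = s.ent := congrArg Core.ent h0.core
      unfold PriorityQueue.depart
      simp only [← hs0, ha, he]
      rw [dif_pos hw]
    rw [e1]
    have h3 := h0.enter k v ((Finset.univ.filter fun l => s.ent l < s.arr l).min' hw)
      (Finset.mem_filter.1 (Finset.min'_mem _ hw)).2
    convert h3 using 1
    unfold Core.depart
    exact dif_pos hw
  · have e1 : PriorityQueue.depart k w v t s = observe s0 := by
      have ha : (observe s0).arr = s.arr := congrArg Core.arr h0.core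
      have he : (observe s0).ent = s.ent := congrArg Core.ent h0.core
      unfold PriorityQueue.depart
      simp only [← hs0, ha, he]
      rw [dif_neg hw]
    rw [e1]
    convert h0 using 1
    unfold Core.depart
    exact dif_neg hw

lemma Core.depart_arr (v : Drive K) (t : ℝ) (c : Core K) : (Core.depart v t c).arr = c.arr := by
  unfold Core.depart
  dsimp only
  split_ifs <;> rfl

/-- This matches the condition on `arr k` in `SwitchAt` with the test `l = k` made by the
simulation. -/
lemma Core.arrive_arr_ne (v : Drive K) (l k : Fin K) (c : Core K) :
    (Core.arrive v l c).arr k ≠ c.arr k ↔ l = k := by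
  by_cases h : k = l
  · subst h; simp [Core.arrive]
  · simp [Core.arrive, h, Ne.symm h]

/-- Until the switch the simulation is the queue driven by `w` alone. The dichotomy is decided by a
condition on that queue, which does not involve `v`. -/
lemma Unswitched.step {w : Drive K} {s : State K} {c : Core K} (h : Unswitched w s c)
    (k : Fin K) (γmax : ℝ) (v : Drive K) (hent : ∀ l, c.ent l ≤ c.arr l) :
    (¬ ((Core.step k w c).arr k ≠ c.arr k ∧ γmax < (Core.step k w c).backlog k w) ∧
      Unswitched w (step k γmax w v s) (Core.step k w c)) ∨
    (((Core.step k w c).arr k ≠ c.arr k ∧ γmax < (Core.step k w c).backlog k w) ∧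
      JustSwitched v (step k γmax w v s) (Core.step k w c)) := by
  have hdep : s.dep = c.dep := congrArg Core.dep h.core
  have hnext : s.next = c.next := congrArg Core.next h.core
  have arrival : PriorityQueue.step k γmax w v s = arrive k γmax w v (firstClass k c.next) s →
      Core.step k w c = Core.arrive w (firstClass k c.next) c →
      (¬ ((Core.step k w c).arr k ≠ c.arr k ∧ γmax < (Core.step k w c).backlog k w) ∧
        Unswitched w (PriorityQueue.step k γmax w v s) (Core.step k w c)) ∨
      (((Core.step k w c).arr k ≠ c.arr k ∧ γmax < (Core.step k w c).backlog k w) ∧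
        JustSwitched v (PriorityQueue.step k γmax w v s) (Core.step k w c)) := by
    intro h1 h2
    rw [h1, h2, Core.arrive_arr_ne, arrive_eq]
    exact (h.arriveOnly k v _ (hent _)).switchIfNeeded k γmax v _
  rcases hd : c.dep with _ | t
  · apply arrival
    · unfold PriorityQueue.step; rw [hdep, hd, nextClass_eq, hnext]
    · unfold Core.step; rw [hd]
  · by_cases ht : c.next (firstClass k c.next) < t
    · apply arrival
      · unfold PriorityQueue.step; rw [hdep, hd, nextClass_eq, hnext]; simp only [ht, if_true]
      · unfold Core.step; rw [hd]; simp only [ht, if_true]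
    · have e1 : PriorityQueue.step k γmax w v s = PriorityQueue.depart k w v t s := by
        unfold PriorityQueue.step; rw [hdep, hd, nextClass_eq, hnext]; simp only [ht, if_false]
      have e2 : Core.step k w c = Core.depart w t c := by
        unfold Core.step; rw [hd]; simp only [ht, if_false]
      left
      rw [e1, e2]
      exact ⟨fun hh => hh.1 (by rw [Core.depart_arr]), h.depart k v t⟩

/-! ### Splicing two inputs at an event -/

/-- The input that follows `w` for everything realized when the numbers of arrivals and entries
are `a` and `e`, and the time is `T`, and `v` afterwards. -/
def splice (k : Fin K) (a e : Fin K → ℕ) (T : ℝ) (w v : Drive K) : Drive K := fun l n =>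
  (if n < a l then (w l n).1 else if n = a l then T - arrivalSum w l (a l) + (v l n).1
    else (v l n).1,
   if l ≤ k then (if n < a l then (w l n).2 else (v l n).2)
    else (if n < e l then (w l n).2 else (v l n).2))

lemma agree_splice (k : Fin K) (a e : Fin K → ℕ) (T : ℝ) (w v : Drive K) :
    Agree k a e w (splice k a e T w v) where
  arrival l n hn := by simp [splice, hn]
  service l n hn := by
    unfold Realized at hn
    by_cases h : l ≤ k <;> simp_all [splice]

/-- The current inter-arrival time of the splice is age plus fresh residual, so the age cancels and
the next arrival is a fresh time after `T`, as in the simulation at the switch. -/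
lemma arrivalSum_splice (k : Fin K) (a e : Fin K → ℕ) (T : ℝ) (w v : Drive K) (l : Fin K) :
    arrivalSum (splice k a e T w v) l (a l + 1) = T + (v l (a l)).1 := by
  rw [arrivalSum_succ, (agree_splice k a e T w v).arrivalSum_eq le_rfl]
  simp [splice]
  ring

lemma pos_splice (k : Fin K) (a e : Fin K → ℕ) (T : ℝ) {w v : Drive K} (hw : Pos w) (hv : Pos v)
    (hT : ∀ l, arrivalSum w l (a l) ≤ T) : Pos (splice k a e T w v) := by
  intro l n
  constructor
  · simp only [splice]
    split_ifs
    · exact (hw l n).1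
    · linarith [hT l, (hv l n).1]
    · exact (hv l n).1
  · simp only [splice]
    split_ifs
    exacts [(hw l n).2, (hv l n).2, (hw l n).2, (hv l n).2]

/-- The splice of two inputs at event `i` of the run with the first one. -/
def spliceAt (k : Fin K) (i : ℕ) (w v : Drive K) : Drive K :=
  splice k (Core.run k w i).arr (Core.run k w i).ent (Core.run k w i).time w v

lemma pos_spliceAt (k : Fin K) (i : ℕ) {w v : Drive K} (hw : Pos w) (hv : Pos v) :
    Pos (spliceAt k i w v) :=
  pos_splice k _ _ _ hw hv (Core.inv_run k hw i).le_time

lemma same_spliceAt (k : Fin K) {w v : Drive K} (hw : Pos w) (hv : Pos v) (i j : ℕ) (hj : j ≤ i) :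
    Core.Same (Core.run k w j) (Core.run k (spliceAt k i w v) j) := by
  refine Core.same_run k hw (pos_spliceAt k i hw hv) i (agree_splice k _ _ _ w v) (fun l => ?_) j hj
  unfold spliceAt
  rw [arrivalSum_splice]
  linarith [(hv l ((Core.run k w i).arr l)).1]

lemma next_spliceAt (k : Fin K) {w v : Drive K} (hw : Pos w) (hv : Pos v) (i : ℕ) (l : Fin K) :
    (Core.run k (spliceAt k i w v) i).next l
      = (Core.run k w i).time + (v l ((Core.run k w i).arr l)).1 := by
  rw [(Core.inv_run k (pos_spliceAt k i hw hv) i).next_eq,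
    (same_spliceAt k hw hv i i le_rfl).arr]
  exact arrivalSum_splice k _ _ _ w v l

/-! ### The sampling path -/

lemma unswitched_samplingPath (k : Fin K) (γmax : ℝ) {w : Drive K} (v : Drive K) (hw : Pos w)
    (j : ℕ) (hj : ∀ i < j, ¬ SwitchAt k γmax w i) :
    Unswitched w (samplingPath k γmax (w, v) j) (Core.run k w j) := by
  induction j with
  | zero => exact ⟨rfl, rfl, rfl, rfl, rfl⟩
  | succ j ih =>
    have h := ih fun i hi => hj i (Nat.lt_succ_of_lt hi)
    rcases h.step k γmax v (Core.inv_run k hw j).ent_le with h' | h'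
    · exact h'.2
    · exact absurd h'.1 (hj j (Nat.lt_succ_self j))

lemma justSwitched_samplingPath (k : Fin K) (γmax : ℝ) {w : Drive K} (v : Drive K) (hw : Pos w)
    (j : ℕ) (hj : ∀ i < j, ¬ SwitchAt k γmax w i) (hs : SwitchAt k γmax w j) :
    JustSwitched v (samplingPath k γmax (w, v) (j + 1)) (Core.run k w (j + 1)) := by
  have h := unswitched_samplingPath k γmax v hw j hj
  rcases h.step k γmax v (Core.inv_run k hw j).ent_le with h' | h'
  · exact absurd hs h'.1
  · exact h'.2

/-- After the switch, the sampling path is the run of the spliced input. -/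
lemma samplingPath_after (k : Fin K) (γmax : ℝ) {w v : Drive K} (hw : Pos w) (hv : Pos v)
    (j : ℕ) (hj : ∀ i < j, ¬ SwitchAt k γmax w i) (hs : SwitchAt k γmax w j) (n : ℕ) :
    (samplingPath k γmax (w, v) (j + 1 + n)).core
        = Core.run k (spliceAt k (j + 1) w v) (j + 1 + n) ∧
      (samplingPath k γmax (w, v) (j + 1 + n)).switched = true ∧
      (samplingPath k γmax (w, v) (j + 1 + n)).obsTime = (Core.run k w (j + 1)).time ∧
      (samplingPath k γmax (w, v) (j + 1 + n)).obsArr = (Core.run k w (j + 1)).arr ∧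
      (samplingPath k γmax (w, v) (j + 1 + n)).obsEnt = (Core.run k w (j + 1)).ent := by
  induction n with
  | zero =>
    have h := justSwitched_samplingPath k γmax v hw j hj hs
    have h2 := same_spliceAt k hw hv (j + 1) (j + 1) le_rfl
    refine ⟨?_, h.switched, h.obsTime, h.obsArr, h.obsEnt⟩
    ext1
    · exact h.same.time.trans h2.time.symm
    · exact h.same.arr.trans h2.arr.symm
    · exact h.same.ent.trans h2.ent.symm
    · funext l
      exact (h.next l).trans (next_spliceAt k hw hv (j + 1) l).symm
    · exact h.same.dep.trans h2.dep.symm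
  | succ n ih =>
    obtain ⟨h1, h2, h3, h4, h5⟩ := ih
    have hsame := same_spliceAt k hw hv (j + 1) (j + 1) le_rfl
    set x := samplingPath k γmax (w, v) (j + 1 + n) with hx
    set d := spliceAt k (j + 1) w v with hd
    have harr : x.arr = (Core.run k d (j + 1 + n)).arr := congrArg Core.arr h1
    have hent : x.ent = (Core.run k d (j + 1 + n)).ent := congrArg Core.ent h1
    have key := core_step_of_switched k γmax w v d x h2 (fun l => ?_) (fun l => ?_)
    · refine ⟨?_, key.2.1, key.2.2.1.trans h3, key.2.2.2.1.trans h4, key.2.2.2.2.trans h5⟩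
      exact key.1.trans (by rw [h1]; rfl)
    · have : (Core.run k w (j + 1)).arr l ≤ x.arr l := by
        rw [harr, ← hsame.arr]
        exact Core.arr_mono k d l (by omega)
      simp only [hd, spliceAt, splice]
      rw [if_neg (by omega), if_neg (by omega)]
    · have : (Core.run k w (j + 1)).ent l ≤ x.ent l := by
        rw [hent, ← hsame.ent]
        exact Core.ent_mono k d l (by omega)
      simp only [hd, spliceAt, splice, h4]
      by_cases hl : l ≤ k
      · simp [hl]
      · simp [hl, not_lt.2 this]

/-- The whole sampling path is an original-type run of one spliced input. Future arrival epochs are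
left out of the comparison because before the switch the simulation still carries those of `w`. -/
lemma samplingPath_same (k : Fin K) (γmax : ℝ) {w v : Drive K} (hw : Pos w) (hv : Pos v)
    (j : ℕ) (hj : ∀ i < j, ¬ SwitchAt k γmax w i) (hs : SwitchAt k γmax w j) (n : ℕ) :
    Core.Same (Core.run k (spliceAt k (j + 1) w v) n) (samplingPath k γmax (w, v) n).core := by
  rcases le_or_gt (j + 1) n with h | h
  · obtain ⟨m, rfl⟩ := Nat.exists_eq_add_of_le h
    rw [(samplingPath_after k γmax hw hv j hj hs m).1]
    exact ⟨rfl, rfl, rfl, rfl⟩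
  · rw [(unswitched_samplingPath k γmax v hw n fun i hi => hj i (by omega)).core]
    have := same_spliceAt k hw hv (j + 1) n h.le
    exact ⟨this.time.symm, this.arr.symm, this.ent.symm, this.dep.symm⟩

lemma core_nominalPath (k : Fin K) (v : Drive K) (j : ℕ) :
    (nominalPath k v j).core = Core.run k v j ∧ (nominalPath k v j).switched = true ∧
      (nominalPath k v j).obsArr = fun _ => 0 := by
  induction j with
  | zero => exact ⟨rfl, rfl, rfl⟩
  | succ j ih =>
    obtain ⟨h1, h2, h3⟩ := ih
    have key := core_step_of_switched k 0 v v v (nominalPath k v j) h2 (fun _ => rfl)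
      (fun l => by simp)
    exact ⟨key.1.trans (by rw [h1]; rfl), key.2.1, key.2.2.2.1.trans h3⟩

end PriorityQueue
end

noncomputable section
namespace PriorityQueue
variable {K : ℕ}

/-! ### Stability -/

/-- Arrivals never accumulate. -/
def Diverges (v : Drive K) : Prop := ∀ l, Tendsto (arrivalSum v l) atTop atTop

/-- Events do not accumulate: in bounded time each class has at most `N` arrivals, hence at most `N`
entries, while the invariant `count` bounds the number of events by arrivals plus entries. -/
lemma exists_time_gt (k : Fin K) {v : Drive K} (hv : Pos v) (hd : Diverges v) (C : ℝ) :
    ∃ j, C < (Core.run k v j).time := by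
  by_contra hcon
  push Not at hcon
  have hN : ∀ᶠ n in atTop, ∀ l, C < arrivalSum v l n :=
    eventually_all.2 fun l => (hd l).eventually_gt_atTop C
  obtain ⟨N, hN⟩ := hN.exists
  have hbound : ∀ j l, (Core.run k v j).arr l ≤ N := by
    intro j l
    by_contra h
    push Not at h
    have h1 := (Core.inv_run k hv j).le_time l
    have h2 := hv.arrivalSum_mono l h.le
    linarith [hcon j, hN l]
  have hc := (Core.inv_run k hv (2 * (K * N) + 1)).count
  have h1 : ∑ l, (Core.run k v (2 * (K * N) + 1)).arr l ≤ K * N := by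
    refine (Finset.sum_le_sum fun l _ => hbound _ l).trans ?_
    simp
  have h2 : ∑ l, (Core.run k v (2 * (K * N) + 1)).ent l ≤ K * N := by
    refine (Finset.sum_le_sum fun l _ => ((Core.inv_run k hv _).ent_le l).trans (hbound _ l)).trans ?_
    simp
  omega

lemma tendsto_time (k : Fin K) {v : Drive K} (hv : Pos v) (hd : Diverges v) :
    Tendsto (fun j => (Core.run k v j).time) atTop atTop :=
  tendsto_atTop_atTop_of_monotone (Core.time_mono k hv)
    fun C => (exists_time_gt k hv hd C).imp fun _ h => h.le

lemma tendsto_arr (k : Fin K) {v : Drive K} (hv : Pos v) (hd : Diverges v) (l : Fin K) :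
    Tendsto (fun j => (Core.run k v j).arr l) atTop atTop := by
  refine tendsto_atTop_atTop_of_monotone (Core.arr_mono k v l) fun N => ?_
  obtain ⟨j, hj⟩ := exists_time_gt k hv hd (arrivalSum v l (N + 1))
  refine ⟨j, ?_⟩
  by_contra h
  push Not at h
  have h1 := (Core.inv_run k hv j).time_le_next l
  rw [(Core.inv_run k hv j).next_eq l] at h1
  have h2 := hv.arrivalSum_mono l (show (Core.run k v j).arr l + 1 ≤ N + 1 by omega)
  linarith

/-- Inputs with positive entries that satisfy the law of large numbers. -/
structure Good (lam mu : Fin K → ℝ) (v : Drive K) : Prop where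
  pos : Pos v
  arrival : ∀ l, Tendsto (fun n : ℕ => arrivalSum v l n / n) atTop (𝓝 (lam l)⁻¹)
  service : ∀ l, Tendsto (fun n : ℕ => serviceSum v l n / n) atTop (𝓝 (mu l)⁻¹)

variable {lam mu : Fin K → ℝ}

lemma Good.diverges (hlam : ∀ l, 0 < lam l) {v : Drive K} (hv : Good lam mu v) : Diverges v := by
  intro l
  have h := (hv.arrival l).pos_mul_atTop (inv_pos.2 (hlam l)) tendsto_natCast_atTop_atTop
  refine h.congr' ?_
  filter_upwards [eventually_gt_atTop 0] with n hn
  have : (n : ℝ) ≠ 0 := by positivity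
  field_simp

lemma Good.eventually_service_le (hlam : ∀ l, 0 < lam l) {v : Drive K} (hv : Good lam mu v)
    (l : Fin K) (r : ℝ) (hr : lam l / mu l < r) :
    ∀ᶠ n in atTop, serviceSum v l n ≤ r * arrivalSum v l n := by
  have h := (hv.service l).sub ((hv.arrival l).const_mul r)
  have hneg : (mu l)⁻¹ - r * (lam l)⁻¹ < 0 := by
    have := hlam l
    rw [sub_neg, ← div_eq_mul_inv, lt_div_iff₀ this, inv_mul_eq_div]
    exact hr
  filter_upwards [h.eventually_lt_const hneg, eventually_gt_atTop 0] with n h1 h2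
  have hn : (0 : ℝ) < n := by positivity
  have : (serviceSum v l n - r * arrivalSum v l n) / n < 0 := by
    rw [sub_div, mul_div_assoc]; exact h1
  have := (div_neg_iff.1 this).resolve_left (fun h => absurd h.2 (not_lt.2 hn.le))
  linarith [this.1]

/-- The server becomes idle again and again. -/
theorem exists_idle_gt (hlam : ∀ l, 0 < lam l) (hstable : ∑ l, lam l / mu l < 1)
    (k : Fin K) {v : Drive K} (hv : Good lam mu v) (j0 : ℕ) :
    ∃ j, j0 < j ∧ (Core.run k v j).dep = none := by
  by_contra hcon
  push Not at hcon
  have hbusy : ∀ j, j0 < j → ∃ t, (Core.run k v j).dep = some t := fun j hj =>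
    Option.ne_none_iff_exists'.1 (hcon j hj)
  -- While the server is busy, each departure epoch is the previous one plus the service time that
  -- enters, so `D` is constant. Thus time < `D` + (service time entered) ≤ `D` + r · time with r <
  -- 1, which is impossible for large times.
  set D : ℕ → ℝ := fun j => (Core.run k v j).dep.getD 0 -
    ∑ l, serviceSum v l ((Core.run k v j).ent l) with hD
  have hupd : ∀ (f : Fin K → ℕ) (m : Fin K),
      ∑ l, serviceSum v l (Function.update f m (f m + 1) l)
        = ∑ l, serviceSum v l (f l) + (v m (f m)).2 := by
    intro f m
    rw [← Finset.add_sum_erase _ _ (Finset.mem_univ m),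
      ← Finset.add_sum_erase Finset.univ (fun l => serviceSum v l (f l)) (Finset.mem_univ m)]
    simp only [Function.update_self, serviceSum_succ]
    rw [Finset.sum_congr rfl fun l hl => by
      rw [Function.update_of_ne (Finset.ne_of_mem_erase hl)]]
    ring
  have hconst : ∀ j, j0 < j → D (j + 1) = D j := by
    intro j hj
    obtain ⟨t, ht⟩ := hbusy j hj
    obtain ⟨t', ht'⟩ := hbusy (j + 1) (by omega)
    have hev := Core.run_event k v j
    simp only [hD, ht]
    revert ht'
    generalize Core.run k v (j + 1) = c at hev
    intro ht'
    cases hev with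
    | arriveIdle l hl hd => simp [ht] at hd
    | arriveBusy l s hl hd hs =>
      rw [ht] at hd
      simp_all
    | departBusy s m hd hs hm =>
      rw [ht] at hd
      simp only [Option.some.injEq] at hd
      subst hd
      simp only [Option.getD_some, hupd]
      ring
    | departIdle s hd => simp at ht'
  have hDj : ∀ j, D (j0 + 1 + j) = D (j0 + 1) := by
    intro j
    induction j with
    | zero => rfl
    | succ j ih => rw [← ih, ← hconst (j0 + 1 + j) (by omega)]; rfl
  have hK : (0 : ℝ) < K := by exact_mod_cast k.pos
  -- Spread over the `K` classes, this uses up half of the spare capacity, so the inflated loads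
  -- still add up to less than 1.
  set δ : ℝ := (1 - ∑ l, lam l / mu l) / (2 * K) with hδ
  have hδ0 : 0 < δ := div_pos (by linarith) (by positivity)
  set r : ℝ := ∑ l, (lam l / mu l + δ) with hr
  have hr1 : r < 1 := by
    rw [hr, Finset.sum_add_distrib]
    simp only [Finset.sum_const, Finset.card_univ, Fintype.card_fin, nsmul_eq_mul, hδ]
    have : (K : ℝ) * ((1 - ∑ l, lam l / mu l) / (2 * K)) = (1 - ∑ l, lam l / mu l) / 2 := by
      field_simp
    rw [this]; linarith
  have htime := tendsto_time k hv.pos (hv.diverges hlam)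
  have h1 : ∀ᶠ j in atTop, ∀ l, serviceSum v l ((Core.run k v j).arr l)
      ≤ (lam l / mu l + δ) * (Core.run k v j).time := by
    refine eventually_all.2 fun l => ?_
    have h2 := (tendsto_arr k hv.pos (hv.diverges hlam) l).eventually
      (hv.eventually_service_le hlam l (lam l / mu l + δ) (by linarith))
    have h3 : ∀ᶠ j in atTop, 0 ≤ serviceSum v l ((Core.run k v j).arr l) :=
      Eventually.of_forall fun j => Finset.sum_nonneg fun i _ => (hv.pos l i).2.le
    have h4 : ∀ᶠ j in atTop, 0 < (Core.run k v j).arr l :=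
      (tendsto_arr k hv.pos (hv.diverges hlam) l).eventually_gt_atTop 0
    filter_upwards [h2, h3, h4] with j h2 h3 h4
    have h5 : 0 < arrivalSum v l ((Core.run k v j).arr l) :=
      Finset.sum_pos (fun i _ => (hv.pos l i).1) (by simpa using h4.ne')
    -- The sign is read off from 0 ≤ service sum ≤ rate · arrival sum; the sign of `mu` is not
    -- available here.
    have h6 : 0 ≤ lam l / mu l + δ := by
      by_contra h; push Not at h; nlinarith
    exact h2.trans (mul_le_mul_of_nonneg_left ((Core.inv_run k hv.pos j).le_time l) h6)
  have h2 : ∀ᶠ j in atTop, (1 - r) * (Core.run k v j).time < D (j0 + 1) := by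
    filter_upwards [h1, eventually_ge_atTop (j0 + 1)] with j h1 hj
    obtain ⟨m, rfl⟩ := Nat.exists_eq_add_of_le hj
    obtain ⟨t, ht⟩ := hbusy (j0 + 1 + m) (by omega)
    have I := Core.inv_run k hv.pos (j0 + 1 + m)
    have h3 := I.time_lt_dep t ht
    have h4 := hDj m
    simp only [hD, ht, Option.getD_some] at h4
    have h5 : ∑ l, serviceSum v l ((Core.run k v (j0 + 1 + m)).ent l)
        ≤ r * (Core.run k v (j0 + 1 + m)).time := by
      rw [hr, Finset.sum_mul]
      exact Finset.sum_le_sum fun l _ => (hv.pos.serviceSum_mono l (I.ent_le l)).trans (h1 l)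
    simp only [hD]
    linarith
  have h3 := (htime.const_mul_atTop (sub_pos.2 hr1)).eventually_ge_atTop (D (j0 + 1))
  obtain ⟨j, h4, h5⟩ := (h2.and h3).exists
  linarith

lemma exists_lt_arr (hlam : ∀ l, 0 < lam l) (k : Fin K) {v : Drive K} (hv : Good lam mu v)
    (l : Fin K) (n : ℕ) : ∃ j, n < (Core.run k v j).arr l :=
  ((tendsto_arr k hv.pos (hv.diverges hlam) l).eventually_gt_atTop n).exists

/-- When the server is idle, everything that has arrived has also entered service; idle epochs
recur. -/
lemma exists_lt_ent (hlam : ∀ l, 0 < lam l) (hstable : ∑ l, lam l / mu l < 1)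
    (k : Fin K) {v : Drive K} (hv : Good lam mu v) (l : Fin K) (n : ℕ) :
    ∃ j, n < (Core.run k v j).ent l := by
  obtain ⟨i, hi⟩ := exists_lt_arr hlam k hv l n
  obtain ⟨j, hj, hd⟩ := exists_idle_gt hlam hstable k hv i
  refine ⟨j, ?_⟩
  rw [(Core.inv_run k hv.pos j).idle hd]
  exact hi.trans_le (Core.arr_mono k v l hj.le)

lemma tendsto_sum_div_of_eventually_eq {f g : ℕ → ℝ} {c : ℝ} (N : ℕ)
    (hfg : ∀ n, N ≤ n → f n = g n)
    (hg : Tendsto (fun n : ℕ => (∑ i ∈ Finset.range n, g i) / n) atTop (𝓝 c)) :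
    Tendsto (fun n : ℕ => (∑ i ∈ Finset.range n, f i) / n) atTop (𝓝 c) := by
  set C := ∑ i ∈ Finset.range N, (f i - g i)
  have h1 : Tendsto (fun n : ℕ => C / (n : ℝ)) atTop (𝓝 0) :=
    tendsto_const_nhds.div_atTop tendsto_natCast_atTop_atTop
  have h2 := hg.add h1
  rw [add_zero] at h2
  refine h2.congr' ?_
  filter_upwards [eventually_ge_atTop N] with n hn
  rw [← add_div]
  congr 1
  have : ∑ i ∈ Finset.range n, (f i - g i) = C := by
    refine (Finset.sum_subset (Finset.range_mono hn) fun i _ hi => ?_).symm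
    rw [hfg i (by simpa using hi), sub_self]
  rw [← this, Finset.sum_sub_distrib]
  ring

/-- Only finitely many entries of each class differ from those of `v`, so averages keep their
limits. Nothing beyond positivity is asked of `w`, whose sampling law may have infinite means. -/
lemma good_splice (k : Fin K) (a e : Fin K → ℕ) (T : ℝ) {w v : Drive K} (hw : Pos w)
    (hv : Good lam mu v) (hT : ∀ l, arrivalSum w l (a l) ≤ T) :
    Good lam mu (splice k a e T w v) where
  pos := pos_splice k a e T hw hv.pos hT
  arrival l := by
    refine tendsto_sum_div_of_eventually_eq (a l + 1) (fun n hn => ?_) (hv.arrival l)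
    simp only [splice]
    rw [if_neg (by omega), if_neg (by omega)]
  service l := by
    refine tendsto_sum_div_of_eventually_eq (max (a l) (e l)) (fun n hn => ?_) (hv.service l)
    have h1 : a l ≤ n := (le_max_left _ _).trans hn
    have h2 : e l ≤ n := (le_max_right _ _).trans hn
    simp [splice, not_lt.2 h1, not_lt.2 h2]

lemma good_spliceAt (k : Fin K) (i : ℕ) {w v : Drive K} (hw : Pos w) (hv : Good lam mu v) :
    Good lam mu (spliceAt k i w v) :=
  good_splice k _ _ _ hw hv (Core.inv_run k hw i).le_time

/-- A long service time of class `k` forces the switch. -/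
lemma exists_switchAt (k : Fin K) (γmax : ℝ) {w : Drive K} (hw : Pos w) (hd : Diverges w) (n : ℕ)
    (hn : γmax < (w k n).2) : ∃ j, SwitchAt k γmax w j := by
  have hex : ∃ j, n < (Core.run k w j).arr k :=
    ((tendsto_arr k hw hd k).eventually_gt_atTop n).exists
  classical
  set j := Nat.find hex with hj
  have hjs := Nat.find_spec hex
  have hj0 : j ≠ 0 := by
    intro h0
    rw [← hj, h0] at hjs
    simp [Core.run, Core.start] at hjs
  obtain ⟨i, hi⟩ := Nat.exists_eq_succ_of_ne_zero hj0
  have hmin : (Core.run k w i).arr k ≤ n := not_lt.1 (Nat.find_min hex (by omega))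
  rw [← hj, hi] at hjs
  refine ⟨i, by simp only [Nat.succ_eq_add_one] at hjs; omega, ?_⟩
  have hev := Core.run_event k w i
  have I := Core.inv_run k hw i
  have hs0 : ∀ (c : Core K), 0 ≤ ∑ l ∈ Finset.univ.filter (fun l => l ≤ k),
      ∑ m ∈ Finset.Ico (c.ent l) (c.arr l), (w l m).2 := fun c =>
    Finset.sum_nonneg fun l _ => Finset.sum_nonneg fun m _ => (hw l m).2.le
  simp only [Nat.succ_eq_add_one] at hjs
  revert hjs
  generalize Core.run k w (i + 1) = c at hev
  intro hjs
  cases hev with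
  | arriveIdle l hl hdn =>
    by_cases hlk : k = l
    -- The arriving job enters at once, so its own service time is the remaining service time in the
    -- backlog; in the busy case below it is a summand of the waiting work.
    · subst hlk
      simp only [Function.update_self] at hjs
      have harr : (Core.run k w i).ent k = n := by rw [I.idle hdn]; omega
      unfold Core.backlog
      refine hn.trans_le ?_
      simp only [Option.getD_some, harr]
      refine le_add_of_nonneg_of_le ?_ (by simp)
      exact Finset.sum_nonneg fun l _ => Finset.sum_nonneg fun m _ => (hw l m).2.le
    · simp [hlk] at hjs; omega
  | arriveBusy l t hl hdn ht =>
    by_cases hlk : k = l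
    · subst hlk
      simp only [Function.update_self] at hjs
      have harr : (Core.run k w i).arr k = n := by omega
      unfold Core.backlog
      refine hn.trans_le ?_
      simp only [Option.getD_some]
      have hmem : k ∈ Finset.univ.filter (fun l : Fin K => l ≤ k) := by simp
      have hmem2 : n ∈ Finset.Ico ((Core.run k w i).ent k)
          (Function.update (Core.run k w i).arr k ((Core.run k w i).arr k + 1) k) := by
        simp [harr]
        rw [← harr]; exact I.ent_le k
      have h1 := Finset.single_le_sum (f := fun m => (w k m).2) (fun m _ => (hw k m).2.le) hmem2
      have h2 := Finset.single_le_sum (f := fun l => ∑ m ∈ Finset.Ico ((Core.run k w i).ent l)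
          (Function.update (Core.run k w i).arr k ((Core.run k w i).arr k + 1) l), (w l m).2)
        (fun l _ => Finset.sum_nonneg fun m _ => (hw l m).2.le) hmem
      linarith
    · simp [hlk] at hjs; omega
  | departBusy t m => simp only at hjs; omega
  | departIdle t => simp only at hjs; omega

/-! ### Response times within the first cycle -/

/-- Response time in terms of the queue. -/
def resp (k : Fin K) (c : ℕ → Core K) (n : ℕ) : ℝ :=
  (c (sInf {j | n < (c j).ent k})).dep.getD 0 - (c (sInf {j | n < (c j).arr k})).time

/-- The `n`-th class-`k` job enters service before the end of the first cycle. -/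
def InCycle (k : Fin K) (c : ℕ → Core K) (n : ℕ) : Prop :=
  ∃ j, n < (c j).ent k ∧ ∀ i, 0 < i → i ≤ j → (c i).dep ≠ none

lemma sInf_congr_of_le {p q : ℕ → Prop} (i : ℕ) (h : ∀ j ≤ i, p j ↔ q j) (hi : p i) :
    sInf {j | p j} = sInf {j | q j} := by
  have hp : sInf {j | p j} ≤ i := Nat.sInf_le hi
  have hq : sInf {j | q j} ≤ i := Nat.sInf_le ((h i le_rfl).1 hi)
  have mp : p (sInf {j | p j}) := Nat.sInf_mem (s := {j | p j}) ⟨i, hi⟩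
  have mq : q (sInf {j | q j}) := Nat.sInf_mem (s := {j | q j}) ⟨i, (h i le_rfl).1 hi⟩
  exact le_antisymm (Nat.sInf_le ((h _ hq).2 mq)) (Nat.sInf_le ((h _ hp).1 mp))

/-- With non-preemptive service the departure epoch is fixed on entry, so the response time is known
by then; likewise membership in the cycle in `inCycle_congr`. -/
lemma resp_congr (k : Fin K) {c c' : ℕ → Core K} (i n : ℕ) (h : ∀ j ≤ i, Core.Same (c j) (c' j))
    (hn : n < (c i).ent k) (hle : (c i).ent k ≤ (c i).arr k) : resp k c n = resp k c' n := by
  have h1 : sInf {j | n < (c j).ent k} = sInf {j | n < (c' j).ent k} :=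
    sInf_congr_of_le (p := fun j => n < (c j).ent k) i (fun j hj => by rw [(h j hj).ent]) hn
  have h2 : sInf {j | n < (c j).arr k} = sInf {j | n < (c' j).arr k} :=
    sInf_congr_of_le (p := fun j => n < (c j).arr k) i (fun j hj => by rw [(h j hj).arr])
      (hn.trans_le hle)
  have l1 : sInf {j | n < (c j).ent k} ≤ i := Nat.sInf_le hn
  have l2 : sInf {j | n < (c j).arr k} ≤ i := Nat.sInf_le (hn.trans_le hle)
  unfold resp
  rw [← h1, ← h2, (h _ l1).dep, (h _ l2).time]

lemma inCycle_congr (k : Fin K) {c c' : ℕ → Core K} (i n : ℕ)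
    (h : ∀ j ≤ i, Core.Same (c j) (c' j)) (hn : n < (c i).ent k) :
    InCycle k c n ↔ InCycle k c' n := by
  constructor
  · rintro ⟨j, h1, h2⟩
    rcases le_total j i with hj | hj
    · exact ⟨j, by rw [(h j hj).ent]; exact h1, fun m h3 h4 => by
        rw [(h m (h4.trans hj)).dep]; exact h2 m h3 h4⟩
    · exact ⟨i, by rw [(h i le_rfl).ent]; exact hn, fun m h3 h4 => by
        rw [(h m h4).dep]; exact h2 m h3 (h4.trans hj)⟩
  · rintro ⟨j, h1, h2⟩
    rcases le_total j i with hj | hj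
    · exact ⟨j, by rw [← (h j hj).ent]; exact h1, fun m h3 h4 => by
        rw [← (h m (h4.trans hj)).dep]; exact h2 m h3 h4⟩
    · exact ⟨i, hn, fun m h3 h4 => by
        rw [← (h m h4).dep]; exact h2 m h3 (h4.trans hj)⟩

lemma responseTime_eq (k : Fin K) (x : ℕ → State K) (n : ℕ) :
    responseTime k x n = resp k (fun j => (x j).core) n := rfl

/-- In a finite cycle, the class-`k` jobs served are those which enter service before its end. -/
lemma lt_cycleCount_iff (k : Fin K) {d : Drive K} (x : ℕ → State K)
    (hx : ∀ j, Core.Same (Core.run k d j) (x j).core)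
    (hfin : ∃ j, 0 < j ∧ (Core.run k d j).dep = none) (n : ℕ) :
    n < cycleCount k x ↔ InCycle k (Core.run k d) n := by
  have hdep : ∀ j, (x j).dep = (Core.run k d j).dep := fun j => (hx j).dep
  have hent : ∀ j, (x j).ent = (Core.run k d j).ent := fun j => (hx j).ent
  have hset : {j | 0 < j ∧ (x j).dep = none} = {j | 0 < j ∧ (Core.run k d j).dep = none} := by
    ext j; simp only [Set.mem_ofPred_eq, hdep]
  have hm : cycleStep x ∈ {j | 0 < j ∧ (Core.run k d j).dep = none} := by
    unfold cycleStep
    rw [hset]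
    exact Nat.sInf_mem hfin
  unfold cycleCount
  set m := cycleStep x with hmdef
  rw [hent]
  have hmin : ∀ i, 0 < i → i < m → (Core.run k d i).dep ≠ none := by
    intro i h1 h2 h3
    have : cycleStep x ≤ i := Nat.sInf_le (show i ∈ {j | 0 < j ∧ (x j).dep = none} by
      rw [hset]; exact ⟨h1, h3⟩)
    omega
  obtain ⟨i, hi⟩ := Nat.exists_eq_succ_of_ne_zero hm.1.ne'
  have hev := Core.run_event k d i
  -- The event that ends the cycle is a departure to an empty system; it admits no job, so all
  -- entries occurred strictly before it.
  have hlast : (Core.run k d m).ent = (Core.run k d i).ent := by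
    have h2 := hm.2
    rw [hi] at h2 ⊢
    simp only [Nat.succ_eq_add_one] at h2 ⊢
    revert h2
    generalize Core.run k d (i + 1) = c at hev
    intro h2
    cases hev with
    | arriveIdle => simp at h2
    | arriveBusy => simp at h2
    | departBusy => simp at h2
    | departIdle => rfl
  constructor
  · intro h
    rw [hlast] at h
    exact ⟨i, h, fun j h1 h2 => hmin j h1 (by omega)⟩
  · rintro ⟨j, h1, h2⟩
    have hjm : j < m := by
      by_contra h
      exact h2 m hm.1 (not_lt.1 h) hm.2
    exact h1.trans_le (Core.ent_mono k d k hjm.le)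

lemma nominalPath_same (k : Fin K) (v : Drive K) (j : ℕ) :
    Core.Same (Core.run k v j) (nominalPath k v j).core := by
  rw [(core_nominalPath k v j).1]
  exact ⟨rfl, rfl, rfl, rfl⟩

lemma responseTime_nominalPath (k : Fin K) (v : Drive K) (n : ℕ) :
    responseTime k (nominalPath k v) n = resp k (Core.run k v) n := by
  rw [responseTime_eq]
  congr 1
  funext j
  exact (core_nominalPath k v j).1

lemma resp_pos (k : Fin K) {v : Drive K} (hv : Pos v) (n : ℕ)
    (hn : ∃ j, n < (Core.run k v j).ent k) : 0 < resp k (Core.run k v) n := by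
  set j := sInf {j | n < (Core.run k v j).ent k} with hj
  have hmem : n < (Core.run k v j).ent k := Nat.sInf_mem (s := {j | n < (Core.run k v j).ent k}) hn
  have hj0 : j ≠ 0 := by
    intro h0
    rw [h0] at hmem
    simp [Core.run, Core.start] at hmem
  obtain ⟨i, hi⟩ := Nat.exists_eq_succ_of_ne_zero hj0
  have hle : sInf {j | n < (Core.run k v j).arr k} ≤ j :=
    Nat.sInf_le (show n < _ from hmem.trans_le ((Core.inv_run k hv j).ent_le k))
  have h1 := Core.time_mono k hv hle
  -- The event at which the job enters is not a departure to an empty system, so the default value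
  -- in `resp` is not used.
  have hne : (Core.run k v j).dep ≠ none := by
    intro h
    have hev := Core.run_event k v i
    have hlt : ¬ n < (Core.run k v i).ent k := Nat.notMem_of_lt_sInf (s := {j | n < (Core.run k v j).ent k}) (by omega)
    rw [hi] at h hmem
    simp only [Nat.succ_eq_add_one] at h hmem
    revert h hmem
    generalize Core.run k v (i + 1) = c at hev
    intro hmem h
    cases hev with
    | arriveIdle => simp at h
    | arriveBusy => simp at h
    | departBusy => simp at h
    | departIdle => exact hlt hmem
  obtain ⟨t, ht⟩ := Option.ne_none_iff_exists'.1 hne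
  have h2 := (Core.inv_run k hv j).time_lt_dep t ht
  unfold resp
  rw [← hj, ht]
  simp only [Option.getD_some] at h1 ⊢
  linarith

/-! ### Restarting after an idle period -/

/-- The input after the first `a l` jobs of each class `l`. -/
def shiftDrive (a : Fin K → ℕ) (v : Drive K) : Drive K := fun l n => v l (a l + n)

namespace Core

/-- A queue which starts at time `T` with job numbers shifted by `a`. -/
def translate (a : Fin K → ℕ) (T : ℝ) (c : Core K) : Core K where
  time := T + c.time
  arr := fun l => a l + c.arr l
  ent := fun l => a l + c.ent l
  next := fun l => T + c.next l
  dep := c.dep.map fun t => T + t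

lemma Event.translate {a : Fin K → ℕ} {T : ℝ} {v d : Drive K} {c c' : Core K} (h : Event v c c')
    (h1 : ∀ l n, (d l (a l + (n + 1))).1 = (v l (n + 1)).1)
    (h2 : ∀ l n, (d l (a l + n)).2 = (v l n).2) :
    Event d (c.translate a T) (c'.translate a T) := by
  have hnext : ∀ l, c.IsNext l → (c.translate a T).IsNext l := fun l hl =>
    ⟨fun j => by simpa [Core.translate] using hl.1 j,
      fun j hj => by simpa [Core.translate] using hl.2 j hj⟩
  have hu : ∀ (f : Fin K → ℕ) (m : Fin K), (fun l => a l + Function.update f m (f m + 1) l)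
      = Function.update (fun l => a l + f l) m (a m + f m + 1) := by
    intro f m
    funext l
    by_cases hl : l = m
    · subst hl; simp; omega
    · simp [hl]
  have hv : ∀ (f : Fin K → ℝ) (m : Fin K) (s : ℝ), (fun l => T + Function.update f m (f m + s) l)
      = Function.update (fun l => T + f l) m (T + f m + s) := by
    intro f m s
    funext l
    by_cases hl : l = m
    · subst hl; simp; ring
    · simp [hl]
  cases h with
  | arriveIdle l hl hd =>
    convert Event.arriveIdle (v := d) (c := c.translate a T) l (hnext l hl) (by simp [Core.translate, hd]) using 1
    simp only [Core.translate, hu, hv, Option.map_some, add_assoc, h1, h2, true_and]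
  | arriveBusy l t hl hd ht =>
    convert Event.arriveBusy (v := d) (c := c.translate a T) l (T + t) (hnext l hl) (by simp [Core.translate, hd])
      (by simpa [Core.translate] using ht) using 1
    simp only [Core.translate, hu, hv, Option.map_some, add_assoc, h1, true_and]
  | departBusy t m hd ht hm =>
    convert Event.departBusy (v := d) (c := c.translate a T) (T + t) m (by simp [Core.translate, hd])
      (fun j => by simpa [Core.translate] using ht j)
      ⟨by simpa [Core.translate] using hm.1, fun l hl => by simpa [Core.translate] using hm.2 l hl⟩ using 1
    simp only [Core.translate, hu, Option.map_some, add_assoc, h2, true_and]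
  | departIdle t hd ht hm =>
    convert Event.departIdle (v := d) (c := c.translate a T) (T + t) (by simp [Core.translate, hd])
      (fun j => by simpa [Core.translate] using ht j)
      (fun l => by simpa [Core.translate] using hm l) using 1
    simp [Core.translate]

end Core

/-- After an idle epoch the run of the spliced input restarts with the shifted second input. -/
theorem run_spliceAt_idle (k : Fin K) {w v : Drive K} (hw : Pos w) (hv : Pos v) (i : ℕ)
    (hi : (Core.run k w i).dep = none) (j : ℕ) :
    Core.run k (spliceAt k i w v) (i + j)
      = (Core.run k (shiftDrive (Core.run k w i).arr v) j).translate (Core.run k w i).arr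
          (Core.run k w i).time := by
  have I := Core.inv_run k hw i
  -- In `splice` the service times of classes above `k` are cut at `e` and those of the others at
  -- `a`; at an idle epoch both cuts coincide, so one shift of job numbers serves all classes.
  have hent : (Core.run k w i).ent = (Core.run k w i).arr := funext fun l => I.idle hi l
  induction j with
  | zero =>
    have hs := same_spliceAt k hw hv i i le_rfl
    ext1
    · simp [hs.time, Core.translate, Core.run, Core.start]
    · simp [hs.arr, Core.translate, Core.run, Core.start]
    · simp [hs.ent, hent, Core.translate, Core.run, Core.start]
    · funext l
      simp [next_spliceAt k hw hv, Core.translate, Core.run, Core.start, shiftDrive]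
    · simp [hs.dep, hi, Core.translate, Core.run, Core.start]
  | succ j ih =>
    have hev := (Core.run_event k (shiftDrive (Core.run k w i).arr v) j).translate
      (a := (Core.run k w i).arr) (T := (Core.run k w i).time) (d := spliceAt k i w v)
      (fun l n => by simp [spliceAt, splice, shiftDrive])
      (fun l n => by simp [spliceAt, splice, shiftDrive, hent])
    have := Core.step_eq_of_event k _ _ _ hev
    rw [← this, ← ih]
    rfl

lemma sInf_shift {p q : ℕ → Prop} (i : ℕ) (h : ∀ j, p (i + j) ↔ q j) (h0 : ∀ j < i, ¬ p j)
    (hq : ∃ j, q j) : sInf {j | p j} = i + sInf {j | q j} := by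
  have mq : q (sInf {j | q j}) := Nat.sInf_mem (s := {j | q j}) hq
  have mp : p (sInf {j | p j}) := Nat.sInf_mem (s := {j | p j}) ⟨_, (h _).2 mq⟩
  refine le_antisymm (Nat.sInf_le ((h _).2 mq)) ?_
  have hle : i ≤ sInf {j | p j} := by
    by_contra hlt
    exact h0 _ (not_le.1 hlt) mp
  obtain ⟨m, hm⟩ := Nat.exists_eq_add_of_le hle
  rw [hm] at mp ⊢
  exact Nat.add_le_add_left (Nat.sInf_le ((h m).1 mp)) i

/-- Response times after an idle epoch. -/
lemma resp_spliceAt_idle (k : Fin K) {w v : Drive K} (hw : Pos w) (hv : Pos v) (i : ℕ)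
    (hi : (Core.run k w i).dep = none) (n : ℕ)
    (hn : ∃ j, n < (Core.run k (shiftDrive (Core.run k w i).arr v) j).ent k) :
    resp k (Core.run k (spliceAt k i w v)) ((Core.run k w i).arr k + n)
      = resp k (Core.run k (shiftDrive (Core.run k w i).arr v)) n := by
  have I := Core.inv_run k hw i
  have hent := I.idle hi k
  have hrun := run_spliceAt_idle k hw hv i hi
  have hs := same_spliceAt k hw hv i i le_rfl
  have hsa := hs.arr
  have hse := hs.ent
  generalize (Core.run k w i).arr = a at *
  generalize (Core.run k w i).ent = e at *
  generalize spliceAt k i w v = d at *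
  set v' := shiftDrive a v with hv'd
  have hv' : Pos v' := fun l m => hv l _
  have e1 : sInf {j | a k + n < (Core.run k d j).ent k}
      = i + sInf {j | n < (Core.run k v' j).ent k} := by
    refine sInf_shift (p := fun j => a k + n < (Core.run k d j).ent k) i (fun j => ?_)
      (fun j hj => ?_) hn
    · rw [hrun j]; simp [Core.translate]
    · have h1 := Core.ent_mono k d k hj.le
      simp only at h1
      rw [hse, hent] at h1
      omega
  have e2 : sInf {j | a k + n < (Core.run k d j).arr k}
      = i + sInf {j | n < (Core.run k v' j).arr k} := by
    refine sInf_shift (p := fun j => a k + n < (Core.run k d j).arr k) i (fun j => ?_)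
      (fun j hj => ?_) (hn.imp fun j hj => hj.trans_le ((Core.inv_run k hv' j).ent_le k))
    · rw [hrun j]; simp [Core.translate]
    · have h1 := Core.arr_mono k d k hj.le
      simp only at h1
      rw [hsa] at h1
      omega
  -- Positivity excludes the default departure epoch 0, which would not be translated by the idle
  -- epoch.
  have hpos := resp_pos k hv' n hn
  unfold resp at hpos ⊢
  rw [e1, e2, hrun, hrun]
  rcases hd : (Core.run k v' (sInf {j | n < (Core.run k v' j).ent k})).dep with _ | t
  · rw [hd] at hpos
    have := (Core.inv_run k hv' (sInf {j | n < (Core.run k v' j).arr k})).time_nonneg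
    simp only [Option.getD_none] at hpos
    linarith
  · simp only [Core.translate, hd, Option.map_some, Option.getD_some]
    ring

end PriorityQueue
end

noncomputable section
namespace PriorityQueue
variable {K : ℕ}

/-! ### Measurability -/

/-- Class numbers, job numbers and step numbers are discrete, so a random index is handled by
splitting into countably many measurable cases. -/
lemma measurable_of_cases {α β ι : Type*} [MeasurableSpace α] [MeasurableSpace β] [Countable ι]
    {c : α → ι} (hc : ∀ i, MeasurableSet {a | c a = i}) {F : ι → α → β}
    (hF : ∀ i, Measurable (F i)) : Measurable fun a => F (c a) a := by
  intro S hS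
  have : (fun a => F (c a) a) ⁻¹' S = ⋃ i, ({a | c a = i} ∩ F i ⁻¹' S) := by
    ext a; simp
  rw [this]
  exact MeasurableSet.iUnion fun i => (hc i).inter (hF i hS)

/-- The components of a state. -/
def State.data (s : State K) : ℝ × (Fin K → ℕ) × (Fin K → ℕ) × (Fin K → ℝ) × (Bool × ℝ) × Bool ×
    ℝ × (Fin K → ℕ) × (Fin K → ℕ) :=
  (s.time, s.arr, s.ent, s.next, (s.dep.isSome, s.dep.getD 0), s.switched, s.obsTime, s.obsArr,
    s.obsEnt)

/-- The departure epoch is represented by a flag and a real number with default 0, so measurability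
into `State K` is measurability of the components. -/
instance : MeasurableSpace (State K) := MeasurableSpace.comap State.data inferInstance

lemma measurable_data : Measurable (State.data (K := K)) := comap_measurable _


section

variable {α : Type*} [MeasurableSpace α] {s : α → State K}

lemma measurable_state_iff : Measurable s ↔ Measurable fun a => (s a).data :=
  measurable_comap_iff

lemma _root_.Measurable.state_time (hs : Measurable s) : Measurable fun a => (s a).time :=
  (measurable_data.comp hs).fst
lemma _root_.Measurable.state_arr (hs : Measurable s) : Measurable fun a => (s a).arr :=
  (measurable_data.comp hs).snd.fst
lemma _root_.Measurable.state_ent (hs : Measurable s) : Measurable fun a => (s a).ent :=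
  (measurable_data.comp hs).snd.snd.fst
lemma _root_.Measurable.state_next (hs : Measurable s) : Measurable fun a => (s a).next :=
  (measurable_data.comp hs).snd.snd.snd.fst
lemma _root_.Measurable.state_isSome (hs : Measurable s) : Measurable fun a => (s a).dep.isSome :=
  (measurable_data.comp hs).snd.snd.snd.snd.fst.fst
lemma _root_.Measurable.state_dep (hs : Measurable s) : Measurable fun a => (s a).dep.getD 0 :=
  (measurable_data.comp hs).snd.snd.snd.snd.fst.snd
lemma _root_.Measurable.state_switched (hs : Measurable s) : Measurable fun a => (s a).switched :=
  (measurable_data.comp hs).snd.snd.snd.snd.snd.fst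
lemma _root_.Measurable.state_obsTime (hs : Measurable s) : Measurable fun a => (s a).obsTime :=
  (measurable_data.comp hs).snd.snd.snd.snd.snd.snd.fst
lemma _root_.Measurable.state_obsArr (hs : Measurable s) : Measurable fun a => (s a).obsArr :=
  (measurable_data.comp hs).snd.snd.snd.snd.snd.snd.snd.fst
lemma _root_.Measurable.state_obsEnt (hs : Measurable s) : Measurable fun a => (s a).obsEnt :=
  (measurable_data.comp hs).snd.snd.snd.snd.snd.snd.snd.snd

lemma measurable_state_mk {time : α → ℝ} {arr ent : α → Fin K → ℕ} {next : α → Fin K → ℝ}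
    {dep : α → Option ℝ} {sw : α → Bool} {oT : α → ℝ} {oA oE : α → Fin K → ℕ}
    (h1 : Measurable time) (h2 : Measurable arr) (h3 : Measurable ent) (h4 : Measurable next)
    (h5 : Measurable fun a => (dep a).isSome) (h6 : Measurable fun a => (dep a).getD 0)
    (h7 : Measurable sw) (h8 : Measurable oT) (h9 : Measurable oA) (h10 : Measurable oE) :
    Measurable fun a =>
      State.mk (time a) (arr a) (ent a) (next a) (dep a) (sw a) (oT a) (oA a) (oE a) :=
  measurable_state_iff.2 (h1.prodMk (h2.prodMk (h3.prodMk (h4.prodMk ((h5.prodMk h6).prodMk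
    (h7.prodMk (h8.prodMk (h9.prodMk h10))))))))

lemma measurable_update_coord {β : Type*} [MeasurableSpace β] (l : Fin K) {f : α → Fin K → β}
    {g : α → β} (hf : Measurable f) (hg : Measurable g) :
    Measurable fun a => Function.update (f a) l (g a) := by
  refine measurable_pi_lambda _ fun i => ?_
  by_cases h : i = l
  · subst h; simpa using hg
  · simp only [Function.update_of_ne h]
    exact (measurable_pi_apply i).comp hf

lemma measurable_entry {w : α → Drive K} (hw : Measurable w) (l : Fin K) {n : α → ℕ}
    (hn : Measurable n) : Measurable fun a => w a l (n a) :=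
  measurable_of_cases (c := n) (fun i => hn (measurableSet_singleton i))
    (F := fun i a => w a l i) fun i =>
      (measurable_pi_apply i).comp ((measurable_pi_apply l).comp hw)

lemma measurable_coord {β : Type*} [MeasurableSpace β] {f : α → Fin K → β} (hf : Measurable f)
    (l : Fin K) : Measurable fun a => f a l := (measurable_pi_apply l).comp hf

variable {w v : α → Drive K}

lemma measurable_input (hw : Measurable w) (hv : Measurable v) {b : α → Bool} (hb : Measurable b) :
    Measurable fun a => input (w a) (v a) (b a) := by
  unfold input
  exact Measurable.ite (hb (measurableSet_singleton true)) hv hw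

lemma measurable_observe (hs : Measurable s) : Measurable fun a => observe (s a) := by
  unfold observe
  exact Measurable.ite (hs.state_switched (measurableSet_singleton true)) hs
    (measurable_state_mk hs.state_time hs.state_arr hs.state_ent hs.state_next hs.state_isSome
      hs.state_dep hs.state_switched hs.state_time hs.state_arr hs.state_ent)

lemma measurable_serviceTime (k : Fin K) (hw : Measurable w) (hv : Measurable v)
    (hs : Measurable s) (l : Fin K) {n : α → ℕ} (hn : Measurable n) :
    Measurable fun a => serviceTime k (w a) (v a) (s a) l (n a) := by
  unfold serviceTime
  by_cases hl : l ≤ k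
  · simp only [hl, if_true]
    exact Measurable.ite (measurableSet_lt hn (measurable_coord hs.state_obsArr l))
      (measurable_entry hw l hn).snd (measurable_entry hv l hn).snd
  · simp only [hl, if_false]
    exact (measurable_entry (measurable_input hw hv hs.state_switched) l hn).snd

lemma measurable_enter (k : Fin K) (hw : Measurable w) (hv : Measurable v) (hs : Measurable s)
    (l : Fin K) : Measurable fun a => enter k (w a) (v a) l (s a) := by
  unfold enter
  have he := measurable_coord hs.state_ent l
  refine measurable_observe (measurable_state_mk hs.state_time hs.state_arr
    (measurable_update_coord l hs.state_ent (he.add_const 1)) hs.state_next ?_ ?_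
    hs.state_switched hs.state_obsTime hs.state_obsArr hs.state_obsEnt)
  · simp only [Option.isSome_some]; exact measurable_const
  · simp only [Option.getD_some]
    exact hs.state_time.add (measurable_serviceTime k hw hv hs l he)

lemma getD_sub_eq (d : Option ℝ) (t : ℝ) :
    d.getD t - t = if d.isSome = true then d.getD 0 - t else 0 := by
  cases d <;> simp

lemma measurable_sum_Ico (hw : Measurable w) (l : Fin K) {m n : α → ℕ} (hm : Measurable m)
    (hn : Measurable n) : Measurable fun a => ∑ i ∈ Finset.Ico (m a) (n a), (w a l i).2 :=
  measurable_of_cases (c := fun a => (m a, n a))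
    (fun i => (hm.prodMk hn) (measurableSet_singleton i))
    (F := fun i a => ∑ j ∈ Finset.Ico i.1 i.2, (w a l j).2) fun i =>
      Finset.measurable_fun_sum _ fun j _ => (measurable_entry hw l measurable_const).snd

lemma measurable_backlog (k : Fin K) (hw : Measurable w) (hs : Measurable s) :
    Measurable fun a => backlog k (w a) (s a) := by
  unfold backlog
  refine Measurable.add (Finset.measurable_fun_sum _ fun l _ => measurable_sum_Ico hw l
    (measurable_coord hs.state_ent l) (measurable_coord hs.state_arr l)) ?_
  simp only [getD_sub_eq]
  exact Measurable.ite (hs.state_isSome (measurableSet_singleton true))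
    (hs.state_dep.sub hs.state_time) measurable_const

lemma measurable_switchIfNeeded (k : Fin K) (γmax : ℝ) (hw : Measurable w) (hv : Measurable v)
    (hs : Measurable s) (l : Fin K) :
    Measurable fun a => switchIfNeeded k γmax (w a) (v a) l (s a) := by
  unfold switchIfNeeded
  refine Measurable.ite ?_ ?_ hs
  · by_cases hl : l = k
    · simp only [hl, true_and]
      exact (hs.state_switched (measurableSet_singleton false)).inter
        (measurableSet_lt measurable_const (measurable_backlog k hw hs))
    · simp [hl]
  · refine measurable_state_mk hs.state_time hs.state_arr hs.state_ent ?_ hs.state_isSome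
      hs.state_dep measurable_const hs.state_obsTime hs.state_obsArr hs.state_obsEnt
    exact measurable_pi_lambda _ fun j => hs.state_time.add
      (measurable_entry hv j (measurable_coord hs.state_arr j)).fst

lemma measurable_arrive (k : Fin K) (γmax : ℝ) (hw : Measurable w) (hv : Measurable v)
    (hs : Measurable s) (l : Fin K) : Measurable fun a => arrive k γmax (w a) (v a) l (s a) := by
  have harr := measurable_coord hs.state_arr l
  have hnext : Measurable fun a =>
      (s a).next l + (input (w a) (v a) (s a).switched l ((s a).arr l + 1)).1 :=
    (measurable_coord hs.state_next l).add
      (measurable_entry (measurable_input hw hv hs.state_switched) l (harr.add_const 1)).fst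
  have h1 := measurable_observe (measurable_state_mk (measurable_coord hs.state_next l)
    (measurable_update_coord l hs.state_arr (harr.add_const 1)) hs.state_ent
    (measurable_update_coord l hs.state_next hnext)
    hs.state_isSome hs.state_dep hs.state_switched hs.state_obsTime hs.state_obsArr
    hs.state_obsEnt)
  unfold arrive
  refine measurable_switchIfNeeded k γmax hw hv (Measurable.ite ?_ (measurable_enter k hw hv h1 l)
    h1) l
  have := h1.state_isSome (measurableSet_singleton false)
  convert this using 1
  ext a
  simp only [Set.mem_ofPred_eq, Set.mem_preimage, Set.mem_singleton_iff, Option.isNone_iff_eq_none,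
    Option.isSome_eq_false_iff]

lemma measurableSet_filter_eq {p : Fin K → α → Prop} [∀ l a, Decidable (p l a)]
    (hp : ∀ l, MeasurableSet {a | p l a}) (S : Finset (Fin K)) :
    MeasurableSet {a | (Finset.univ.filter fun l => p l a) = S} := by
  have : {a | (Finset.univ.filter fun l => p l a) = S}
      = ⋂ l, {a | p l a ↔ l ∈ S} := by
    ext a
    simp [Finset.ext_iff]
  rw [this]
  refine MeasurableSet.iInter fun l => ?_
  by_cases hl : l ∈ S
  · simpa [hl] using hp l
  · simp only [hl, iff_false]
    exact (hp l).compl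

lemma measurable_depart (k : Fin K) (hw : Measurable w) (hv : Measurable v) (hs : Measurable s)
    {t : α → ℝ} (ht : Measurable t) : Measurable fun a => depart k (w a) (v a) (t a) (s a) := by
  have h1 := measurable_observe (measurable_state_mk (dep := fun _ => none) ht hs.state_arr
    hs.state_ent hs.state_next (by simp) (by simp)
    hs.state_switched hs.state_obsTime hs.state_obsArr hs.state_obsEnt)
  unfold depart
  refine measurable_of_cases (ι := Finset (Fin K))
    (c := fun a => Finset.univ.filter fun l => (s a).ent l < (s a).arr l)
    (F := fun S a => if h : S.Nonempty then enter k (w a) (v a) (S.min' h)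
      (observe { s a with time := t a, dep := none })
      else observe { s a with time := t a, dep := none }) ?_ ?_
  · exact measurableSet_filter_eq fun l => measurableSet_lt (measurable_coord hs.state_ent l)
      (measurable_coord hs.state_arr l)
  · intro S
    by_cases hS : S.Nonempty
    · simp only [hS, dite_true]
      exact measurable_enter k hw hv h1 _
    · simp only [hS, dite_false]
      exact h1

lemma measurableSet_nextClass (k : Fin K) (hs : Measurable s) (l : Fin K) :
    MeasurableSet {a | nextClass k (s a) = l} := by
  have : {a | nextClass k (s a) = l} = {a | (∀ j, (s a).next l ≤ (s a).next j) ∧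
      ∀ j < l, (s a).next l < (s a).next j} := by
    ext a
    simp only [Set.mem_ofPred_eq, nextClass_eq]
    constructor
    · rintro rfl; exact firstClass_spec k _
    · rintro ⟨h1, h2⟩; exact firstClass_eq k _ l h1 h2
  rw [this]
  have hn := fun j => measurable_coord hs.state_next j
  refine MeasurableSet.inter ?_ ?_
  · exact measurableSet_setOfPred.2 (Measurable.forall fun j => measurableSet_setOfPred.1 (measurableSet_le (hn l) (hn j)))
  · refine measurableSet_setOfPred.2 (Measurable.forall fun j => ?_)
    by_cases hj : j < l
    · simpa [hj] using measurableSet_setOfPred.1 (measurableSet_lt (hn l) (hn j))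
    · simp [hj]

lemma measurable_step (k : Fin K) (γmax : ℝ) (hw : Measurable w) (hv : Measurable v)
    (hs : Measurable s) : Measurable fun a => step k γmax (w a) (v a) (s a) := by
  have harr : Measurable fun a => arrive k γmax (w a) (v a) (nextClass k (s a)) (s a) :=
    measurable_of_cases (c := fun a => nextClass k (s a)) (measurableSet_nextClass k hs)
      (F := fun l a => arrive k γmax (w a) (v a) l (s a)) fun l =>
        measurable_arrive k γmax hw hv hs l
  have hnx : Measurable fun a => (s a).next (nextClass k (s a)) :=
    measurable_of_cases (c := fun a => nextClass k (s a)) (measurableSet_nextClass k hs)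
      (F := fun l a => (s a).next l) fun l => measurable_coord hs.state_next l
  have heq : (fun a => step k γmax (w a) (v a) (s a)) = fun a =>
      open Classical in
      if (s a).dep.isSome = true ∧ (s a).dep.getD 0 ≤ (s a).next (nextClass k (s a)) then
        depart k (w a) (v a) ((s a).dep.getD 0) (s a)
      else arrive k γmax (w a) (v a) (nextClass k (s a)) (s a) := by
    funext a
    unfold step
    rcases hd : (s a).dep with _ | t
    · simp
    · by_cases h : (s a).next (nextClass k (s a)) < t
      · simp [h, not_le.2 h]
      · simp [h, not_lt.1 h]
  rw [heq]
  exact Measurable.ite ((hs.state_isSome (measurableSet_singleton true)).inter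
    (measurableSet_le hs.state_dep hnx)) (measurable_depart k hw hv hs hs.state_dep) harr

lemma measurable_path (k : Fin K) (γmax : ℝ) (hw : Measurable w) (hv : Measurable v) (b : Bool)
    (j : ℕ) : Measurable fun a => path k γmax (w a) (v a) b j := by
  induction j with
  | zero =>
    refine measurable_state_mk measurable_const measurable_const measurable_const ?_ ?_ ?_
      measurable_const measurable_const measurable_const measurable_const
    · exact measurable_pi_lambda _ fun l =>
        (measurable_entry (measurable_input hw hv measurable_const) l measurable_const).fst
    · simp
    · simp
  | succ j ih => exact measurable_step k γmax hw hv ih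

end

lemma measurable_samplingPath (k : Fin K) (γmax : ℝ) (j : ℕ) :
    Measurable fun u : Drive K × Drive K => samplingPath k γmax u j :=
  measurable_path k γmax measurable_fst measurable_snd false j

lemma measurable_nominalPath (k : Fin K) (j : ℕ) :
    Measurable fun v : Drive K => nominalPath k v j :=
  measurable_path k 0 measurable_id measurable_id true j

lemma measurable_sInf_nat {α : Type*} [MeasurableSpace α] {p : ℕ → α → Prop}
    (hp : ∀ j, MeasurableSet {a | p j a}) : Measurable fun a => sInf {j | p j a} := by
  classical
  refine measurable_to_countable' fun n => ?_
  -- The second set accounts for the convention that the infimum of the empty set of natural numbers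
  -- is 0.
  have : (fun a => sInf {j | p j a}) ⁻¹' {n}
      = ({a | p n a} ∩ ⋂ j, {a | j < n → ¬ p j a}) ∪ (if n = 0 then ⋂ j, {a | ¬ p j a} else ∅) := by
    ext a
    simp only [Set.mem_preimage, Set.mem_singleton_iff, Set.mem_union, Set.mem_inter_iff,
      Set.mem_ofPred_eq, Set.mem_iInter]
    by_cases hex : ∃ j, p j a
    · have hz : a ∉ (if n = 0 then ⋂ j, {a | ¬ p j a} else (∅ : Set α)) := by
        split_ifs
        · simpa using hex
        · simp
      simp only [hz, or_false]
      constructor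
      · rintro rfl
        exact ⟨Nat.sInf_mem (s := {j | p j a}) hex, fun j hj => Nat.notMem_of_lt_sInf hj⟩
      · rintro ⟨h1, h2⟩
        exact le_antisymm (Nat.sInf_le h1) (not_lt.1 fun h =>
          h2 _ h (Nat.sInf_mem (s := {j | p j a}) hex))
    · have hempty : {j | p j a} = ∅ := by
        ext j; simpa using fun h => hex ⟨j, h⟩
      have hn : ¬ p n a := fun h => hex ⟨n, h⟩
      rw [hempty]
      simp only [Nat.sInf_empty, hn, false_and, false_or]
      split_ifs with h0
      · simp only [h0, Set.mem_iInter, Set.mem_ofPred_eq, true_iff]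
        exact fun j h => hex ⟨j, h⟩
      · simp [Ne.symm h0]
  rw [this]
  refine MeasurableSet.union ((hp n).inter (MeasurableSet.iInter fun j => ?_)) ?_
  · by_cases hj : j < n
    · simp only [hj, true_implies]
      exact (hp j).compl
    · simp [hj]
  · split_ifs
    · exact MeasurableSet.iInter fun j => (hp j).compl
    · exact .empty

/-! ### Measurability of response times and cycle quantities -/

section

variable {α : Type*} [MeasurableSpace α] {x : α → ℕ → State K}

lemma measurable_at {β : Type*} [MeasurableSpace β] {y : α → ℕ → β}
    (hy : ∀ j, Measurable fun a => y a j) {n : α → ℕ} (hn : Measurable n) :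
    Measurable fun a => y a (n a) :=
  measurable_of_cases (c := n) (fun i => hn (measurableSet_singleton i)) (F := fun i a => y a i) hy

lemma measurable_entryStep (k : Fin K) (hx : ∀ j, Measurable fun a => x a j) (n : ℕ) :
    Measurable fun a => entryStep k (x a) n :=
  measurable_sInf_nat fun j => measurableSet_lt measurable_const
    (measurable_coord (hx j).state_ent k)

lemma measurable_arrivalStep (k : Fin K) (hx : ∀ j, Measurable fun a => x a j) (n : ℕ) :
    Measurable fun a => arrivalStep k (x a) n :=
  measurable_sInf_nat fun j => measurableSet_lt measurable_const
    (measurable_coord (hx j).state_arr k)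

lemma measurable_responseTime (k : Fin K) (hx : ∀ j, Measurable fun a => x a j) (n : ℕ) :
    Measurable fun a => responseTime k (x a) n :=
  (measurable_at hx (measurable_entryStep k hx n)).state_dep.sub
    (measurable_at hx (measurable_arrivalStep k hx n)).state_time

lemma measurableSet_dep_eq_none {s : α → State K} (hs : Measurable s) :
    MeasurableSet {a | (s a).dep = none} := by
  convert hs.state_isSome (measurableSet_singleton false) using 1
  ext a
  simp

lemma measurable_cycleStep (hx : ∀ j, Measurable fun a => x a j) :
    Measurable fun a => cycleStep (x a) := by
  refine measurable_sInf_nat (p := fun j a => 0 < j ∧ (x a j).dep = none) fun j => ?_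
  by_cases hj : 0 < j
  · simpa [hj] using measurableSet_dep_eq_none (hx j)
  · simp [hj]

lemma measurable_cycleCount (k : Fin K) (hx : ∀ j, Measurable fun a => x a j) :
    Measurable fun a => cycleCount k (x a) :=
  measurable_coord (measurable_at hx (measurable_cycleStep hx)).state_ent k

end

/-- The likelihood in terms of the observed numbers and time. -/
def lik (gA gS : Fin K → ℝ → ℝ) (k : Fin K) (a e : Fin K → ℕ) (T : ℝ) (w : Drive K) : ℝ :=
  (∏ l, (∏ n ∈ Finset.range (a l), gA l (w l n).1) * tail (gA l) (T - arrivalSum w l (a l)))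
    * (∏ l ∈ Finset.univ.filter (fun l => l ≤ k), ∏ n ∈ Finset.range (a l), gS l (w l n).2)
    * (∏ l ∈ Finset.univ.filter (fun l => k < l), ∏ n ∈ Finset.range (e l), gS l (w l n).2)

lemma likelihood_eq_lik (gA gS : Fin K → ℝ → ℝ) (k : Fin K) (w : Drive K) (s : State K) :
    likelihood gA gS k w s = lik gA gS k s.obsArr s.obsEnt s.obsTime w := rfl

lemma measurable_tail {g : ℝ → ℝ} (hg : Integrable g) (h0 : ∀ x, 0 ≤ g x) : Measurable (tail g) :=
  Antitone.measurable fun a b hab => setIntegral_mono_set hg.integrableOn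
    (Eventually.of_forall h0) (Set.Ioi_subset_Ioi hab).eventuallyLE

lemma measurable_lik {α : Type*} [MeasurableSpace α] {gA gS : Fin K → ℝ → ℝ}
    (hA : ∀ l, Measurable (gA l)) (hS : ∀ l, Measurable (gS l)) (hT : ∀ l, Measurable (tail (gA l)))
    (k : Fin K) (a e : Fin K → ℕ) {T : α → ℝ} {w : α → Drive K} (hTm : Measurable T)
    (hw : Measurable w) : Measurable fun x => lik gA gS k a e (T x) (w x) := by
  have h1 : ∀ l n, Measurable fun x => (w x l n).1 := fun l n =>
    (measurable_entry hw l measurable_const).fst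
  have h2 : ∀ l n, Measurable fun x => (w x l n).2 := fun l n =>
    (measurable_entry hw l measurable_const).snd
  unfold lik arrivalSum
  refine Measurable.mul (Measurable.mul ?_ ?_) ?_
  · refine Finset.measurable_fun_prod _ fun l _ => Measurable.mul ?_ ?_
    · exact Finset.measurable_fun_prod _ fun n _ => (hA l).comp (h1 l n)
    · exact (hT l).comp (hTm.sub (Finset.measurable_fun_sum _ fun n _ => h1 l n))
  · exact Finset.measurable_fun_prod _ fun l _ => Finset.measurable_fun_prod _ fun n _ =>
      (hS l).comp (h2 l n)
  · exact Finset.measurable_fun_prod _ fun l _ => Finset.measurable_fun_prod _ fun n _ =>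
      (hS l).comp (h2 l n)

lemma measurable_likelihood {α : Type*} [MeasurableSpace α] {gA gS : Fin K → ℝ → ℝ}
    (hA : ∀ l, Measurable (gA l)) (hS : ∀ l, Measurable (gS l)) (hT : ∀ l, Measurable (tail (gA l)))
    (k : Fin K) {w : α → Drive K} {s : α → State K} (hw : Measurable w) (hs : Measurable s) :
    Measurable fun x => likelihood gA gS k (w x) (s x) := by
  simp only [likelihood_eq_lik]
  exact measurable_of_cases (c := fun x => ((s x).obsArr, (s x).obsEnt))
    (fun i => (hs.state_obsArr.prodMk hs.state_obsEnt) (measurableSet_singleton i))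
    (F := fun i x => lik gA gS k i.1 i.2 (s x).obsTime (w x))
    fun i => measurable_lik hA hS hT k _ _ hs.state_obsTime hw

end PriorityQueue
end

noncomputable section
namespace PriorityQueue
variable {K : ℕ}

/-! ### The law of the input -/

section Density

variable {f g : ℝ → ℝ}

lemma IsSamplingDensity.isProbabilityMeasure (hg : IsSamplingDensity g) :
    IsProbabilityMeasure (densityLaw g) := by
  constructor
  rw [densityLaw, withDensity_apply _ .univ, setLIntegral_univ, hg.lintegral_eq_one]

lemma densityLaw_absolutelyContinuous (g : ℝ → ℝ) : densityLaw g ≪ volume :=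
  withDensity_absolutelyContinuous _ _

lemma nullSingletonClass_densityLaw (g : ℝ → ℝ) : NullSingletonClass (densityLaw g) :=
  ⟨fun x => densityLaw_absolutelyContinuous g (measure_singleton x)⟩

lemma IsSamplingDensity.ae_pos (hg : IsSamplingDensity g) : ∀ᵐ x ∂densityLaw g, 0 < x := by
  rw [densityLaw, ae_withDensity_iff hg.measurable.ennreal_ofReal]
  have h0 : ∀ᵐ x : ℝ, x ≠ 0 := by simp [ae_iff]
  filter_upwards [h0] with x hx hgx
  by_contra hlt
  have : x < 0 := lt_of_le_of_ne (not_lt.1 hlt) hx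
  simp [hg.eq_zero_of_neg x this] at hgx

lemma IsSamplingDensity.Ioo_ne_zero (hg : IsSamplingDensity g) {s t : ℝ} (hs : 0 ≤ s)
    (hst : s < t) : densityLaw g (Set.Ioo s t) ≠ 0 := by
  rw [densityLaw, withDensity_apply _ measurableSet_Ioo]
  refine (ne_of_gt ?_)
  rw [setLIntegral_pos_iff hg.measurable.ennreal_ofReal]
  have h1 : volume (Set.Ioo s t) ≠ 0 := by
    simp [hst]
  refine (pos_iff_ne_zero.2 h1).trans_le (measure_mono_ae ?_)
  filter_upwards [hg.pos] with x hx
  intro hxs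
  have hxs' : s < x ∧ x < t := hxs
  refine ⟨?_, hxs⟩
  simp [Function.mem_support, hx (hs.trans_lt hxs'.1)]

lemma IsSamplingDensity.Ioi_ne_zero (hg : IsSamplingDensity g) {s : ℝ} (hs : 0 ≤ s) :
    densityLaw g (Set.Ioi s) ≠ 0 := fun h =>
  hg.Ioo_ne_zero hs (lt_add_one s) (measure_mono_null Set.Ioo_subset_Ioi_self h)

lemma IsSamplingDensity.integrable (hg : IsSamplingDensity g) : Integrable g := by
  refine ⟨hg.measurable.aestronglyMeasurable, ?_⟩
  rw [hasFiniteIntegral_iff_ofReal (Eventually.of_forall hg.nonneg), hg.lintegral_eq_one]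
  exact ENNReal.one_lt_top

lemma IsSamplingDensity.ofReal_tail (hg : IsSamplingDensity g) (t : ℝ) :
    ENNReal.ofReal (tail g t) = densityLaw g (Set.Ioi t) := by
  rw [tail, ofReal_integral_eq_lintegral_ofReal hg.integrable.integrableOn
    (Eventually.of_forall hg.nonneg), densityLaw, withDensity_apply _ measurableSet_Ioi]

lemma IsSamplingDensity.tail_pos (hg : IsSamplingDensity g) {t : ℝ} (ht : 0 ≤ t) :
    0 < tail g t := by
  rw [← ENNReal.ofReal_pos, hg.ofReal_tail]
  exact pos_iff_ne_zero.2 (hg.Ioi_ne_zero ht)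

lemma IsSamplingDensity.measurable_tail (hg : IsSamplingDensity g) : Measurable (tail g) :=
  PriorityQueue.measurable_tail hg.integrable hg.nonneg

/-- Both densities vanish on the negative half-line and `g` is positive almost everywhere on the
positive one, so (f/g) · g = f almost everywhere. -/
lemma densityLaw_withDensity_div (hf : IsSamplingDensity f) (hg : IsSamplingDensity g) :
    (densityLaw g).withDensity (fun x => ENNReal.ofReal (f x / g x)) = densityLaw f := by
  have hfg : Measurable fun x => ENNReal.ofReal (f x / g x) :=
    (hf.measurable.div hg.measurable).ennreal_ofReal
  unfold densityLaw
  rw [← withDensity_mul _ hg.measurable.ennreal_ofReal hfg]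
  refine withDensity_congr_ae ?_
  have h0 : ∀ᵐ x : ℝ, x ≠ 0 := by simp [ae_iff]
  filter_upwards [hg.pos, h0] with x hx hx0
  simp only [Pi.mul_apply]
  rw [← ENNReal.ofReal_mul (hg.nonneg x)]
  congr 1
  rcases lt_or_gt_of_ne hx0 with h | h
  · simp [hf.eq_zero_of_neg x h, hg.eq_zero_of_neg x h]
  · field_simp [(hx h).ne']

lemma isSamplingDensity_exp {r : ℝ} (hr : 0 < r) : IsSamplingDensity (exponentialPDFReal r) where
  measurable := measurable_exponentialPDFReal r
  nonneg := exponentialPDFReal_nonneg hr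
  eq_zero_of_neg x hx := by simp [exponentialPDFReal, gammaPDFReal, not_le.2 hx]
  pos := Eventually.of_forall fun _ hx => exponentialPDFReal_pos hr hx
  lintegral_eq_one := lintegral_exponentialPDF_eq_one hr

lemma exponentialPDFReal_eq {r x : ℝ} (hx : 0 ≤ x) :
    exponentialPDFReal r x = r * Real.exp (-(r * x)) := by
  simp [exponentialPDFReal, gammaPDFReal, hx]

lemma densityLaw_exp (r : ℝ) : densityLaw (exponentialPDFReal r) = expMeasure r := rfl

lemma exp_Ioi {r : ℝ} (hr : 0 < r) {h : ℝ} (hh : 0 ≤ h) :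
    densityLaw (exponentialPDFReal r) (Set.Ioi h) = ENNReal.ofReal (Real.exp (-(r * h))) := by
  have := isProbabilityMeasure_expMeasure hr
  rw [densityLaw_exp, ← Set.compl_Iic, prob_compl_eq_one_sub measurableSet_Iic, ← ofReal_cdf,
    cdf_expMeasure_eq hr, if_pos hh, ← ENNReal.ofReal_one, ← ENNReal.ofReal_sub]
  · congr 1; ring
  · have : Real.exp (-(r * h)) ≤ 1 := Real.exp_le_one_iff.2 (by nlinarith)
    linarith

/-- After translating Lebesgue measure by `h`, this is the identity f(x) = f(h + x) / exp(-r h) for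
x > 0. -/
lemma memoryless_exp {r : ℝ} (hr : 0 < r) : Memoryless (densityLaw (exponentialPDFReal r)) where
  tail_ne_zero h hh := (isSamplingDensity_exp hr).Ioi_ne_zero hh
  map_add h hh := by
    have hm := (isSamplingDensity_exp hr).measurable.ennreal_ofReal
    have hind : Measurable fun x : ℝ => (densityLaw (exponentialPDFReal r) (Set.Ioi h))⁻¹ *
        (Set.Ioi h).indicator (1 : ℝ → ENNReal) x :=
      (measurable_one.indicator measurableSet_Ioi).const_mul _
    ext s hs
    rw [Measure.map_apply (by fun_prop) hs]
    nth_rewrite 1 [densityLaw]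
    nth_rewrite 1 [densityLaw]
    rw [← withDensity_mul _ hm hind, withDensity_apply _ hs,
      withDensity_apply _ (measurableSet_preimage (by fun_prop) hs),
      ← lintegral_indicator hs, ← lintegral_indicator (measurableSet_preimage (by fun_prop) hs)]
    conv_rhs => rw [← lintegral_add_left_eq_self _ h]
    refine lintegral_congr_ae ?_
    have h0 : ∀ᵐ x : ℝ, x ≠ 0 := by simp [ae_iff]
    filter_upwards [h0] with x hx0
    by_cases hxs : h + x ∈ s
    · rw [Set.indicator_of_mem (show x ∈ (fun x => h + x) ⁻¹' s from hxs),
        Set.indicator_of_mem hxs]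
      simp only [Pi.mul_apply]
      rcases lt_or_gt_of_ne hx0 with h1 | h1
      · rw [(isSamplingDensity_exp hr).eq_zero_of_neg x h1,
          Set.indicator_of_notMem (by simp [h1.le])]
        simp
      · rw [Set.indicator_of_mem (by simpa using h1), exp_Ioi hr hh, Pi.one_apply, mul_one,
          ← ENNReal.ofReal_inv_of_pos (Real.exp_pos _), ← ENNReal.ofReal_mul
          (exponentialPDFReal_nonneg hr _), exponentialPDFReal_eq h1.le,
          exponentialPDFReal_eq (by linarith), ← Real.exp_neg, mul_assoc, ← Real.exp_add]
        congr 3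
        ring
    · rw [Set.indicator_of_notMem (show x ∉ (fun x => h + x) ⁻¹' s from hxs),
        Set.indicator_of_notMem hxs]

end Density

/-! ### The input as one product over single times, and the change of measure for inputs -/

/-- Indices of single inter-arrival (`true`) and service times (`false`). -/
abbrev Coord (K : ℕ) := Fin K × ℕ × Bool

/-- Laws of single inter-arrival and service times. -/
def coordLaw (gA gS : Fin K → ℝ → ℝ) (j : Coord K) : Measure ℝ :=
  densityLaw (if j.2.2 then gA j.1 else gS j.1)

/-- The input with given single times. -/
def assemble (x : Coord K → ℝ) : Drive K := fun l n => (x (l, n, true), x (l, n, false))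

lemma measurable_assemble : Measurable (assemble (K := K)) :=
  measurable_pi_lambda _ fun _ => measurable_pi_lambda _ fun _ =>
    (measurable_pi_apply _).prodMk (measurable_pi_apply _)

variable {gA gS : Fin K → ℝ → ℝ}

lemma isProbabilityMeasure_coordLaw (hgA : ∀ l, IsSamplingDensity (gA l))
    (hgS : ∀ l, IsSamplingDensity (gS l)) (j : Coord K) :
    IsProbabilityMeasure (coordLaw gA gS j) := by
  unfold coordLaw
  split_ifs
  exacts [(hgA _).isProbabilityMeasure, (hgS _).isProbabilityMeasure]

lemma map_infinitePi_bool (ν : Bool → Measure ℝ) [∀ b, IsProbabilityMeasure (ν b)] :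
    (Measure.infinitePi ν).map (fun z => (z true, z false)) = (ν true).prod (ν false) := by
  refine (Measure.prod_eq fun s t hs ht => ?_).symm
  rw [Measure.map_apply (by fun_prop) (hs.prod ht)]
  have : (fun z : Bool → ℝ => (z true, z false)) ⁻¹' s ×ˢ t
      = Set.pi (Finset.univ : Finset Bool) fun b => if b then s else t := by
    ext z; simp
  rw [this, Measure.infinitePi_pi _ (fun b _ => by split_ifs <;> assumption)]
  simp

/-- Currying twice turns the flat product over classes, jobs and kinds into the nested one. The flat
form is needed because the realized part of the input cuts through the pairs of a job. -/
theorem map_assemble (hgA : ∀ l, IsSamplingDensity (gA l)) (hgS : ∀ l, IsSamplingDensity (gS l)) :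
    (Measure.infinitePi (coordLaw gA gS)).map assemble = driveLaw gA gS := by
  have h1 := isProbabilityMeasure_coordLaw hgA hgS
  have e1 := Measure.infinitePi_map_curry (fun (l : Fin K) (q : ℕ × Bool) => coordLaw gA gS (l, q))
  have e2 : ∀ l : Fin K, (Measure.infinitePi fun q : ℕ × Bool => coordLaw gA gS (l, q)).map
      (MeasurableEquiv.curry ℕ Bool ℝ) = _ := fun l =>
    Measure.infinitePi_map_curry (fun (n : ℕ) (b : Bool) => coordLaw gA gS (l, n, b))
  have e3 := Measure.infinitePi_map_pi
    (fun l : Fin K => Measure.infinitePi fun q : ℕ × Bool => coordLaw gA gS (l, q))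
    (f := fun _ y n => (y (n, true), y (n, false)))
    (fun l => by fun_prop)
  have e4 : ∀ l : Fin K, (Measure.infinitePi fun q : ℕ × Bool => coordLaw gA gS (l, q)).map
      (fun y (n : ℕ) => (y (n, true), y (n, false)))
      = Measure.infinitePi fun _ : ℕ => (densityLaw (gA l)).prod (densityLaw (gS l)) := by
    intro l
    have e5 := Measure.infinitePi_map_pi
      (fun n : ℕ => Measure.infinitePi fun b : Bool => coordLaw gA gS (l, n, b))
      (f := fun _ z => (z true, z false)) (fun n => by fun_prop)
    rw [← e2 l, Measure.map_map (by fun_prop) (by fun_prop)] at e5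
    refine Eq.trans ?_ (e5.trans ?_)
    · rfl
    · congr 1
      funext n
      rw [map_infinitePi_bool]
      simp [coordLaw]
  simp only [e4] at e3
  rw [← e1, Measure.map_map (by fun_prop) (by fun_prop)] at e3
  exact e3

lemma isProbabilityMeasure_driveLaw (hgA : ∀ l, IsSamplingDensity (gA l))
    (hgS : ∀ l, IsSamplingDensity (gS l)) : IsProbabilityMeasure (driveLaw gA gS) := by
  have h1 := isProbabilityMeasure_coordLaw hgA hgS
  rw [← map_assemble hgA hgS]
  exact Measure.isProbabilityMeasure_map measurable_assemble.aemeasurable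

lemma measurableSet_pos : MeasurableSet {w : Drive K | Pos w} := by
  unfold Pos
  simp only [Set.ofPred_forall]
  refine MeasurableSet.iInter fun l => MeasurableSet.iInter fun n => ?_
  have h := measurable_entry (measurable_id (α := Drive K)) l (n := fun _ => n) measurable_const
  exact (measurableSet_lt measurable_const h.fst).inter (measurableSet_lt measurable_const h.snd)

lemma ae_pos_driveLaw (hgA : ∀ l, IsSamplingDensity (gA l)) (hgS : ∀ l, IsSamplingDensity (gS l)) :
    ∀ᵐ w ∂driveLaw gA gS, Pos w := by
  have h1 := isProbabilityMeasure_coordLaw hgA hgS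
  rw [← map_assemble hgA hgS, ae_map_iff measurable_assemble.aemeasurable measurableSet_pos]
  have : ∀ᵐ x ∂Measure.infinitePi (coordLaw gA gS), ∀ j, 0 < x j := ae_all_iff.2 fun j =>
    (measurePreserving_eval_infinitePi _ j).quasiMeasurePreserving.ae (by
      unfold coordLaw; split_ifs; exacts [(hgA _).ae_pos, (hgS _).ae_pos])
  filter_upwards [this] with x hx l n using ⟨hx _, hx _⟩

/-- Indices of what has been realized. -/
def realizedCoords (k : Fin K) (a e : Fin K → ℕ) : Finset (Coord K) :=
  (Finset.univ.sigma fun l => Finset.range (a l)).image (fun p => (p.1, p.2, true)) ∪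
    (Finset.univ.sigma fun l => Finset.range (if l ≤ k then a l else e l)).image
      fun p => (p.1, p.2, false)

/-- Indices of the current inter-arrival times. -/
def residualCoords (a : Fin K → ℕ) : Finset (Coord K) :=
  Finset.univ.image fun l => (l, a l, true)

lemma mem_realizedCoords_true {k : Fin K} {a e : Fin K → ℕ} {l : Fin K} {n : ℕ} :
    (l, n, true) ∈ realizedCoords k a e ↔ n < a l := by
  simp only [realizedCoords, Finset.mem_union, Finset.mem_image, Finset.mem_sigma,
    Finset.mem_univ, true_and, Finset.mem_range, Prod.mk.injEq, Sigma.exists]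
  constructor
  · rintro (⟨_, _, h, rfl, rfl, _⟩ | ⟨_, _, _, _, _, h⟩)
    exacts [h, absurd h (by simp)]
  · exact fun h => Or.inl ⟨l, n, h, rfl, rfl, trivial⟩

lemma mem_realizedCoords_false {k : Fin K} {a e : Fin K → ℕ} {l : Fin K} {n : ℕ} :
    (l, n, false) ∈ realizedCoords k a e ↔ n < if l ≤ k then a l else e l := by
  simp only [realizedCoords, Finset.mem_union, Finset.mem_image, Finset.mem_sigma,
    Finset.mem_univ, true_and, Finset.mem_range, Prod.mk.injEq, Sigma.exists]
  constructor
  · rintro (⟨_, _, _, _, _, h⟩ | ⟨_, _, h, rfl, rfl, _⟩)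
    exacts [absurd h (by simp), h]
  · exact fun h => Or.inr ⟨l, n, h, rfl, rfl, trivial⟩

lemma mem_residualCoords {a : Fin K → ℕ} {l : Fin K} {n : ℕ} {b : Bool} :
    (l, n, b) ∈ residualCoords a ↔ n = a l ∧ b = true := by
  simp only [residualCoords, Finset.mem_image, Finset.mem_univ, true_and, Prod.mk.injEq]
  constructor
  · rintro ⟨l', rfl, rfl, rfl⟩; exact ⟨rfl, rfl⟩
  · rintro ⟨rfl, rfl⟩; exact ⟨l, rfl, rfl, rfl⟩

lemma prod_realizedCoords (k : Fin K) (a e : Fin K → ℕ) (φ : Coord K → ENNReal) :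
    ∏ j ∈ realizedCoords k a e, φ j
      = (∏ l, ∏ n ∈ Finset.range (a l), φ (l, n, true))
        * ((∏ l ∈ Finset.univ.filter (fun l => l ≤ k), ∏ n ∈ Finset.range (a l), φ (l, n, false))
          * ∏ l ∈ Finset.univ.filter (fun l => k < l), ∏ n ∈ Finset.range (e l), φ (l, n, false)) := by
  unfold realizedCoords
  rw [Finset.prod_union, Finset.prod_image, Finset.prod_image, Finset.prod_sigma,
    Finset.prod_sigma]
  · congr 1
    rw [← Finset.prod_filter_mul_prod_filter_not Finset.univ (fun l => l ≤ k)]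
    congr 1
    · refine Finset.prod_congr rfl fun l hl => ?_
      rw [if_pos (Finset.mem_filter.1 hl).2]
    · simp only [not_le]
      refine Finset.prod_congr rfl fun l hl => ?_
      rw [if_neg (not_le.2 (Finset.mem_filter.1 hl).2)]
  · rintro ⟨p1, p2⟩ _ ⟨q1, q2⟩ _ h
    simp only [Prod.mk.injEq, and_true] at h
    obtain ⟨rfl, rfl⟩ := h; rfl
  · rintro ⟨p1, p2⟩ _ ⟨q1, q2⟩ _ h
    simp only [Prod.mk.injEq, and_true] at h
    obtain ⟨rfl, rfl⟩ := h; rfl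
  · rw [Finset.disjoint_left]
    rintro ⟨l, n, b⟩ h1 h2
    simp only [Finset.mem_image, Prod.mk.injEq] at h1 h2
    obtain ⟨_, _, _, _, h1⟩ := h1
    obtain ⟨_, _, _, _, h2⟩ := h2
    exact absurd (h1.trans h2.symm) (by simp)

/-- Brings the likelihood ratio into the form of `lintegral_graft`: density ratios over realized
coordinates times tail ratios over current inter-arrival times. The hypothesis `hT` makes the ages
nonnegative, so that the tails in the denominator are positive. -/
lemma ofReal_lik_div {fA fS : Fin K → ℝ → ℝ} (hfA : ∀ l, IsSamplingDensity (fA l))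
    (hfS : ∀ l, IsSamplingDensity (fS l)) (hgA : ∀ l, IsSamplingDensity (gA l))
    (hgS : ∀ l, IsSamplingDensity (gS l)) (k : Fin K) (a e : Fin K → ℕ) (T : ℝ) (w : Drive K)
    (hT : ∀ l, arrivalSum w l (a l) ≤ T) :
    ENNReal.ofReal (lik fA fS k a e T w / lik gA gS k a e T w)
      = (∏ l, ∏ n ∈ Finset.range (a l), ENNReal.ofReal (fA l (w l n).1 / gA l (w l n).1))
        * ((∏ l ∈ Finset.univ.filter (fun l => l ≤ k), ∏ n ∈ Finset.range (a l),
            ENNReal.ofReal (fS l (w l n).2 / gS l (w l n).2))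
          * ∏ l ∈ Finset.univ.filter (fun l => k < l), ∏ n ∈ Finset.range (e l),
            ENNReal.ofReal (fS l (w l n).2 / gS l (w l n).2))
        * ∏ l, (densityLaw (fA l) (Set.Ioi (T - arrivalSum w l (a l)))
          / densityLaw (gA l) (Set.Ioi (T - arrivalSum w l (a l)))) := by
  have hA : ∀ l n, 0 ≤ fA l (w l n).1 / gA l (w l n).1 := fun l n =>
    div_nonneg ((hfA l).nonneg _) ((hgA l).nonneg _)
  have hS : ∀ l n, 0 ≤ fS l (w l n).2 / gS l (w l n).2 := fun l n =>
    div_nonneg ((hfS l).nonneg _) ((hgS l).nonneg _)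
  have hTl : ∀ l, 0 ≤ tail (fA l) (T - arrivalSum w l (a l)) /
      tail (gA l) (T - arrivalSum w l (a l)) := fun l =>
    div_nonneg ((hfA l).tail_pos (sub_nonneg.2 (hT l))).le
      ((hgA l).tail_pos (sub_nonneg.2 (hT l))).le
  have hreal : lik fA fS k a e T w / lik gA gS k a e T w
      = (∏ l, ∏ n ∈ Finset.range (a l), (fA l (w l n).1 / gA l (w l n).1))
        * ((∏ l ∈ Finset.univ.filter (fun l => l ≤ k), ∏ n ∈ Finset.range (a l),
            (fS l (w l n).2 / gS l (w l n).2))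
          * ∏ l ∈ Finset.univ.filter (fun l => k < l), ∏ n ∈ Finset.range (e l),
            (fS l (w l n).2 / gS l (w l n).2))
        * ∏ l, (tail (fA l) (T - arrivalSum w l (a l))
          / tail (gA l) (T - arrivalSum w l (a l))) := by
    simp only [lik, Finset.prod_mul_distrib, Finset.prod_div_distrib, mul_div_mul_comm]
    ring
  have hden : ∀ l, ENNReal.ofReal (tail (fA l) (T - arrivalSum w l (a l))
          / tail (gA l) (T - arrivalSum w l (a l)))
        = densityLaw (fA l) (Set.Ioi (T - arrivalSum w l (a l)))
          / densityLaw (gA l) (Set.Ioi (T - arrivalSum w l (a l))) := fun l => by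
    rw [ENNReal.ofReal_div_of_pos ((hgA l).tail_pos (sub_nonneg.2 (hT l))), (hfA l).ofReal_tail,
      (hgA l).ofReal_tail]
  rw [hreal, ENNReal.ofReal_mul, ENNReal.ofReal_mul, ENNReal.ofReal_mul,
    ENNReal.ofReal_prod_of_nonneg, ENNReal.ofReal_prod_of_nonneg, ENNReal.ofReal_prod_of_nonneg,
    ENNReal.ofReal_prod_of_nonneg]
  · simp only [hden]
    congr 1
    congr 1
    · exact Finset.prod_congr rfl fun l _ => ENNReal.ofReal_prod_of_nonneg fun n _ => hA l n
    · congr 1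
      · exact Finset.prod_congr rfl fun l _ => ENNReal.ofReal_prod_of_nonneg fun n _ => hS l n
      · exact Finset.prod_congr rfl fun l _ => ENNReal.ofReal_prod_of_nonneg fun n _ => hS l n
  · exact fun l _ => hTl l
  · exact fun l _ => Finset.prod_nonneg fun n _ => hS l n
  · exact fun l _ => Finset.prod_nonneg fun n _ => hS l n
  · exact fun l _ => Finset.prod_nonneg fun n _ => hA l n
  · exact Finset.prod_nonneg fun l _ => Finset.prod_nonneg fun n _ => hS l n
  · exact Finset.prod_nonneg fun l _ => Finset.prod_nonneg fun n _ => hA l n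
  · exact mul_nonneg (Finset.prod_nonneg fun l _ => Finset.prod_nonneg fun n _ => hA l n)
      (mul_nonneg (Finset.prod_nonneg fun l _ => Finset.prod_nonneg fun n _ => hS l n)
        (Finset.prod_nonneg fun l _ => Finset.prod_nonneg fun n _ => hS l n))

lemma measurable_arrivalSum (l : Fin K) (n : ℕ) : Measurable fun w : Drive K => arrivalSum w l n :=
  Finset.measurable_fun_sum _ fun _ _ => (measurable_entry measurable_id l measurable_const).fst

lemma measurable_splice (k : Fin K) (a e : Fin K → ℕ) {T : Drive K → ℝ} (hT : Measurable T) :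
    Measurable fun u : Drive K × Drive K => splice k a e (T u.1) u.1 u.2 := by
  have hw : ∀ l n, Measurable fun u : Drive K × Drive K => u.1 l n := fun l n =>
    measurable_entry measurable_fst l measurable_const
  have hv : ∀ l n, Measurable fun u : Drive K × Drive K => u.2 l n := fun l n =>
    measurable_entry measurable_snd l measurable_const
  refine measurable_pi_lambda _ fun l => measurable_pi_lambda _ fun n => Measurable.prodMk ?_ ?_
  · split_ifs
    exacts [(hw l n).fst, ((hT.comp measurable_fst).sub ((measurable_arrivalSum l _).comp
      measurable_fst)).add (hv l n).fst, (hv l n).fst]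
  · split_ifs
    exacts [(hw l n).snd, (hv l n).snd, (hw l n).snd, (hv l n).snd]

/-- Change of measure at a stopping event, in terms of inputs. -/
theorem lintegral_splice {lam mu : Fin K → ℝ} (hlam : ∀ l, 0 < lam l) (hmu : ∀ l, 0 < mu l)
    (hgA : ∀ l, IsSamplingDensity (gA l)) (hgS : ∀ l, IsSamplingDensity (gS l)) (k : Fin K)
    (a e : Fin K → ℕ) {T : Drive K → ℝ} (hT : Measurable T) {E : Set (Drive K)}
    (hE : MeasurableSet E)
    (hE1 : ∀ w ∈ E, ∀ l, arrivalSum w l (a l) ≤ T w ∧ T w ≤ arrivalSum w l (a l + 1))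
    (hE2 : ∀ w ∈ E, ∀ w', Pos w → Pos w' → Agree k a e w w' →
      (∀ l, T w < arrivalSum w' l (a l + 1)) → w' ∈ E ∧ T w' = T w)
    {F : Drive K → ENNReal} (hF : Measurable F) :
    ∫⁻ u, E.indicator (fun w => ENNReal.ofReal
        (lik (expDensity lam) (expDensity mu) k a e (T w) w / lik gA gS k a e (T w) w)) u.1
        * F (splice k a e (T u.1) u.1 u.2) ∂((driveLaw gA gS).prod (nominalLaw lam mu))
      = ∫⁻ v, E.indicator F v ∂nominalLaw lam mu := by
  have hfA : ∀ l, IsSamplingDensity (expDensity lam l) := fun l => isSamplingDensity_exp (hlam l)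
  have hfS : ∀ l, IsSamplingDensity (expDensity mu l) := fun l => isSamplingDensity_exp (hmu l)
  have p1 := isProbabilityMeasure_coordLaw hgA hgS
  have p2 := isProbabilityMeasure_coordLaw hfA hfS
  set m := coordLaw (expDensity lam) (expDensity mu) with hm
  set m' := coordLaw gA gS with hm'
  set I := realizedCoords k a e
  set R := residualCoords a
  have hIR : Disjoint I R := by
    rw [Finset.disjoint_left]
    rintro ⟨l, n, b⟩ h1 h2
    obtain ⟨rfl, rfl⟩ := mem_residualCoords.1 h2
    exact lt_irrefl _ (mem_realizedCoords_true.1 h1)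
  have hRtrue : ∀ j ∈ R, j.2.2 = true := by
    rintro ⟨l, n, b⟩ hj
    exact (mem_residualCoords.1 hj).2
  set g : Coord K → ℝ → ENNReal := fun j x => ENNReal.ofReal
    ((if j.2.2 then expDensity lam j.1 else expDensity mu j.1) x
      / (if j.2.2 then gA j.1 else gS j.1) x) with hg
  set h : (Coord K → ℝ) → Coord K → ℝ := fun x j =>
    T (assemble x) - arrivalSum (assemble x) j.1 (a j.1) with hh
  -- The coordinates in `I` are the realized times, those in `R` the current inter-arrival times;
  -- the threshold `h` is the age at time `T`.
  have key := lintegral_graft m m' I R hIR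
    (fun j => by
      simp only [hm, coordLaw]; split_ifs; exacts [(hfA _).ae_pos, (hfS _).ae_pos])
    (fun j => by
      simp only [hm', coordLaw]; split_ifs; exacts [(hgA _).ae_pos, (hgS _).ae_pos])
    g
    (fun j _ => by
      refine Measurable.ennreal_ofReal (Measurable.div ?_ ?_)
      · split_ifs; exacts [(hfA _).measurable, (hfS _).measurable]
      · split_ifs; exacts [(hgA _).measurable, (hgS _).measurable])
    (fun j _ => by
      simp only [hm, hm', coordLaw, hg]
      split_ifs
      exacts [densityLaw_withDensity_div (hfA _) (hgA _),
        densityLaw_withDensity_div (hfS _) (hgS _)])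
    (fun j hj => by
      simp only [hm, coordLaw, hRtrue j hj, if_true]; exact memoryless_exp (hlam _))
    (fun j hj t ht => by
      simp only [hm', coordLaw, hRtrue j hj, if_true]; exact (hgA _).Ioi_ne_zero ht)
    (fun j _ => nullSingletonClass_densityLaw _) (fun j _ => nullSingletonClass_densityLaw _)
    (assemble ⁻¹' E) (measurable_assemble hE) h
    (measurable_pi_lambda _ fun j => (hT.comp measurable_assemble).sub
      ((measurable_arrivalSum _ _).comp measurable_assemble))
    (fun x hx j hj => by
      obtain ⟨l, n, b⟩ := j
      obtain ⟨rfl, rfl⟩ := mem_residualCoords.1 hj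
      have h1 := hE1 _ hx l
      rw [arrivalSum_succ] at h1
      have h2 : (assemble x l (a l)).1 = x (l, a l, true) := rfl
      rw [h2] at h1
      constructor <;> simp only [hh] <;> linarith [h1.1, h1.2])
    (fun x hx x' hpx hpx' hxI hxR => by
      have hag : Agree k a e (assemble x) (assemble x') :=
        ⟨fun l n hn => hxI _ (mem_realizedCoords_true.2 hn),
          fun l n hn => hxI _ (mem_realizedCoords_false.2 (by
            unfold Realized at hn; split_ifs at hn ⊢ <;> exact hn))⟩
      obtain ⟨h1, h2⟩ := hE2 _ hx (assemble x') (fun l n => ⟨hpx _, hpx _⟩)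
        (fun l n => ⟨hpx' _, hpx' _⟩) hag (fun l => by
          have := hxR (l, a l, true) (mem_residualCoords.2 ⟨rfl, rfl⟩)
          rw [arrivalSum_succ, hag.arrivalSum_eq le_rfl]
          simp only [hh] at this
          have h3 : (assemble x' l (a l)).1 = x' (l, a l, true) := rfl
          rw [h3]; linarith)
      exact ⟨h1, fun j _ => by
        simp only [hh]; rw [h2, hag.arrivalSum_eq le_rfl]⟩)
    (F ∘ assemble) (hF.comp measurable_assemble)
  -- Grafting single times is splicing inputs: age plus fresh value at the coordinates in `R` is the
  -- middle case in `splice`.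
  have hgr : ∀ x y : Coord K → ℝ, assemble (graft I R (h x) x y)
      = splice k a e (T (assemble x)) (assemble x) (assemble y) := by
    intro x y
    funext l n
    refine Prod.ext ?_ ?_
    · show graft I R (h x) x y (l, n, true) = _
      simp only [graft, I, R, mem_realizedCoords_true, mem_residualCoords, and_true, splice]
      by_cases h1 : n < a l
      · simp [h1, assemble]
      · by_cases h2 : n = a l
        · subst h2; simp [hh, assemble]
        · simp [h1, h2, assemble]
    · show graft I R (h x) x y (l, n, false) = _
      simp only [graft, I, R, mem_realizedCoords_false, mem_residualCoords, splice]
      by_cases h1 : l ≤ k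
      · simp [h1, assemble]
      · simp [h1, assemble]
  rw [nominalLaw, ← map_assemble hgA hgS, ← map_assemble hfA hfS,
    lintegral_map (hF.indicator hE) measurable_assemble]
  rw [show ((Measure.infinitePi (coordLaw gA gS)).map assemble).prod
      ((Measure.infinitePi (coordLaw (expDensity lam) (expDensity mu))).map assemble)
      = _ from Measure.map_prod_map _ _ measurable_assemble measurable_assemble]
  rw [lintegral_map _ (measurable_assemble.prodMap measurable_assemble)]
  · refine Eq.trans (lintegral_congr fun p => ?_) (key.trans (lintegral_congr fun v => ?_))
    · obtain ⟨x, y⟩ := p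
      simp only [Prod.map_fst, Prod.map_snd, Function.comp, hgr]
      congr 1
      by_cases hx : assemble x ∈ E
      · rw [Set.indicator_of_mem hx, Set.indicator_of_mem (show x ∈ assemble ⁻¹' E from hx),
          ofReal_lik_div hfA hfS hgA hgS k a e _ _ fun l => (hE1 _ hx l).1, prod_realizedCoords]
        congr 1
        rw [show R = residualCoords a from rfl, residualCoords,
          Finset.prod_image fun p _ q _ h => congrArg Prod.fst h]
        rfl
      · rw [Set.indicator_of_notMem hx, Set.indicator_of_notMem (show x ∉ assemble ⁻¹' E from hx)]
    · rfl
  · refine Measurable.mul ((Measurable.indicator (Measurable.ennreal_ofReal (Measurable.div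
      ?_ ?_)) hE).comp measurable_fst) (hF.comp (measurable_splice k a e hT))
    · exact measurable_lik (fun l => (hfA l).measurable) (fun l => (hfS l).measurable)
        (fun l => (hfA l).measurable_tail) k a e hT measurable_id
    · exact measurable_lik (fun l => (hgA l).measurable) (fun l => (hgS l).measurable)
        (fun l => (hgA l).measurable_tail) k a e hT measurable_id

end PriorityQueue
end

noncomputable section
namespace PriorityQueue
variable {K : ℕ}

/-! ### Almost sure properties of the input -/

/-- Layer cake formula: the tail of the exponential law is its density divided by the rate. -/
lemma lintegral_exp {r : ℝ} (hr : 0 < r) :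
    ∫⁻ x, ENNReal.ofReal x ∂densityLaw (exponentialPDFReal r) = ENNReal.ofReal r⁻¹ := by
  have hd := isSamplingDensity_exp hr
  rw [lintegral_eq_lintegral_meas_lt _ (hd.ae_pos.mono fun x hx => hx.le) aemeasurable_id]
  have h1 : ∀ t ∈ Set.Ioi (0 : ℝ), densityLaw (exponentialPDFReal r) {a | t < a}
      = ENNReal.ofReal r⁻¹ * ENNReal.ofReal (exponentialPDFReal r t) := by
    intro t ht
    have ht' : (0 : ℝ) < t := ht
    rw [show {a : ℝ | t < a} = Set.Ioi t from rfl, exp_Ioi hr ht'.le, exponentialPDFReal_eq ht'.le,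
      ← ENNReal.ofReal_mul (by positivity), ← mul_assoc, inv_mul_cancel₀ hr.ne', one_mul]
  rw [setLIntegral_congr_fun measurableSet_Ioi h1, lintegral_const_mul _
    hd.measurable.ennreal_ofReal, ← withDensity_apply _ measurableSet_Ioi]
  have h2 := exp_Ioi hr le_rfl
  rw [densityLaw] at h2
  rw [h2]
  simp

lemma integrable_exp {r : ℝ} (hr : 0 < r) :
    Integrable (fun x => x) (densityLaw (exponentialPDFReal r)) := by
  refine ⟨aestronglyMeasurable_id, ?_⟩
  rw [hasFiniteIntegral_iff_ofReal ((isSamplingDensity_exp hr).ae_pos.mono fun x hx => hx.le),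
    lintegral_exp hr]
  exact ENNReal.ofReal_lt_top

lemma integral_exp {r : ℝ} (hr : 0 < r) :
    ∫ x, x ∂densityLaw (exponentialPDFReal r) = r⁻¹ := by
  rw [integral_eq_lintegral_of_nonneg_ae
    ((isSamplingDensity_exp hr).ae_pos.mono fun x hx => hx.le) aestronglyMeasurable_id,
    lintegral_exp hr, ENNReal.toReal_ofReal (inv_pos.2 hr).le]

/-- The strong law of large numbers for a function of the coordinates of an i.i.d. sequence. -/
lemma ae_tendsto_average {α : Type*} [MeasurableSpace α] (μ : Measure α) [IsProbabilityMeasure μ]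
    {f : α → ℝ} (hf : Measurable f) (hi : Integrable f μ) :
    ∀ᵐ y ∂Measure.infinitePi fun _ : ℕ => μ,
      Tendsto (fun n : ℕ => (∑ i ∈ Finset.range n, f (y i)) / n) atTop (𝓝 (∫ x, f x ∂μ)) := by
  have hmp := fun n : ℕ => measurePreserving_eval_infinitePi (fun _ : ℕ => μ) n
  have hind : iIndepFun (fun (n : ℕ) (y : ℕ → α) => f (y n)) (Measure.infinitePi fun _ : ℕ => μ) :=
    iIndepFun_infinitePi (X := fun _ => f) fun _ => hf
  have hmap : ∀ i : ℕ, (Measure.infinitePi fun _ : ℕ => μ).map (fun y => f (y i)) = μ.map f :=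
    fun i => by
      rw [← (hmp i).map_eq, Measure.map_map hf (measurable_pi_apply i), (hmp i).map_eq]
      rfl
  have h := strong_law_ae_real (μ := Measure.infinitePi fun _ : ℕ => μ)
    (fun n y => f (y n)) ((hmp 0).integrable_comp_of_integrable hi)
    (fun i j hij => hind.indepFun hij)
    (fun i => ⟨(hf.comp (measurable_pi_apply i)).aemeasurable,
      (hf.comp (measurable_pi_apply 0)).aemeasurable, (hmap i).trans (hmap 0).symm⟩)
  have hint : ∫ y, f (y 0) ∂(Measure.infinitePi fun _ : ℕ => μ) = ∫ x, f x ∂μ := by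
    rw [← (hmp 0).map_eq, integral_map (measurable_pi_apply 0).aemeasurable
      hf.aestronglyMeasurable, (hmp 0).map_eq]
  rwa [hint] at h

/-- An i.i.d. sequence visits a set of positive measure infinitely often. -/
lemma ae_frequently_mem {α : Type*} [MeasurableSpace α] (μ : Measure α) [IsProbabilityMeasure μ]
    {S : Set α} (hS : MeasurableSet S) (h0 : μ S ≠ 0) :
    ∀ᵐ y ∂Measure.infinitePi fun _ : ℕ => μ, ∃ᶠ n in atTop, y n ∈ S := by
  have h := ae_tendsto_average μ (measurable_one.indicator hS (f := (1 : α → ℝ)))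
    ((integrable_const (1 : ℝ)).indicator hS)
  filter_upwards [h] with y hy
  intro hev
  rw [integral_indicator_one hS] at hy
  obtain ⟨N, hN⟩ := eventually_atTop.1 hev
  -- With finitely many visits the visit frequency would tend to 0, whereas the law of large numbers
  -- gives the limit μ(S).
  have h2 : Tendsto (fun n : ℕ => (∑ i ∈ Finset.range n, S.indicator (1 : α → ℝ) (y i)) / n) atTop
      (𝓝 0) := by
    refine tendsto_sum_div_of_eventually_eq (g := fun _ => 0) N (fun n hn => ?_) (by simp)
    exact Set.indicator_of_notMem (hN n hn) _
  have := tendsto_nhds_unique hy h2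
  exact h0 ((measureReal_eq_zero_iff).1 this)

variable {gA gS : Fin K → ℝ → ℝ} {lam mu : Fin K → ℝ}

lemma ae_driveLaw_of_ae (hgA : ∀ l, IsSamplingDensity (gA l)) (hgS : ∀ l, IsSamplingDensity (gS l))
    {p : Fin K → (ℕ → ℝ × ℝ) → Prop}
    (h : ∀ l, ∀ᵐ y ∂Measure.infinitePi fun _ : ℕ => (densityLaw (gA l)).prod (densityLaw (gS l)),
      p l y) : ∀ᵐ w ∂driveLaw gA gS, ∀ l, p l (w l) := by
  have h1 : ∀ l, IsProbabilityMeasure ((densityLaw (gA l)).prod (densityLaw (gS l))) := fun l => by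
    have := (hgA l).isProbabilityMeasure
    have := (hgS l).isProbabilityMeasure
    infer_instance
  exact ae_all_iff.2 fun l =>
    (measurePreserving_eval_infinitePi _ l).quasiMeasurePreserving.ae (h l)

theorem ae_good (hlam : ∀ l, 0 < lam l) (hmu : ∀ l, 0 < mu l) :
    ∀ᵐ v ∂nominalLaw lam mu, Good lam mu v := by
  have hA : ∀ l, IsSamplingDensity (expDensity lam l) := fun l => isSamplingDensity_exp (hlam l)
  have hS : ∀ l, IsSamplingDensity (expDensity mu l) := fun l => isSamplingDensity_exp (hmu l)
  have h1 : ∀ l, IsProbabilityMeasure (densityLaw (expDensity lam l)) := fun l =>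
    (hA l).isProbabilityMeasure
  have h2 : ∀ l, IsProbabilityMeasure (densityLaw (expDensity mu l)) := fun l =>
    (hS l).isProbabilityMeasure
  have hfst : ∀ l, Integrable (fun z : ℝ × ℝ => z.1)
      ((densityLaw (expDensity lam l)).prod (densityLaw (expDensity mu l))) := fun l =>
    (show Integrable (fun x => x) (densityLaw (expDensity lam l)) from
      integrable_exp (hlam l)).comp_fst _
  have hsnd : ∀ l, Integrable (fun z : ℝ × ℝ => z.2)
      ((densityLaw (expDensity lam l)).prod (densityLaw (expDensity mu l))) := fun l =>
    (show Integrable (fun x => x) (densityLaw (expDensity mu l)) from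
      integrable_exp (hmu l)).comp_snd _
  have ifst : ∀ l, ∫ z, z.1 ∂((densityLaw (expDensity lam l)).prod (densityLaw (expDensity mu l)))
      = (lam l)⁻¹ := fun l => by
    rw [integral_fun_fst (fun x : ℝ => x)]
    simp only [probReal_univ, one_smul]
    exact integral_exp (hlam l)
  have isnd : ∀ l, ∫ z, z.2 ∂((densityLaw (expDensity lam l)).prod (densityLaw (expDensity mu l)))
      = (mu l)⁻¹ := fun l => by
    rw [integral_fun_snd (fun x : ℝ => x)]
    simp only [probReal_univ, one_smul]
    exact integral_exp (hmu l)
  filter_upwards [ae_pos_driveLaw hA hS,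
    ae_driveLaw_of_ae hA hS fun l => ae_tendsto_average _ measurable_fst (hfst l),
    ae_driveLaw_of_ae hA hS fun l => ae_tendsto_average _ measurable_snd (hsnd l)] with v h1 h2 h3
  refine ⟨h1, fun l => ?_, fun l => ?_⟩
  · rw [← ifst l]; exact h2 l
  · rw [← isnd l]; exact h3 l

/-- Sampling inter-arrival times may have infinite mean, so divergence is obtained from infinitely
many gaps longer than 1 instead of from averages. -/
lemma diverges_of_frequently {w : Drive K} (hw : Pos w)
    (h : ∀ l, ∃ᶠ n in atTop, w l n ∈ Set.Ioi (1 : ℝ) ×ˢ Set.univ) : Diverges w := by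
  intro l
  refine tendsto_atTop_atTop_of_monotone (hw.arrivalSum_mono l) fun C => ?_
  obtain ⟨N, hN⟩ := exists_nat_ge C
  suffices ∃ n, (N : ℝ) ≤ arrivalSum w l n from this.imp fun n hn => hN.trans hn
  clear hN
  induction N with
  | zero => exact ⟨0, by simp [arrivalSum]⟩
  | succ N ih =>
    obtain ⟨n, hn⟩ := ih
    obtain ⟨m, hm, hm1⟩ := frequently_atTop.1 (h l) n
    refine ⟨m + 1, ?_⟩
    have h1 := hw.arrivalSum_mono l hm
    have h2 : 1 < (w l m).1 := hm1.1
    rw [arrivalSum_succ]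
    push_cast
    linarith

/-- Importance sampling switches almost surely. -/
theorem ae_exists_switchAt (hgA : ∀ l, IsSamplingDensity (gA l))
    (hgS : ∀ l, IsSamplingDensity (gS l)) (k : Fin K) (γmax : ℝ) :
    ∀ᵐ w ∂driveLaw gA gS, ∃ j, SwitchAt k γmax w j := by
  have h1 : ∀ l, IsProbabilityMeasure (densityLaw (gA l)) := fun l => (hgA l).isProbabilityMeasure
  have h2 : ∀ l, IsProbabilityMeasure (densityLaw (gS l)) := fun l => (hgS l).isProbabilityMeasure
  have hm1 : MeasurableSet (Set.Ioi (1 : ℝ) ×ˢ (Set.univ : Set ℝ)) := measurableSet_Ioi.prod .univ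
  have hm2 : MeasurableSet ((Set.univ : Set ℝ) ×ˢ Set.Ioi (max γmax 0)) :=
    MeasurableSet.univ.prod measurableSet_Ioi
  filter_upwards [ae_pos_driveLaw hgA hgS,
    ae_driveLaw_of_ae hgA hgS fun l => ae_frequently_mem
      ((densityLaw (gA l)).prod (densityLaw (gS l))) hm1
      (by simpa using (hgA l).Ioi_ne_zero zero_le_one),
    ae_driveLaw_of_ae hgA hgS fun l => ae_frequently_mem
      ((densityLaw (gA l)).prod (densityLaw (gS l))) hm2
      (by simpa using (hgS l).Ioi_ne_zero (le_max_right γmax 0))] with w hw h3 h4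
  obtain ⟨n, hn⟩ := (h4 k).exists
  exact exists_switchAt k γmax hw (diverges_of_frequently hw h3) n
    ((le_max_left _ _).trans_lt hn.2)

end PriorityQueue
end

noncomputable section
namespace PriorityQueue
variable {K : ℕ}

/-! ### Unbiasedness of the weighted counts -/

lemma lintegral_eq_tsum_indicator {α ι : Type*} [MeasurableSpace α] [Countable ι] {μ : Measure α}
    {E : ι → Set α} (hE : ∀ q, MeasurableSet (E q)) (hd : Pairwise (Function.onFun Disjoint E))
    (hcov : ∀ᵐ x ∂μ, ∃ q, x ∈ E q) (f : α → ENNReal) :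
    ∫⁻ x, f x ∂μ = ∑' q, ∫⁻ x, (E q).indicator f x ∂μ := by
  have h : (⋃ q, E q : Set α) =ᵐ[μ] Set.univ :=
    eventuallyEq_univ.2 (hcov.mono fun x hx => Set.mem_iUnion.2 hx)
  rw [← setLIntegral_univ f, ← setLIntegral_congr h, lintegral_iUnion hE hd]
  exact tsum_congr fun q => (lintegral_indicator (hE q) f).symm

section Run

variable (k : Fin K) (γmax : ℝ)

lemma nominalPath_core_eq (v : Drive K) (j : ℕ) : (nominalPath k v j).core = Core.run k v j :=
  (core_nominalPath k v j).1

lemma measurable_run_time (j : ℕ) : Measurable fun v => (Core.run k v j).time := by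
  simp only [← nominalPath_core_eq]
  exact (measurable_nominalPath k j).state_time

lemma measurable_run_arr (j : ℕ) : Measurable fun v => (Core.run k v j).arr := by
  simp only [← nominalPath_core_eq]
  exact (measurable_nominalPath k j).state_arr

lemma measurable_run_ent (j : ℕ) : Measurable fun v => (Core.run k v j).ent := by
  simp only [← nominalPath_core_eq]
  exact (measurable_nominalPath k j).state_ent

lemma measurableSet_run_dep (j : ℕ) : MeasurableSet {v | (Core.run k v j).dep = none} := by
  simp only [← nominalPath_core_eq]
  exact measurableSet_dep_eq_none (measurable_nominalPath k j)

lemma measurableSet_switchAt (j : ℕ) : MeasurableSet {w | SwitchAt k γmax w j} := by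
  have h1 := measurable_coord (measurable_run_arr k j) k
  have h2 := measurable_coord (measurable_run_arr k (j + 1)) k
  have h3 : Measurable fun w => (Core.run k w (j + 1)).backlog k w := by
    simp only [← nominalPath_core_eq]
    exact measurable_backlog k measurable_id (measurable_nominalPath k (j + 1))
  exact (measurableSet_eq_fun h2 h1).compl.inter (measurableSet_lt measurable_const h3)

/-- The simulation has switched, or the `n`-th class-`k` job has entered service. -/
def Stopped (n : ℕ) (w : Drive K) (i : ℕ) : Prop :=
  (∃ j < i, SwitchAt k γmax w j) ∨ n < (Core.run k w i).ent k

lemma measurableSet_stopped (n i : ℕ) : MeasurableSet {w | Stopped k γmax n w i} := by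
  have h1 : MeasurableSet {w | ∃ j < i, SwitchAt k γmax w j} := by
    have : {w | ∃ j < i, SwitchAt k γmax w j} = ⋃ j ∈ Set.Iio i, {w | SwitchAt k γmax w j} := by
      ext w; simp
    rw [this]
    exact MeasurableSet.biUnion (Set.to_countable _) fun j _ => measurableSet_switchAt k γmax j
  exact h1.union (measurableSet_lt measurable_const (measurable_coord (measurable_run_ent k i) k))

/-- Stopping at event `i` with given numbers of arrivals and of jobs that have entered service. -/
def stopEvent (n : ℕ) (q : ℕ × (Fin K → ℕ) × (Fin K → ℕ)) : Set (Drive K) :=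
  {w | (Pos w ∧ Stopped k γmax n w q.1 ∧ ∀ i < q.1, ¬ Stopped k γmax n w i) ∧
    (Core.run k w q.1).arr = q.2.1 ∧ (Core.run k w q.1).ent = q.2.2}

lemma measurableSet_stopEvent (n : ℕ) (q : ℕ × (Fin K → ℕ) × (Fin K → ℕ)) :
    MeasurableSet (stopEvent k γmax n q) := by
  have h : MeasurableSet {w | ∀ i < q.1, ¬ Stopped k γmax n w i} := by
    have : {w | ∀ i < q.1, ¬ Stopped k γmax n w i}
        = ⋂ i ∈ Set.Iio q.1, {w | Stopped k γmax n w i}ᶜ := by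
      ext w; simp
    rw [this]
    exact MeasurableSet.biInter (Set.to_countable _) fun j _ =>
      (measurableSet_stopped k γmax n j).compl
  exact (measurableSet_pos.inter ((measurableSet_stopped k γmax n q.1).inter h)).inter
    ((measurable_run_arr k q.1 (measurableSet_singleton _)).inter
      (measurable_run_ent k q.1 (measurableSet_singleton _)))

lemma pairwise_disjoint_stopEvent (n : ℕ) :
    Pairwise (Function.onFun Disjoint (stopEvent k γmax n)) := by
  rintro ⟨i, a, e⟩ ⟨i', a', e'⟩ hne
  refine Set.disjoint_left.2 ?_
  rintro w ⟨⟨-, h1, h2⟩, h3, h4⟩ ⟨⟨-, h1', h2'⟩, h3', h4'⟩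
  have hi : i = i' := by
    rcases lt_trichotomy i i' with h | h | h
    · exact absurd h1 (h2' i h)
    · exact h
    · exact absurd h1' (h2 i' h)
  subst hi
  exact hne (by simp only at h3 h3' h4 h4'; rw [← h3, ← h4, h3', h4'])

lemma exists_mem_stopEvent {n : ℕ} {w : Drive K} (hw : Pos w)
    (h : ∃ i, Stopped k γmax n w i) : ∃ q, w ∈ stopEvent k γmax n q := by
  classical
  exact ⟨(Nat.find h, (Core.run k w (Nat.find h)).arr, (Core.run k w (Nat.find h)).ent), ⟨hw, Nat.find_spec h, fun i hi => Nat.find_min h hi⟩, rfl, rfl⟩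

variable {k γmax}

/-- The backlog contains service times of waiting jobs of classes up to `k` only, and those are
realized on arrival. Realizing them early is what makes the switch a stopping rule. -/
lemma SwitchAt.congr {w w' : Drive K} {j i : ℕ} (hj : j < i)
    (hs : ∀ m ≤ i, Core.Same (Core.run k w m) (Core.run k w' m))
    (hag : Agree k (Core.run k w i).arr (Core.run k w i).ent w w') :
    SwitchAt k γmax w' j ↔ SwitchAt k γmax w j := by
  have hb : (Core.run k w' (j + 1)).backlog k w' = (Core.run k w (j + 1)).backlog k w := by
    unfold Core.backlog
    rw [(hs _ hj).arr, (hs _ hj).ent, (hs _ hj).dep, (hs _ hj).time]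
    congr 1
    refine Finset.sum_congr rfl fun l hl => Finset.sum_congr rfl fun n hn => ?_
    refine hag.service l n ?_
    unfold Realized
    rw [if_pos (Finset.mem_filter.1 hl).2]
    exact (Finset.mem_Ico.1 hn).2.trans_le (Core.arr_mono k w l hj)
  unfold SwitchAt
  rw [hb, (hs _ hj).arr, (hs _ hj.le).arr]

/-- Stopping events are determined by what has been realized when they occur. -/
lemma stopEvent_determined {n : ℕ} {q : ℕ × (Fin K → ℕ) × (Fin K → ℕ)} {w : Drive K}
    (hw : w ∈ stopEvent k γmax n q) {w' : Drive K} (hw' : Pos w') (hag : Agree k q.2.1 q.2.2 w w')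
    (hres : ∀ l, (Core.run k w q.1).time < arrivalSum w' l (q.2.1 l + 1)) :
    w' ∈ stopEvent k γmax n q ∧ (Core.run k w' q.1).time = (Core.run k w q.1).time := by
  obtain ⟨⟨hp, h1, h2⟩, h3, h4⟩ := hw
  obtain ⟨i, a, e⟩ := q
  dsimp only at h1 h2 h3 h4 hag hres ⊢
  subst h3 h4
  have hs := Core.same_run k hp hw' i hag hres
  have hst : ∀ m ≤ i, (Stopped k γmax n w' m ↔ Stopped k γmax n w m) := fun m hm => by
    unfold Stopped
    rw [(hs m hm).ent]
    refine or_congr_left (exists_congr fun j => and_congr_right fun hj => ?_)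
    exact SwitchAt.congr (hj.trans_le hm) hs hag
  exact ⟨⟨⟨hw', (hst i le_rfl).2 h1, fun m hm => (hst m hm.le).not.2 (h2 m hm)⟩,
    (hs i le_rfl).arr, (hs i le_rfl).ent⟩, (hs i le_rfl).time⟩

lemma resp_congr_all {c c' : ℕ → Core K} (h : ∀ j, Core.Same (c j) (c' j)) (n : ℕ) :
    resp k c n = resp k c' n := by
  unfold resp
  simp only [(h _).ent, (h _).arr, (h _).dep, (h _).time]

end Run

/-! ### Late jobs and the unbiasedness of their weights -/

variable {gA gS : Fin K → ℝ → ℝ} {lam mu : Fin K → ℝ}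

/-- The `n`-th class-`k` job belongs to the first cycle and has a response time above `γ`. -/
def lateEvent (k : Fin K) (γ : ℝ) (n : ℕ) : Set (Drive K) :=
  {v | n < cycleCount k (nominalPath k v) ∧ γ < responseTime k (nominalPath k v) n}

lemma measurableSet_lateEvent (k : Fin K) (γ : ℝ) (n : ℕ) : MeasurableSet (lateEvent k γ n) :=
  (measurableSet_lt measurable_const (measurable_cycleCount k (measurable_nominalPath k))).inter
    (measurableSet_lt measurable_const (measurable_responseTime k (measurable_nominalPath k) n))

/-- The `n`-th class-`k` job belongs to the importance sampling cycle and has a response time above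
`γ`. -/
def samplingLateEvent (k : Fin K) (γmax γ : ℝ) (n : ℕ) : Set (Drive K × Drive K) :=
  {u | n < cycleCount k (samplingPath k γmax u) ∧ γ < responseTime k (samplingPath k γmax u) n}

lemma measurableSet_samplingLateEvent (k : Fin K) (γmax γ : ℝ) (n : ℕ) :
    MeasurableSet (samplingLateEvent k γmax γ n) :=
  (measurableSet_lt measurable_const (measurable_cycleCount k (measurable_samplingPath k γmax))).inter
    (measurableSet_lt measurable_const
      (measurable_responseTime k (measurable_samplingPath k γmax) n))

lemma Good.exists_cycle_end (hlam : ∀ l, 0 < lam l) (hstable : ∑ l, lam l / mu l < 1) (k : Fin K)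
    {v : Drive K} (hv : Good lam mu v) : ∃ j, 0 < j ∧ (Core.run k v j).dep = none :=
  exists_idle_gt hlam hstable k hv 0

lemma Good.lt_cycleCount_iff (hlam : ∀ l, 0 < lam l) (hstable : ∑ l, lam l / mu l < 1) {k : Fin K}
    {v : Drive K} (hv : Good lam mu v) {n : ℕ} :
    n < cycleCount k (nominalPath k v) ↔ InCycle k (Core.run k v) n :=
  PriorityQueue.lt_cycleCount_iff k _ (nominalPath_same k v)
    (hv.exists_cycle_end hlam hstable k) n

lemma Good.mem_lateEvent (hlam : ∀ l, 0 < lam l) (hstable : ∑ l, lam l / mu l < 1) {k : Fin K}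
    {v : Drive K} (hv : Good lam mu v) {γ : ℝ} {n : ℕ} :
    v ∈ lateEvent k γ n ↔ InCycle k (Core.run k v) n ∧ γ < resp k (Core.run k v) n := by
  rw [← hv.lt_cycleCount_iff hlam hstable, ← responseTime_nominalPath]
  rfl

/-- At a stopping event, the importance sampling run continues like the original system. -/
lemma sampling_eq_of_mem_stopEvent (hlam : ∀ l, 0 < lam l) (hstable : ∑ l, lam l / mu l < 1)
    {k : Fin K} {γmax : ℝ} {n : ℕ} {q : ℕ × (Fin K → ℕ) × (Fin K → ℕ)} {w v : Drive K}
    (hw : w ∈ stopEvent k γmax n q) (hsw : ∃ j, SwitchAt k γmax w j) (hv : Good lam mu v) (γ : ℝ) :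
    ((w, v) ∈ samplingLateEvent k γmax γ n ↔
      splice k q.2.1 q.2.2 (Core.run k w q.1).time w v ∈ lateEvent k γ n) ∧
    likelihoodRatio lam mu gA gS k w
        (samplingPath k γmax (w, v) (entryStep k (samplingPath k γmax (w, v)) n))
      = lik (expDensity lam) (expDensity mu) k q.2.1 q.2.2 (Core.run k w q.1).time w
        / lik gA gS k q.2.1 q.2.2 (Core.run k w q.1).time w := by
  classical
  obtain ⟨⟨hp, h1, h2⟩, h3, h4⟩ := hw
  obtain ⟨i, a, e⟩ := q
  dsimp only at h1 h2 h3 h4 ⊢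
  subst h3 h4
  change ((n < cycleCount k (samplingPath k γmax (w, v)) ∧
    γ < responseTime k (samplingPath k γmax (w, v)) n) ↔ spliceAt k i w v ∈ _) ∧ _
  set x := samplingPath k γmax (w, v) with hx
  set j := Nat.find hsw with hj
  have hjs : SwitchAt k γmax w j := Nat.find_spec hsw
  have hjm : ∀ m < j, ¬ SwitchAt k γmax w m := fun m hm => Nat.find_min hsw hm
  have hgood : ∀ i, Good lam mu (spliceAt k i w v) := fun i => good_spliceAt k i hp hv
  have hsame := samplingPath_same k γmax hp hv.pos j hjm hjs
  have hcount := PriorityQueue.lt_cycleCount_iff k x hsame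
    ((hgood (j + 1)).exists_cycle_end hlam hstable k) n
  have hresp : responseTime k x n = resp k (Core.run k (spliceAt k (j + 1) w v)) n := by
    rw [responseTime_eq]; exact (resp_congr_all hsame n).symm
  have hex : ∃ m, n < (x m).ent k := by
    obtain ⟨m, hm⟩ := exists_lt_ent hlam hstable k (hgood (j + 1)) k n
    exact ⟨m, by rw [show (x m).ent = _ from (hsame m).ent]; exact hm⟩
  have hmem : n < (x (entryStep k x n)).ent k := Nat.sInf_mem (s := {j | n < (x j).ent k}) hex
  -- Before the stopping event the run has not switched, so up to there the sampling path is the run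
  -- of `w`, and the job cannot have entered.
  have hns : ∀ m, m < i → m ≤ j := fun m hm => by
    by_contra hlt
    exact h2 m hm (Or.inl ⟨j, not_le.1 hlt, hjs⟩)
  have hun : ∀ m ≤ j, Unswitched w (x m) (Core.run k w m) := fun m hm =>
    unswitched_samplingPath k γmax v hp m fun m' hm' => hjm m' (hm'.trans_le hm)
  have hge : i ≤ entryStep k x n := by
    by_contra hlt
    push Not at hlt
    have := (hun _ (hns _ hlt)).core
    have he : (x (entryStep k x n)).ent = _ := congrArg Core.ent this
    rw [he] at hmem
    exact h2 _ hlt (Or.inr hmem)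
  rw [(hgood i).mem_lateEvent hlam hstable, hcount, hresp]
  -- Either the switch stops the run: then `i = j + 1` and the observed quantities stay frozen from
  -- there on. Or the entry of the job does: then cycle membership and response time are already
  -- settled at `i`, so splicing at `i` or at `j + 1` makes no difference.
  rcases Nat.lt_or_ge j i with hji | hji
  · have hi : i = j + 1 := by
      by_contra hne
      have : j + 1 < i := by omega
      exact absurd (hns _ this) (by omega)
    subst hi
    refine ⟨Iff.rfl, ?_⟩
    obtain ⟨m, hm⟩ := Nat.exists_eq_add_of_le hge
    obtain ⟨-, -, e1, e2, e3⟩ := samplingPath_after k γmax hp hv.pos j hjm hjs m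
    rw [hm, likelihoodRatio, likelihood_eq_lik, likelihood_eq_lik, e1, e2, e3]
  · have hent : n < (Core.run k w i).ent k := by
      rcases h1 with ⟨m, hm, hms⟩ | h
      · exact absurd hms (hjm m (by omega))
      · exact h
    have s1 := same_spliceAt k hp hv.pos i
    have s2 : ∀ m ≤ i, Core.Same (Core.run k w m) (Core.run k (spliceAt k (j + 1) w v) m) :=
      fun m hm => same_spliceAt k hp hv.pos (j + 1) m (by omega)
    have hle := (Core.inv_run k hp i).ent_le k
    rw [← resp_congr k i n s1 hent hle, ← resp_congr k i n s2 hent hle,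
      ← inCycle_congr k i n s1 hent, ← inCycle_congr k i n s2 hent]
    refine ⟨Iff.rfl, ?_⟩
    have hU := hun i hji
    have hstep : entryStep k x n = i := by
      refine le_antisymm (Nat.sInf_le ?_) hge
      show n < (x i).ent k
      rw [show (x i).ent = _ from congrArg Core.ent hU.core]
      exact hent
    rw [hstep, likelihoodRatio, likelihood_eq_lik, likelihood_eq_lik, hU.obsTime, hU.obsArr,
      hU.obsEnt, show (x i).time = _ from congrArg Core.time hU.core,
      show (x i).arr = _ from congrArg Core.arr hU.core,
      show (x i).ent = _ from congrArg Core.ent hU.core]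

/-- The weighted indicator of a late job is unbiased. -/
theorem lintegral_likelihoodRatio (hlam : ∀ l, 0 < lam l) (hmu : ∀ l, 0 < mu l)
    (hstable : ∑ l, lam l / mu l < 1) (hgA : ∀ l, IsSamplingDensity (gA l))
    (hgS : ∀ l, IsSamplingDensity (gS l)) (k : Fin K) (γmax γ : ℝ) (n : ℕ) :
    ∫⁻ u, (samplingLateEvent k γmax γ n).indicator
        (fun u => ENNReal.ofReal (likelihoodRatio lam mu gA gS k u.1
          (samplingPath k γmax u (entryStep k (samplingPath k γmax u) n)))) u
        ∂((driveLaw gA gS).prod (nominalLaw lam mu))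
      = nominalLaw lam mu (lateEvent k γ n) := by
  have := isProbabilityMeasure_driveLaw hgA hgS
  have : IsProbabilityMeasure (nominalLaw lam mu) := isProbabilityMeasure_driveLaw
    (fun l => isSamplingDensity_exp (hlam l)) (fun l => isSamplingDensity_exp (hmu l))
  have hw : ∀ᵐ u ∂((driveLaw gA gS).prod (nominalLaw lam mu)),
      Pos u.1 ∧ ∃ j, SwitchAt k γmax u.1 j :=
    Measure.quasiMeasurePreserving_fst.ae
      ((ae_pos_driveLaw hgA hgS).and (ae_exists_switchAt hgA hgS k γmax))
  have hv : ∀ᵐ u ∂((driveLaw gA gS).prod (nominalLaw lam mu)), Good lam mu u.2 :=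
    Measure.quasiMeasurePreserving_snd.ae (ae_good hlam hmu)
  rw [lintegral_eq_tsum_indicator (E := fun q => Prod.fst ⁻¹' stopEvent k γmax n q)
    (fun q => measurable_fst (measurableSet_stopEvent k γmax n q))
    (fun q q' hq => (pairwise_disjoint_stopEvent k γmax n hq).preimage _)
    -- The partition covers both probability spaces for different reasons: under sampling the switch
    -- occurs almost surely, under the original law the job eventually enters service.
    (hw.mono fun u hu => exists_mem_stopEvent k γmax hu.1 (by
      obtain ⟨j, hj⟩ := hu.2
      exact ⟨j + 1, Or.inl ⟨j, Nat.lt_succ_self j, hj⟩⟩)),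
    ← lintegral_indicator_one (measurableSet_lateEvent k γ n),
    lintegral_eq_tsum_indicator (fun q => measurableSet_stopEvent k γmax n q)
    (pairwise_disjoint_stopEvent k γmax n) ((ae_good hlam hmu).mono fun v hv =>
      exists_mem_stopEvent k γmax hv.pos (by
        obtain ⟨j, hj⟩ := exists_lt_ent hlam hstable k hv k n
        exact ⟨j, Or.inr hj⟩))]
  refine tsum_congr fun q => ?_
  rw [← lintegral_splice hlam hmu hgA hgS k q.2.1 q.2.2 (measurable_run_time k q.1)
    (measurableSet_stopEvent k γmax n q) (fun w hw l => ?_) (fun w hw w' _ hw' hag hres =>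
      stopEvent_determined hw hw' hag hres)
    (measurable_one.indicator (measurableSet_lateEvent k γ n))]
  · refine lintegral_congr_ae ?_
    filter_upwards [hw, hv] with u hu1 hu2
    obtain ⟨w, v⟩ := u
    by_cases hE : w ∈ stopEvent k γmax n q
    · obtain ⟨h1, h2⟩ := sampling_eq_of_mem_stopEvent (gA := gA) (gS := gS) hlam hstable hE hu1.2
        hu2 γ
      rw [Set.indicator_of_mem (show (w, v) ∈ Prod.fst ⁻¹' stopEvent k γmax n q from hE),
        Set.indicator_of_mem hE, ← h2]
      by_cases hL : splice k q.2.1 q.2.2 (Core.run k w q.1).time w v ∈ lateEvent k γ n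
      · rw [Set.indicator_of_mem (h1.2 hL), Set.indicator_of_mem hL, Pi.one_apply, mul_one]
      · rw [Set.indicator_of_notMem fun h => hL (h1.1 h), Set.indicator_of_notMem hL, mul_zero]
    · rw [Set.indicator_of_notMem (show (w, v) ∉ Prod.fst ⁻¹' stopEvent k γmax n q from hE),
        Set.indicator_of_notMem hE, zero_mul]
  · obtain ⟨⟨hp, -, -⟩, h3, -⟩ := hw
    have I := Core.inv_run k hp q.1
    have := I.le_time l
    have h5 := I.time_le_next l
    rw [I.next_eq, h3] at h5
    rw [h3] at this
    exact ⟨this, h5⟩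

lemma tail_nonneg {g : ℝ → ℝ} (hg : ∀ x, 0 ≤ g x) (t : ℝ) : 0 ≤ tail g t :=
  integral_nonneg hg

lemma likelihood_nonneg (hA : ∀ l x, 0 ≤ gA l x) (hS : ∀ l x, 0 ≤ gS l x) (k : Fin K)
    (w : Drive K) (s : State K) : 0 ≤ likelihood gA gS k w s := by
  refine mul_nonneg (mul_nonneg ?_ ?_) ?_
  · exact Finset.prod_nonneg fun l _ => mul_nonneg (Finset.prod_nonneg fun n _ => hA l _)
      (tail_nonneg (hA l) _)
  · exact Finset.prod_nonneg fun l _ => Finset.prod_nonneg fun n _ => hS l _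
  · exact Finset.prod_nonneg fun l _ => Finset.prod_nonneg fun n _ => hS l _

lemma likelihoodRatio_nonneg (hlam : ∀ l, 0 < lam l) (hmu : ∀ l, 0 < mu l)
    (hgA : ∀ l, IsSamplingDensity (gA l)) (hgS : ∀ l, IsSamplingDensity (gS l)) (k : Fin K)
    (w : Drive K) (s : State K) : 0 ≤ likelihoodRatio lam mu gA gS k w s :=
  div_nonneg (likelihood_nonneg (fun l => exponentialPDFReal_nonneg (hlam l))
    (fun l => exponentialPDFReal_nonneg (hmu l)) k w s)
    (likelihood_nonneg (fun l => (hgA l).nonneg) (fun l => (hgS l).nonneg) k w s)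

lemma measurable_likelihoodRatio_entry (hlam : ∀ l, 0 < lam l) (hmu : ∀ l, 0 < mu l)
    (hgA : ∀ l, IsSamplingDensity (gA l)) (hgS : ∀ l, IsSamplingDensity (gS l)) (k : Fin K)
    (γmax : ℝ) (n : ℕ) : Measurable fun u : Drive K × Drive K =>
      likelihoodRatio lam mu gA gS k u.1
        (samplingPath k γmax u (entryStep k (samplingPath k γmax u) n)) := by
  have hfA : ∀ l, IsSamplingDensity (expDensity lam l) := fun l => isSamplingDensity_exp (hlam l)
  have hfS : ∀ l, IsSamplingDensity (expDensity mu l) := fun l => isSamplingDensity_exp (hmu l)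
  have hs := measurable_at (measurable_samplingPath (K := K) k γmax)
    (measurable_entryStep k (measurable_samplingPath k γmax) n)
  exact (measurable_likelihood (fun l => (hfA l).measurable) (fun l => (hfS l).measurable)
    (fun l => (hfA l).measurable_tail) k measurable_fst hs).div
    (measurable_likelihood (fun l => (hgA l).measurable) (fun l => (hgS l).measurable)
    (fun l => (hgA l).measurable_tail) k measurable_fst hs)

/-- The random number of summands is traded for a series of indicators, so that expectation and sum
can be exchanged. -/
lemma ofReal_weightedCount (hlam : ∀ l, 0 < lam l) (hmu : ∀ l, 0 < mu l)
    (hgA : ∀ l, IsSamplingDensity (gA l)) (hgS : ∀ l, IsSamplingDensity (gS l)) (k : Fin K)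
    (γmax : ℝ) (u : Drive K × Drive K) (γ : ℝ) :
    ENNReal.ofReal (weightedCount lam mu gA gS k γmax u γ)
      = ∑' n, (samplingLateEvent k γmax γ n).indicator
        (fun u => ENNReal.ofReal (likelihoodRatio lam mu gA gS k u.1
          (samplingPath k γmax u (entryStep k (samplingPath k γmax u) n)))) u := by
  have h0 := likelihoodRatio_nonneg hlam hmu hgA hgS k
  unfold weightedCount
  dsimp only
  rw [ENNReal.ofReal_sum_of_nonneg fun n _ => mul_nonneg (h0 _ _) (by split_ifs <;> simp),
    tsum_eq_sum (s := Finset.range (cycleCount k (samplingPath k γmax u)))]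
  · refine Finset.sum_congr rfl fun n hn => ?_
    rw [Finset.mem_range] at hn
    by_cases hγ : γ < responseTime k (samplingPath k γmax u) n
    · simp [samplingLateEvent, Set.indicator, hn, hγ]
    · simp [samplingLateEvent, Set.indicator, hγ]
  · intro n hn
    refine Set.indicator_of_notMem (fun h => hn (Finset.mem_range.2 h.1)) _

lemma weightedCount_nonneg (hlam : ∀ l, 0 < lam l) (hmu : ∀ l, 0 < mu l)
    (hgA : ∀ l, IsSamplingDensity (gA l)) (hgS : ∀ l, IsSamplingDensity (gS l)) (k : Fin K)
    (γmax : ℝ) (u : Drive K × Drive K) (γ : ℝ) : 0 ≤ weightedCount lam mu gA gS k γmax u γ :=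
  Finset.sum_nonneg fun _ _ => mul_nonneg (likelihoodRatio_nonneg hlam hmu hgA hgS k _ _)
    (by split_ifs <;> simp)

lemma weightedCount_antitone (hlam : ∀ l, 0 < lam l) (hmu : ∀ l, 0 < mu l)
    (hgA : ∀ l, IsSamplingDensity (gA l)) (hgS : ∀ l, IsSamplingDensity (gS l)) (k : Fin K)
    (γmax : ℝ) (u : Drive K × Drive K) : Antitone (weightedCount lam mu gA gS k γmax u) := by
  intro γ γ' h
  refine Finset.sum_le_sum fun n _ => mul_le_mul_of_nonneg_left ?_
    (likelihoodRatio_nonneg hlam hmu hgA hgS k _ _)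
  split_ifs with h1 h2
  · exact le_rfl
  · exact absurd (h.trans_lt h1) h2
  · exact zero_le_one
  · exact le_rfl

lemma weightedCount_eventually_eq_zero (k : Fin K) (γmax : ℝ) (u : Drive K × Drive K) :
    ∀ᶠ γ in atTop, weightedCount lam mu gA gS k γmax u γ = 0 := by
  have h : ∀ᶠ γ in atTop, ∀ n ∈ Finset.range (cycleCount k (samplingPath k γmax u)),
      responseTime k (samplingPath k γmax u) n ≤ γ :=
    (Filter.eventually_all_finset _).2 fun n _ => eventually_ge_atTop _
  filter_upwards [h] with γ hγ
  refine Finset.sum_eq_zero fun n hn => ?_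
  rw [if_neg (not_lt.2 (hγ n hn)), mul_zero]

lemma measurable_weightedCount (hlam : ∀ l, 0 < lam l) (hmu : ∀ l, 0 < mu l)
    (hgA : ∀ l, IsSamplingDensity (gA l)) (hgS : ∀ l, IsSamplingDensity (gS l)) (k : Fin K)
    (γmax γ : ℝ) : Measurable fun u => weightedCount lam mu gA gS k γmax u γ := by
  have h : Measurable fun u => ENNReal.ofReal (weightedCount lam mu gA gS k γmax u γ) := by
    simp only [ofReal_weightedCount hlam hmu hgA hgS]
    exact Measurable.tsum fun n =>
      (measurable_likelihoodRatio_entry hlam hmu hgA hgS k γmax n).ennreal_ofReal.indicator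
        (measurableSet_samplingLateEvent k γmax γ n)
  convert h.ennreal_toReal using 2 with u
  exact (ENNReal.toReal_ofReal (weightedCount_nonneg hlam hmu hgA hgS k γmax u γ)).symm

/-- Unbiasedness of importance sampling. -/
theorem lintegral_weightedCount (hlam : ∀ l, 0 < lam l) (hmu : ∀ l, 0 < mu l)
    (hstable : ∑ l, lam l / mu l < 1) (hgA : ∀ l, IsSamplingDensity (gA l))
    (hgS : ∀ l, IsSamplingDensity (gS l)) (k : Fin K) (γmax γ : ℝ) :
    ∫⁻ u, ENNReal.ofReal (weightedCount lam mu gA gS k γmax u γ)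
        ∂((driveLaw gA gS).prod (nominalLaw lam mu))
      = ∑' n, nominalLaw lam mu (lateEvent k γ n) := by
  simp only [ofReal_weightedCount hlam hmu hgA hgS]
  rw [lintegral_tsum fun n =>
    ((measurable_likelihoodRatio_entry hlam hmu hgA hgS k γmax n).ennreal_ofReal.indicator
      (measurableSet_samplingLateEvent k γmax γ n)).aemeasurable]
  exact tsum_congr fun n => lintegral_likelihoodRatio hlam hmu hstable hgA hgS k γmax γ n

end PriorityQueue
end

noncomputable section
namespace PriorityQueue
variable {K : ℕ}

/-! ### Regeneration -/

section Renewal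

/-- In generating functions: f(1 - g) = b and G = (1 - g)/(1 - z), hence G f = b/(1 - z). -/
lemma renewal_sum {f b g G : ℕ → ℝ} (hG0 : G 0 = 1 - g 0) (hG : ∀ i, G (i + 1) = G i - g (i + 1))
    (hf : ∀ n, f n = b n + ∑ j ∈ Finset.range (n + 1), g j * f (n - j)) (n : ℕ) :
    ∑ i ∈ Finset.range (n + 1), G i * f (n - i) = ∑ m ∈ Finset.range (n + 1), b m := by
  induction n with
  | zero =>
    have := hf 0
    simp only [zero_add, Finset.range_one, Finset.sum_singleton, Nat.sub_self] at this ⊢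
    rw [hG0]; linarith
  | succ n ih =>
    rw [Finset.sum_range_succ b (n + 1), ← ih, Finset.sum_range_succ']
    have h1 := hf (n + 1)
    rw [Finset.sum_range_succ'] at h1
    simp only [Nat.add_sub_add_right, Nat.sub_zero] at h1 ⊢
    have h2 : ∑ i ∈ Finset.range (n + 1), G (i + 1) * f (n - i)
        = ∑ i ∈ Finset.range (n + 1), G i * f (n - i)
          - ∑ i ∈ Finset.range (n + 1), g (i + 1) * f (n - i) := by
      rw [← Finset.sum_sub_distrib]
      exact Finset.sum_congr rfl fun i _ => by rw [hG]; ring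
    rw [h2, hG0]
    linarith

/-- A discrete renewal theorem, given that the solution of the renewal equation converges. -/
theorem hasSum_of_renewal {f b g G : ℕ → ℝ} {c C : ℝ} (hG0 : G 0 = 1 - g 0)
    (hG : ∀ i, G (i + 1) = G i - g (i + 1))
    (hf : ∀ n, f n = b n + ∑ j ∈ Finset.range (n + 1), g j * f (n - j))
    (hb : ∀ n, 0 ≤ b n) (hfb : ∀ n, |f n| ≤ C) (hGn : ∀ i, 0 ≤ G i) (hs : Summable G)
    (hlim : Tendsto f atTop (𝓝 c)) : HasSum b (c * ∑' i, G i) := by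
  -- Padded with zeros, the convolution becomes a series over a fixed index set, dominated termwise
  -- by the summable `G i * C`.
  have h1 : Tendsto (fun n => ∑' i, if i < n + 1 then G i * f (n - i) else 0) atTop
      (𝓝 (∑' i, G i * c)) := by
    refine tendsto_tsum_of_dominated_convergence (bound := fun i => G i * C) (hs.mul_right C)
      (fun i => ?_) (Eventually.of_forall fun n i => ?_)
    · refine ((hlim.comp (tendsto_sub_atTop_nat i)).const_mul (G i)).congr' ?_
      filter_upwards [eventually_ge_atTop i] with n hn
      rw [if_pos (by omega)]
      rfl
    · split_ifs
      · rw [Real.norm_eq_abs, abs_mul, abs_of_nonneg (hGn i)]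
        exact mul_le_mul_of_nonneg_left (hfb _) (hGn i)
      · rw [norm_zero]
        exact mul_nonneg (hGn i) ((abs_nonneg _).trans (hfb 0))
  rw [hasSum_iff_tendsto_nat_of_nonneg hb]
  rw [← tendsto_add_atTop_iff_nat 1]
  rw [tsum_mul_right, mul_comm] at h1
  refine h1.congr fun n => ?_
  rw [← renewal_sum hG0 hG hf n, tsum_eq_sum (s := Finset.range (n + 1))]
  · exact Finset.sum_congr rfl fun i hi => by rw [if_pos (Finset.mem_range.1 hi)]
  · intro i hi
    rw [if_neg fun h => hi (Finset.mem_range.2 h)]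

end Renewal

/-! ### The restart after the first cycle and the renewal equation -/

variable {lam mu : Fin K → ℝ}

lemma isProbabilityMeasure_nominalLaw (hlam : ∀ l, 0 < lam l) (hmu : ∀ l, 0 < mu l) :
    IsProbabilityMeasure (nominalLaw lam mu) :=
  isProbabilityMeasure_driveLaw (fun l => isSamplingDensity_exp (hlam l))
    (fun l => isSamplingDensity_exp (hmu l))

lemma measurable_shiftDrive (a : Fin K → ℕ) : Measurable (shiftDrive a) :=
  measurable_pi_lambda _ fun l => measurable_pi_lambda _ fun _ =>
    measurable_entry measurable_id l measurable_const

/-- The shift is deterministic. For this reason the end of a cycle is split according to the vector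
of arrivals in `cycleEvent`. -/
lemma measurePreserving_shiftDrive (hlam : ∀ l, 0 < lam l) (hmu : ∀ l, 0 < mu l)
    (a : Fin K → ℕ) :
    MeasurePreserving (shiftDrive a) (nominalLaw lam mu) (nominalLaw lam mu) := by
  have h1 : ∀ l, IsProbabilityMeasure
      ((densityLaw (expDensity lam l)).prod (densityLaw (expDensity mu l))) := fun l => by
    have : IsProbabilityMeasure (densityLaw (expDensity lam l)) :=
      (isSamplingDensity_exp (hlam l)).isProbabilityMeasure
    have : IsProbabilityMeasure (densityLaw (expDensity mu l)) :=
      (isSamplingDensity_exp (hmu l)).isProbabilityMeasure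
    infer_instance
  refine ⟨measurable_shiftDrive a, ?_⟩
  have e := Measure.infinitePi_map_pi
    (fun l : Fin K => Measure.infinitePi fun _ : ℕ =>
      (densityLaw (expDensity lam l)).prod (densityLaw (expDensity mu l)))
    (f := fun l y n => y (a l + n)) (fun l => by fun_prop)
  have e2 : ∀ l : Fin K, (Measure.infinitePi fun _ : ℕ =>
      (densityLaw (expDensity lam l)).prod (densityLaw (expDensity mu l))).map
        (fun y n => y (a l + n)) = Measure.infinitePi fun _ : ℕ =>
      (densityLaw (expDensity lam l)).prod (densityLaw (expDensity mu l)) := fun l =>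
    Measure.map_infinitePi_infinitePi_of_inj (f := fun n : ℕ => a l + n)
      (add_right_injective (a l))
  simp only [e2] at e
  exact e

/-- The first cycle ends at event `q.1`, when `q.2` jobs have arrived. -/
def cycleEvent (k : Fin K) (q : ℕ × (Fin K → ℕ)) : Set (Drive K) :=
  {w | (Pos w ∧ (0 < q.1 ∧ (Core.run k w q.1).dep = none) ∧
    ∀ i < q.1, ¬ (0 < i ∧ (Core.run k w i).dep = none)) ∧ (Core.run k w q.1).arr = q.2}

lemma measurableSet_cycleEvent (k : Fin K) (q : ℕ × (Fin K → ℕ)) :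
    MeasurableSet (cycleEvent k q) := by
  have h0 : ∀ i, MeasurableSet {w | 0 < i ∧ (Core.run k w i).dep = none} := fun i => by
    by_cases hi : 0 < i
    · simpa [hi] using measurableSet_run_dep k i
    · simp [hi]
  have h : MeasurableSet {w | ∀ i < q.1, ¬ (0 < i ∧ (Core.run k w i).dep = none)} := by
    have : {w | ∀ i < q.1, ¬ (0 < i ∧ (Core.run k w i).dep = none)}
        = ⋂ i ∈ Set.Iio q.1, {w | 0 < i ∧ (Core.run k w i).dep = none}ᶜ := by
      ext w; simp
    rw [this]
    exact MeasurableSet.biInter (Set.to_countable _) fun i _ => (h0 i).compl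
  exact (measurableSet_pos.inter ((h0 q.1).inter h)).inter
    (measurable_run_arr k q.1 (measurableSet_singleton _))

lemma pairwise_disjoint_cycleEvent (k : Fin K) :
    Pairwise (Function.onFun Disjoint (cycleEvent k)) := by
  rintro ⟨i, a⟩ ⟨i', a'⟩ hne
  refine Set.disjoint_left.2 ?_
  rintro w ⟨⟨-, h1, h2⟩, h3⟩ ⟨⟨-, h1', h2'⟩, h3'⟩
  have hi : i = i' := by
    rcases lt_trichotomy i i' with h | h | h
    · exact absurd h1 (h2' i h)
    · exact h
    · exact absurd h1' (h2 i' h)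
  subst hi
  exact hne (by simp only at h3 h3'; rw [← h3, h3'])

lemma Good.exists_mem_cycleEvent (hlam : ∀ l, 0 < lam l) (hstable : ∑ l, lam l / mu l < 1)
    (k : Fin K) {w : Drive K} (hw : Good lam mu w) : ∃ q, w ∈ cycleEvent k q := by
  classical
  have h := hw.exists_cycle_end hlam hstable k
  exact ⟨(Nat.find h, (Core.run k w (Nat.find h)).arr),
    ⟨hw.pos, Nat.find_spec h, fun i hi => Nat.find_min h hi⟩, rfl⟩

lemma cycleCount_of_mem_cycleEvent {k : Fin K} {q : ℕ × (Fin K → ℕ)} {w : Drive K}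
    (hw : w ∈ cycleEvent k q) : cycleCount k (nominalPath k w) = q.2 k := by
  obtain ⟨⟨hp, h1, h2⟩, h3⟩ := hw
  have hd : ∀ j, (nominalPath k w j).dep = (Core.run k w j).dep := fun j =>
    congrArg Core.dep (nominalPath_core_eq k w j)
  have hstep : cycleStep (nominalPath k w) = q.1 := by
    refine le_antisymm (Nat.sInf_le ⟨h1.1, (hd _).trans h1.2⟩) ?_
    by_contra hlt
    have hm : cycleStep (nominalPath k w) ∈ {j | 0 < j ∧ (nominalPath k w j).dep = none} :=
      Nat.sInf_mem ⟨q.1, h1.1, (hd _).trans h1.2⟩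
    exact h2 _ (not_le.1 hlt) ⟨hm.1, (hd _).symm.trans hm.2⟩
  rw [cycleCount, hstep, show (nominalPath k w q.1).ent = (Core.run k w q.1).ent from
    congrArg Core.ent (nominalPath_core_eq k w q.1), (Core.inv_run k hp q.1).idle h1.2 k, h3]

/-- The end of the cycle is a stopping event. Entries equal arrivals there, so the single vector
`q.2` plays both roles in `Agree`. -/
lemma cycleEvent_determined {k : Fin K} {q : ℕ × (Fin K → ℕ)} {w : Drive K}
    (hw : w ∈ cycleEvent k q) {w' : Drive K} (hw' : Pos w') (hag : Agree k q.2 q.2 w w')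
    (hres : ∀ l, (Core.run k w q.1).time < arrivalSum w' l (q.2 l + 1)) :
    w' ∈ cycleEvent k q ∧ (Core.run k w' q.1).time = (Core.run k w q.1).time := by
  obtain ⟨⟨hp, h1, h2⟩, h3⟩ := hw
  obtain ⟨i, a⟩ := q
  dsimp only at h1 h2 h3 hag hres ⊢
  subst h3
  have hent : (Core.run k w i).ent = (Core.run k w i).arr :=
    funext fun l => (Core.inv_run k hp i).idle h1.2 l
  have hs := Core.same_run k hp hw' i (by rw [hent]; exact hag) hres
  exact ⟨⟨⟨hw', ⟨h1.1, (hs i le_rfl).dep.trans h1.2⟩, fun m hm h => h2 m hm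
    ⟨h.1, (hs m hm.le).dep.symm.trans h.2⟩⟩, (hs i le_rfl).arr⟩, (hs i le_rfl).time⟩

/-- The `n`-th class-`k` job has a response time above `γ`. -/
def respEvent (k : Fin K) (γ : ℝ) (n : ℕ) : Set (Drive K) :=
  {v | γ < responseTime k (nominalPath k v) n}

lemma measurableSet_respEvent (k : Fin K) (γ : ℝ) (n : ℕ) : MeasurableSet (respEvent k γ n) :=
  measurableSet_lt measurable_const (measurable_responseTime k (measurable_nominalPath k) n)

lemma lik_pos {gA gS : Fin K → ℝ → ℝ} (hgA : ∀ l, IsSamplingDensity (gA l))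
    (hA : ∀ l x, 0 < x → 0 < gA l x) (hS : ∀ l x, 0 < x → 0 < gS l x) (k : Fin K)
    (a e : Fin K → ℕ) {T : ℝ} {w : Drive K} (hw : Pos w) (hT : ∀ l, arrivalSum w l (a l) ≤ T) :
    0 < lik gA gS k a e T w := by
  refine mul_pos (mul_pos ?_ ?_) ?_
  · exact Finset.prod_pos fun l _ => mul_pos (Finset.prod_pos fun n _ => hA l _ (hw l n).1)
      ((hgA l).tail_pos (sub_nonneg.2 (hT l)))
  · exact Finset.prod_pos fun l _ => Finset.prod_pos fun n _ => hS l _ (hw l n).2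
  · exact Finset.prod_pos fun l _ => Finset.prod_pos fun n _ => hS l _ (hw l n).2

/-- The system starts afresh after its first cycle. -/
theorem measure_cycleEvent_inter (hlam : ∀ l, 0 < lam l) (hmu : ∀ l, 0 < mu l)
    (hstable : ∑ l, lam l / mu l < 1) (k : Fin K) (γ : ℝ) (n : ℕ) (q : ℕ × (Fin K → ℕ)) :
    nominalLaw lam mu (cycleEvent k q ∩ respEvent k γ (q.2 k + n))
      = nominalLaw lam mu (cycleEvent k q) * nominalLaw lam mu (respEvent k γ n) := by
  have hA : ∀ l, IsSamplingDensity (expDensity lam l) := fun l => isSamplingDensity_exp (hlam l)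
  have hS : ∀ l, IsSamplingDensity (expDensity mu l) := fun l => isSamplingDensity_exp (hmu l)
  have := isProbabilityMeasure_nominalLaw hlam hmu
  have hE := measurableSet_cycleEvent k q
  have hbound : ∀ w ∈ cycleEvent k q, ∀ l, arrivalSum w l (q.2 l) ≤ (Core.run k w q.1).time ∧
      (Core.run k w q.1).time ≤ arrivalSum w l (q.2 l + 1) := by
    rintro w ⟨⟨hp, -, -⟩, h3⟩ l
    have I := Core.inv_run k hp q.1
    have h4 := I.le_time l
    have h5 := I.time_le_next l
    rw [I.next_eq, h3] at h5
    rw [h3] at h4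
    exact ⟨h4, h5⟩
  -- Sampling from the original densities makes the likelihood ratio equal to 1, and the change of
  -- measure reduces to the strong Markov property.
  have key := lintegral_splice hlam hmu hA hS k q.2 q.2 (measurable_run_time k q.1) hE hbound
    (fun w hw w' _ hw' hag hres => cycleEvent_determined hw hw' hag hres)
    (measurable_one.indicator (measurableSet_respEvent k γ (q.2 k + n)))
  have hshift := measurePreserving_shiftDrive hlam hmu q.2
  have hr := measurableSet_respEvent k γ n
  calc nominalLaw lam mu (cycleEvent k q ∩ respEvent k γ (q.2 k + n))
      = ∫⁻ v, (cycleEvent k q).indicator ((respEvent k γ (q.2 k + n)).indicator 1) v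
          ∂nominalLaw lam mu := by
        rw [Set.indicator_indicator, lintegral_indicator_one
          (hE.inter (measurableSet_respEvent k γ (q.2 k + n)))]
    _ = ∫⁻ u, (cycleEvent k q).indicator 1 u.1 *
          (respEvent k γ n).indicator 1 (shiftDrive q.2 u.2)
          ∂((nominalLaw lam mu).prod (nominalLaw lam mu)) := by
        rw [← key]
        refine lintegral_congr_ae ?_
        have hv : ∀ᵐ u ∂((nominalLaw lam mu).prod (nominalLaw lam mu)),
            Good lam mu u.2 ∧ Good lam mu (shiftDrive q.2 u.2) :=
          Measure.quasiMeasurePreserving_snd.ae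
            ((ae_good hlam hmu).and (hshift.quasiMeasurePreserving.ae (ae_good hlam hmu)))
        filter_upwards [hv] with u hu
        obtain ⟨w, v⟩ := u
        by_cases hw : w ∈ cycleEvent k q
        · have hl : lik (expDensity lam) (expDensity mu) k q.2 q.2 (Core.run k w q.1).time w ≠ 0 :=
            (lik_pos (gA := expDensity lam) (gS := expDensity mu) hA
              (fun l x hx => exponentialPDFReal_pos (hlam l) hx)
              (fun l x hx => exponentialPDFReal_pos (hmu l) hx) k q.2 q.2 hw.1.1
              fun l => (hbound w hw l).1).ne'
          have h1 : (cycleEvent k q).indicator (fun w => ENNReal.ofReal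
              (lik (expDensity lam) (expDensity mu) k q.2 q.2 (Core.run k w q.1).time w /
                lik (expDensity lam) (expDensity mu) k q.2 q.2 (Core.run k w q.1).time w)) w = 1 := by
            rw [Set.indicator_of_mem hw, div_self hl, ENNReal.ofReal_one]
          rw [h1, Set.indicator_of_mem hw, Pi.one_apply, one_mul, one_mul]
          have hiff : splice k q.2 q.2 (Core.run k w q.1).time w v ∈ respEvent k γ (q.2 k + n) ↔
              shiftDrive q.2 v ∈ respEvent k γ n := by
            obtain ⟨⟨hp, h1, -⟩, h3⟩ := hw
            have hent : (Core.run k w q.1).ent = q.2 :=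
              (funext fun l => (Core.inv_run k hp q.1).idle h1.2 l).trans h3
            have hs : splice k q.2 q.2 (Core.run k w q.1).time w v = spliceAt k q.1 w v := by
              rw [spliceAt, hent, h3]
            have := resp_spliceAt_idle k hp hu.1.pos q.1 h1.2 n
              (by rw [h3]; exact exists_lt_ent hlam hstable k hu.2 k n)
            rw [h3] at this
            simp only [respEvent, Set.mem_ofPred_eq, responseTime_nominalPath, hs, this]
          by_cases hm : shiftDrive q.2 v ∈ respEvent k γ n
          · rw [Set.indicator_of_mem hm, Set.indicator_of_mem (hiff.2 hm)]
            rfl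
          · rw [Set.indicator_of_notMem hm, Set.indicator_of_notMem fun h => hm (hiff.1 h)]
        · simp only [Set.indicator_of_notMem hw, zero_mul]
    _ = nominalLaw lam mu (cycleEvent k q) * nominalLaw lam mu (respEvent k γ n) := by
        rw [lintegral_prod_mul (f := (cycleEvent k q).indicator 1)
          (g := fun v => (respEvent k γ n).indicator 1 (shiftDrive q.2 v))
          (measurable_one.indicator hE).aemeasurable
          ((measurable_one.indicator hr).comp hshift.measurable).aemeasurable,
          lintegral_indicator_one hE,
          hshift.lintegral_comp (measurable_one.indicator hr), lintegral_indicator_one hr]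

lemma measurableSet_cycleCount_eq (k : Fin K) (j : ℕ) :
    MeasurableSet {v : Drive K | cycleCount k (nominalPath k v) = j} :=
  measurable_cycleCount k (measurable_nominalPath k) (measurableSet_singleton j)

lemma measurableSet_lt_cycleCount (k : Fin K) (j : ℕ) :
    MeasurableSet {v : Drive K | j < cycleCount k (nominalPath k v)} :=
  measurableSet_lt measurable_const (measurable_cycleCount k (measurable_nominalPath k))

lemma measure_cycleCount_eq_inter (hlam : ∀ l, 0 < lam l) (hmu : ∀ l, 0 < mu l)
    (hstable : ∑ l, lam l / mu l < 1) (k : Fin K) (γ : ℝ) (n j : ℕ) :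
    nominalLaw lam mu ({v | cycleCount k (nominalPath k v) = j} ∩ respEvent k γ (j + n))
      = nominalLaw lam mu {v | cycleCount k (nominalPath k v) = j}
        * nominalLaw lam mu (respEvent k γ n) := by
  have hj := measurableSet_cycleCount_eq k j
  have hcov : ∀ᵐ v ∂nominalLaw lam mu, ∃ q, v ∈ cycleEvent k q :=
    (ae_good hlam hmu).mono fun v hv => hv.exists_mem_cycleEvent hlam hstable k
  have hsum : ∀ S, MeasurableSet S → nominalLaw lam mu S
      = ∑' q, nominalLaw lam mu (cycleEvent k q ∩ S) := fun S hS => by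
    rw [← lintegral_indicator_one hS, lintegral_eq_tsum_indicator (measurableSet_cycleEvent k)
      (pairwise_disjoint_cycleEvent k) hcov]
    refine tsum_congr fun q => ?_
    rw [Set.indicator_indicator, lintegral_indicator_one ((measurableSet_cycleEvent k q).inter hS)]
  rw [hsum _ (hj.inter (measurableSet_respEvent k γ (j + n))), hsum _ hj, ← ENNReal.tsum_mul_right]
  refine tsum_congr fun q => ?_
  by_cases hq : q.2 k = j
  · have h1 : cycleEvent k q ∩ {v | cycleCount k (nominalPath k v) = j} = cycleEvent k q :=
      Set.inter_eq_left.2 fun v hv => (cycleCount_of_mem_cycleEvent hv).trans hq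
    rw [← Set.inter_assoc, h1, ← hq, measure_cycleEvent_inter hlam hmu hstable]
  · have h1 : cycleEvent k q ∩ {v | cycleCount k (nominalPath k v) = j} = ∅ :=
      Set.eq_empty_of_forall_notMem fun v hv =>
        hq ((cycleCount_of_mem_cycleEvent hv.1).symm.trans hv.2)
    rw [← Set.inter_assoc, h1, Set.empty_inter, measure_empty, zero_mul]

/-- The renewal equation for the tail probabilities of the response times. -/
theorem measureReal_respEvent (hlam : ∀ l, 0 < lam l) (hmu : ∀ l, 0 < mu l)
    (hstable : ∑ l, lam l / mu l < 1) (k : Fin K) (γ : ℝ) (n : ℕ) :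
    (nominalLaw lam mu).real (respEvent k γ n) = (nominalLaw lam mu).real (lateEvent k γ n)
      + ∑ j ∈ Finset.range (n + 1), (nominalLaw lam mu).real {v | cycleCount k (nominalPath k v) = j}
        * (nominalLaw lam mu).real (respEvent k γ (n - j)) := by
  have := isProbabilityMeasure_nominalLaw hlam hmu
  have hr := measurableSet_respEvent (K := K) k γ n
  rw [← measureReal_inter_add_sdiff (measurableSet_lt_cycleCount k n)]
  congr 1
  · rw [Set.inter_comm]; rfl
  -- If job `n` is not in the first cycle, then that cycle has some `j ≤ n` class-`k` jobs, possibly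
  -- none, and the job has index `n - j` in the restarted system.
  · have : respEvent k γ n \ {v | n < cycleCount k (nominalPath k v)}
        = ⋃ j ∈ Finset.range (n + 1),
          {v | cycleCount k (nominalPath k v) = j} ∩ respEvent k γ n := by
      ext v
      simp only [Set.mem_sdiff, Set.mem_ofPred_eq, not_lt, Set.mem_iUnion, Finset.mem_range,
        Set.mem_inter_iff, exists_and_left, exists_prop, Nat.lt_succ_iff]
      constructor
      · rintro ⟨h1, h2⟩; exact ⟨_, rfl, h2, h1⟩
      · rintro ⟨j, rfl, h1, h3⟩; exact ⟨h3, h1⟩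
    rw [this, measureReal_biUnion_finset]
    · refine Finset.sum_congr rfl fun j hj => ?_
      obtain ⟨i, rfl⟩ := Nat.exists_eq_add_of_le (Nat.lt_succ_iff.1 (Finset.mem_range.1 hj))
      rw [Nat.add_sub_cancel_left, measureReal_def, measure_cycleCount_eq_inter hlam hmu hstable,
        ENNReal.toReal_mul]
      rfl
    · intro i _ j _ hij
      refine Set.disjoint_left.2 fun v h1 h2 => hij ?_
      exact h1.1.symm.trans h2.1
    · exact fun j _ => (measurableSet_cycleCount_eq k j).inter hr

lemma tsum_measure_lt_cycleCount (k : Fin K) :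
    ∑' i, nominalLaw lam mu {v | i < cycleCount k (nominalPath k v)}
      = ∫⁻ v, (cycleCount k (nominalPath k v) : ENNReal) ∂nominalLaw lam mu := by
  have h : ∀ v : Drive K, (cycleCount k (nominalPath k v) : ENNReal)
      = ∑' i, {v | i < cycleCount k (nominalPath k v)}.indicator 1 v := fun v => by
    rw [tsum_eq_sum (s := Finset.range (cycleCount k (nominalPath k v)))]
    · rw [Finset.sum_congr rfl fun i hi => Set.indicator_of_mem
        (show v ∈ {v | i < cycleCount k (nominalPath k v)} from Finset.mem_range.1 hi) _]
      simp
    · exact fun i hi => Set.indicator_of_notMem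
        (s := {v | i < cycleCount k (nominalPath k v)}) (fun h => hi (Finset.mem_range.2 h)) _
  simp only [h]
  rw [lintegral_tsum fun i =>
    (measurable_one.indicator (measurableSet_lt_cycleCount k i)).aemeasurable]
  exact tsum_congr fun i => (lintegral_indicator_one (measurableSet_lt_cycleCount k i)).symm

/-- The regenerative representation of the steady state. -/
theorem tsum_measure_lateEvent (hlam : ∀ l, 0 < lam l) (hmu : ∀ l, 0 < mu l)
    (hstable : ∑ l, lam l / mu l < 1) (k : Fin K) (γ : ℝ) {c : ℝ}
    (hi : Integrable (fun v => (cycleCount k (nominalPath k v) : ℝ)) (nominalLaw lam mu))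
    (hc : Tendsto (fun n => (nominalLaw lam mu).real (respEvent k γ n)) atTop (𝓝 c)) :
    ∑' n, nominalLaw lam mu (lateEvent k γ n)
      = ENNReal.ofReal (c * ∫ v, (cycleCount k (nominalPath k v) : ℝ) ∂nominalLaw lam mu) := by
  have := isProbabilityMeasure_nominalLaw hlam hmu
  set G : ℕ → ℝ := fun i => (nominalLaw lam mu).real {v | i < cycleCount k (nominalPath k v)}
    with hG
  -- The tails of α sum to its mean, so integrability of α is the summability needed for dominated
  -- convergence.
  have hfin : ∑' i, nominalLaw lam mu {v | i < cycleCount k (nominalPath k v)} ≠ ⊤ := by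
    rw [tsum_measure_lt_cycleCount]
    have := hi.2.ne
    simpa [HasFiniteIntegral, enorm] using this
  have hsum : Summable G := ENNReal.summable_toReal hfin
  have htsum : ∑' i, G i = ∫ v, (cycleCount k (nominalPath k v) : ℝ) ∂nominalLaw lam mu := by
    rw [integral_eq_lintegral_of_nonneg_ae (Eventually.of_forall fun v => Nat.cast_nonneg _)
      hi.aestronglyMeasurable]
    simp only [ENNReal.ofReal_natCast]
    rw [← tsum_measure_lt_cycleCount, ENNReal.tsum_toReal_eq fun i => measure_ne_top _ _]
    rfl
  have hG0 : G 0 = 1 - (nominalLaw lam mu).real {v | cycleCount k (nominalPath k v) = 0} := by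
    rw [← probReal_compl_eq_one_sub (measurableSet_cycleCount_eq k 0)]
    exact congrArg (nominalLaw lam mu).real (Set.ext fun v => Nat.pos_iff_ne_zero)
  have hG1 : ∀ i, G (i + 1)
      = G i - (nominalLaw lam mu).real {v | cycleCount k (nominalPath k v) = i + 1} := fun i => by
    have hsub : {v : Drive K | cycleCount k (nominalPath k v) = i + 1}
        ⊆ {v | i < cycleCount k (nominalPath k v)} := fun v hv => by
      simp only [Set.mem_ofPred_eq] at hv ⊢; omega
    rw [← measureReal_sdiff hsub (measurableSet_cycleCount_eq k (i + 1))]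
    refine congrArg (nominalLaw lam mu).real (Set.ext fun v => ?_)
    simp only [Set.mem_sdiff, Set.mem_ofPred_eq]
    omega
  have h := hasSum_of_renewal (C := 1) hG0 hG1 (measureReal_respEvent hlam hmu hstable k γ)
    (fun n => measureReal_nonneg) (fun n => by
      rw [abs_of_nonneg measureReal_nonneg]; exact measureReal_le_one)
    (fun i => measureReal_nonneg) hsum hc
  rw [← htsum, ← h.tsum_eq, ENNReal.ofReal_tsum_of_nonneg (fun n => measureReal_nonneg) h.summable]
  exact tsum_congr fun n => (ofReal_measureReal).symm

end PriorityQueue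
end

noncomputable section
namespace PriorityQueue
variable {K : ℕ}

/-! ### Events of positive probability -/

/-- A single inter-arrival or service time. -/
def coordOf (v : Drive K) (j : Coord K) : ℝ :=
  if j.2.2 then (v j.1 j.2.1).1 else (v j.1 j.2.1).2

lemma coordOf_assemble (x : Coord K → ℝ) (j : Coord K) : coordOf (assemble x) j = x j := by
  obtain ⟨l, n, b⟩ := j
  cases b <;> rfl

lemma measurable_coordOf (j : Coord K) : Measurable fun v : Drive K => coordOf v j := by
  have h := measurable_entry (measurable_id (α := Drive K)) j.1 (n := fun _ => j.2.1)
    measurable_const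
  unfold coordOf
  split_ifs
  exacts [h.fst, h.snd]

variable {gA gS : Fin K → ℝ → ℝ} {lam mu : Fin K → ℝ}

lemma driveLaw_box (hgA : ∀ l, IsSamplingDensity (gA l)) (hgS : ∀ l, IsSamplingDensity (gS l))
    (J : Finset (Coord K)) {s : Coord K → Set ℝ} (hs : ∀ j, MeasurableSet (s j)) :
    driveLaw gA gS {v | ∀ j ∈ J, coordOf v j ∈ s j} = ∏ j ∈ J, coordLaw gA gS j (s j) := by
  have := isProbabilityMeasure_coordLaw hgA hgS
  have hm : MeasurableSet {v : Drive K | ∀ j ∈ J, coordOf v j ∈ s j} := by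
    have : {v : Drive K | ∀ j ∈ J, coordOf v j ∈ s j}
        = ⋂ j ∈ J, (fun v => coordOf v j) ⁻¹' s j := by
      ext v; simp
    rw [this]
    exact Finset.measurableSet_biInter J fun j _ => measurable_coordOf j (hs j)
  rw [← map_assemble hgA hgS, Measure.map_apply measurable_assemble hm,
    ← Measure.infinitePi_pi (coordLaw gA gS) fun j _ => hs j]
  congr 1
  ext x
  simp [coordOf_assemble]

lemma nominalLaw_box_ne_zero (hlam : ∀ l, 0 < lam l) (hmu : ∀ l, 0 < mu l)
    (J : Finset (Coord K)) {a : Coord K → ℝ} (ha : ∀ j, 0 ≤ a j) :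
    nominalLaw lam mu {v | ∀ j ∈ J, coordOf v j ∈ Set.Ioo (a j) (a j + 1)} ≠ 0 := by
  rw [nominalLaw, driveLaw_box (gA := expDensity lam) (gS := expDensity mu)
    (fun l => isSamplingDensity_exp (hlam l)) (fun l => isSamplingDensity_exp (hmu l)) J
    fun _ => measurableSet_Ioo]
  refine Finset.prod_ne_zero_iff.2 fun j _ => ?_
  unfold coordLaw
  split_ifs
  · exact (isSamplingDensity_exp (hlam _)).Ioo_ne_zero (ha j) (lt_add_one _)
  · exact (isSamplingDensity_exp (hmu _)).Ioo_ne_zero (ha j) (lt_add_one _)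

/-- The queue after the first arrival, if that is of class `k`. -/
lemma run_one (k : Fin K) {v : Drive K} (h : ∀ l, l ≠ k → (v k 0).1 < (v l 0).1) :
    Core.run k v 1 =
      { time := (v k 0).1
        arr := Function.update (fun _ => 0) k 1
        next := Function.update (fun l => (v l 0).1) k ((v k 0).1 + (v k 1).1)
        ent := Function.update (fun _ => 0) k 1
        dep := some ((v k 0).1 + (v k 0).2) } := by
  refine Core.step_eq_of_event k v _ _ (Core.Event.arriveIdle (c := Core.start v) k ⟨fun j => ?_, fun j hj =>
    h j hj.ne⟩ rfl)
  rcases eq_or_ne j k with rfl | hj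
  · exact le_rfl
  · exact (h j hj).le

lemma sInf_lt_coord {f : ℕ → ℕ} (h0 : f 0 = 0) (h1 : f 1 = 1) : sInf {j | 0 < f j} = 1 := by
  refine le_antisymm (Nat.sInf_le (by simp [h1])) ?_
  rw [Nat.one_le_iff_ne_zero]
  intro h
  have : sInf {j | 0 < f j} ∈ {j | 0 < f j} := Nat.sInf_mem ⟨1, by simp [h1]⟩
  rw [h] at this
  simp [h0] at this

lemma resp_zero (k : Fin K) {v : Drive K} (h : ∀ l, l ≠ k → (v k 0).1 < (v l 0).1) :
    resp k (Core.run k v) 0 = (v k 0).2 := by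
  have h1 := run_one k h
  have e1 : sInf {j | 0 < (Core.run k v j).ent k} = 1 := sInf_lt_coord rfl (by simp [h1])
  have e2 : sInf {j | 0 < (Core.run k v j).arr k} = 1 := sInf_lt_coord rfl (by simp [h1])
  rw [resp, e1, e2, h1]
  simp

lemma inCycle_zero (k : Fin K) {v : Drive K} (h : ∀ l, l ≠ k → (v k 0).1 < (v l 0).1) :
    InCycle k (Core.run k v) 0 := by
  refine ⟨1, by simp [run_one k h], fun i h0 hi => ?_⟩
  obtain rfl : i = 1 := by omega
  simp [run_one k h]

lemma measure_inter_ne_zero_of_ae {α : Type*} [MeasurableSpace α] {μ : Measure α} {B : Set α}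
    {p q : α → Prop} (hB : μ B ≠ 0) (hp : ∀ᵐ x ∂μ, p x) (h : ∀ x ∈ B, p x → q x) :
    μ {x | q x} ≠ 0 := fun h0 => hB <| measure_mono_null_ae (by
  filter_upwards [hp] with x hx hxB using h x hxB hx) h0

/-- The times that determine the beginning of the first cycle. -/
def firstCoords (k : Fin K) : Finset (Coord K) :=
  (Finset.univ.image fun l => (l, 0, true)) ∪ {(k, 0, false), (k, 1, true)}

lemma measure_cycleCount_eq_one (hlam : ∀ l, 0 < lam l) (hmu : ∀ l, 0 < mu l) (k : Fin K) :
    nominalLaw lam mu {v | cycleCount k (nominalPath k v) = 1} ≠ 0 := by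
  -- Each listed time falls in a unit interval: the first class-k job arrives and is served within
  -- time 2, and every other arrival comes after time 2.
  have hbox := nominalLaw_box_ne_zero hlam hmu (firstCoords k)
    (a := fun j => if j = (k, 0, true) ∨ j = (k, 0, false) then 0 else 2)
    (fun j => by split_ifs <;> norm_num)
  refine measure_inter_ne_zero_of_ae hbox (ae_pos_driveLaw
    (fun l => isSamplingDensity_exp (hlam l)) (fun l => isSamplingDensity_exp (hmu l)))
    fun v hv hp => ?_
  have h1 : (v k 0).1 < 1 := by
    simpa [coordOf] using (hv (k, 0, true) (by simp [firstCoords])).2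
  have h2 : (v k 0).2 < 1 := by
    simpa [coordOf] using (hv (k, 0, false) (by simp [firstCoords])).2
  have h3 : 2 < (v k 1).1 := by
    simpa [coordOf] using (hv (k, 1, true) (by simp [firstCoords])).1
  have h4 : ∀ l, l ≠ k → 2 < (v l 0).1 := fun l hl => by
    simpa [coordOf, hl] using (hv (l, 0, true) (by simp [firstCoords])).1
  have hr := run_one k fun l hl => (h1.trans one_lt_two).trans (h4 l hl)
  have hr2 := Core.step_eq_of_event k v _ _ (Core.Event.departIdle (c := Core.run k v 1)
    ((v k 0).1 + (v k 0).2) (by rw [hr]) (fun j => ?_) (fun l => by rw [hr]))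
  · have hm : v ∈ cycleEvent k (2, (Core.run k v 1).arr) := by
      change Core.run k v 2 = _ at hr2
      refine ⟨⟨hp, ⟨two_pos, by rw [hr2]⟩, fun i hi h => ?_⟩, by rw [hr2]⟩
      obtain rfl : i = 1 := by have := h.1; dsimp only at hi; omega
      rw [hr] at h
      simp at h
    rw [cycleCount_of_mem_cycleEvent hm, hr]
    simp
  · rw [hr]
    rcases eq_or_ne j k with rfl | hj
    · simp; linarith
    · simp [hj]; linarith [h4 j hj]

lemma measure_one_lt_cycleCount (hlam : ∀ l, 0 < lam l) (hmu : ∀ l, 0 < mu l)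
    (hstable : ∑ l, lam l / mu l < 1) (k : Fin K) :
    nominalLaw lam mu {v | 1 < cycleCount k (nominalPath k v)} ≠ 0 := by
  -- Now the second class-k job arrives within time 2, while the first one needs more than 2 time
  -- units of service; the other classes arrive after time 2.
  have hbox := nominalLaw_box_ne_zero hlam hmu (firstCoords k)
    (a := fun j => if j = (k, 0, true) ∨ j = (k, 1, true) then 0 else 2)
    (fun j => by split_ifs <;> norm_num)
  refine measure_inter_ne_zero_of_ae hbox (ae_good hlam hmu) fun v hv hg => ?_
  have h1 : (v k 0).1 < 1 := by
    simpa [coordOf] using (hv (k, 0, true) (by simp [firstCoords])).2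
  have h2 : 2 < (v k 0).2 := by
    simpa [coordOf] using (hv (k, 0, false) (by simp [firstCoords])).1
  have h3 : (v k 1).1 < 1 := by
    simpa [coordOf] using (hv (k, 1, true) (by simp [firstCoords])).2
  have h4 : ∀ l, l ≠ k → 2 < (v l 0).1 := fun l hl => by
    simpa [coordOf, hl] using (hv (l, 0, true) (by simp [firstCoords])).1
  have h5 := (hg.pos k 0).1
  have hr := run_one k fun l hl => (h1.trans one_lt_two).trans (h4 l hl)
  have hlt : ∀ j, j ≠ k → (Core.run k v 1).next k < (Core.run k v 1).next j := fun j hj => by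
    rw [hr]; simp [hj]; linarith [h4 j hj]
  have hr2 := Core.step_eq_of_event k v _ _ (Core.Event.arriveBusy (c := Core.run k v 1) k
    ((v k 0).1 + (v k 0).2) ⟨fun j => ?_, fun j hj => hlt j hj.ne⟩ (by rw [hr])
    (by rw [hr]; simp; linarith))
  · change Core.run k v 2 = _ at hr2
    obtain ⟨q, hq⟩ := hg.exists_mem_cycleEvent hlam hstable k
    have hq1 : 2 ≤ q.1 := by
      obtain ⟨⟨-, h6, -⟩, -⟩ := hq
      by_contra hlt
      have : q.1 = 1 := by omega
      rw [this, hr] at h6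
      simp at h6
    show 1 < cycleCount k (nominalPath k v)
    rw [cycleCount_of_mem_cycleEvent hq, ← hq.2]
    refine lt_of_lt_of_le ?_ (Core.arr_mono k v k hq1)
    simp only [hr2, hr]
    simp
  · rcases eq_or_ne j k with rfl | hj
    · exact le_rfl
    · exact (hlt j hj).le

/-- A lower bound on the density of the response time of the first job. -/
lemma exists_le_measure_lateEvent_sdiff (hlam : ∀ l, 0 < lam l) (hmu : ∀ l, 0 < mu l)
    (hstable : ∑ l, lam l / mu l < 1) (k : Fin K) (B : ℝ) :
    ∃ c : ℝ, 0 < c ∧ ∀ a b : ℝ, 0 ≤ a → b ≤ B →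
      ENNReal.ofReal (c * (b - a)) ≤ nominalLaw lam mu (lateEvent k a 0 \ lateEvent k b 0) := by
  have hA : ∀ l, IsSamplingDensity (expDensity lam l) := fun l => isSamplingDensity_exp (hlam l)
  have hS : ∀ l, IsSamplingDensity (expDensity mu l) := fun l => isSamplingDensity_exp (hmu l)
  have := isProbabilityMeasure_nominalLaw hlam hmu
  have := isProbabilityMeasure_coordLaw hA hS
  set J : Finset (Coord K) := Finset.univ.image fun l => (l, 0, true) with hJ
  set lo : Coord K → ℝ := fun j => if j = (k, 0, true) then 0 else 1 with hlo
  set C := ∏ j ∈ J, coordLaw (expDensity lam) (expDensity mu) j (Set.Ioo (lo j) (lo j + 1)) with hC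
  have hC0 : C ≠ 0 := Finset.prod_ne_zero_iff.2 fun j _ => by
    have : 0 ≤ lo j := by simp only [hlo]; split_ifs <;> norm_num
    unfold coordLaw
    split_ifs
    exacts [(hA _).Ioo_ne_zero this (lt_add_one _), (hS _).Ioo_ne_zero this (lt_add_one _)]
  have hCt : C ≠ ⊤ := ENNReal.prod_ne_top fun j _ => measure_ne_top _ _
  -- The exponential density is decreasing, so on levels up to `B` its value at `B` is a lower
  -- bound. The factor `C` is the probability that class `k` arrives before time 1 and the other
  -- classes after it.
  have hdens : ∀ a b : ℝ, 0 ≤ a → b ≤ B → ENNReal.ofReal (mu k * Real.exp (-(mu k * B)) * (b - a))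
      ≤ densityLaw (expDensity mu k) (Set.Ioo a b) := fun a b ha hb => by
    rw [densityLaw, withDensity_apply _ measurableSet_Ioo]
    calc ENNReal.ofReal (mu k * Real.exp (-(mu k * B)) * (b - a))
        = ∫⁻ _ in Set.Ioo a b, ENNReal.ofReal (mu k * Real.exp (-(mu k * B))) := by
          rw [setLIntegral_const, Real.volume_Ioo, ENNReal.ofReal_mul
            (mul_nonneg (hmu k).le (Real.exp_pos _).le)]
      _ ≤ _ := by
          refine setLIntegral_mono (hS k).measurable.ennreal_ofReal fun x hx => ?_
          refine ENNReal.ofReal_le_ofReal ?_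
          rw [expDensity, exponentialPDFReal_eq (ha.trans hx.1.le)]
          have := hmu k
          have := hx.2.le.trans hb
          gcongr
  refine ⟨C.toReal * (mu k * Real.exp (-(mu k * B))), mul_pos (ENNReal.toReal_pos hC0 hCt)
    (mul_pos (hmu k) (Real.exp_pos _)), fun a b ha hb => ?_⟩
  have hk : (k, 0, false) ∉ J := by simp [hJ]
  set s : Coord K → Set ℝ := fun j => if j = (k, 0, false) then Set.Ioo a b
    else Set.Ioo (lo j) (lo j + 1) with hs
  have hbox := driveLaw_box hA hS (insert (k, 0, false) J) (s := s)
    (fun j => by simp only [hs]; split_ifs <;> exact measurableSet_Ioo)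
  rw [Finset.prod_insert hk] at hbox
  have hprod : ∏ j ∈ J, coordLaw (expDensity lam) (expDensity mu) j (s j) = C :=
    Finset.prod_congr rfl fun j hj => by
      simp only [hs]
      rw [if_neg (by rintro rfl; exact hk hj)]
  calc ENNReal.ofReal (C.toReal * (mu k * Real.exp (-(mu k * B))) * (b - a))
      = ENNReal.ofReal (mu k * Real.exp (-(mu k * B)) * (b - a)) * C := by
        rw [mul_assoc, mul_comm, ENNReal.ofReal_mul' ENNReal.toReal_nonneg,
          ENNReal.ofReal_toReal hCt]
    _ ≤ densityLaw (expDensity mu k) (Set.Ioo a b) * C := by gcongr; exact hdens a b ha hb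
    _ = nominalLaw lam mu {v | ∀ j ∈ insert (k, 0, false) J, coordOf v j ∈ s j} := by
        rw [nominalLaw, hbox, hprod]
        simp [hs, coordLaw]
    _ ≤ _ := by
        refine measure_mono_ae ?_
        filter_upwards [ae_good hlam hmu] with v hg hv
        have h1 : (v k 0).1 < 1 := by
          have := hv (k, 0, true) (Finset.mem_insert_of_mem (by simp [hJ]))
          simp only [hs, hlo, coordOf, if_true, Prod.mk.injEq, and_false, Bool.true_eq_false,
            if_false] at this
          simpa using this.2
        have h2 : (v k 0).2 ∈ Set.Ioo a b := by
          simpa [coordOf, hs] using hv (k, 0, false) (Finset.mem_insert_self _ _)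
        have h4 : ∀ l, l ≠ k → 1 < (v l 0).1 := fun l hl => by
          have := hv (l, 0, true) (Finset.mem_insert_of_mem (by simp [hJ]))
          simp only [hs, hlo, coordOf, if_true, Prod.mk.injEq, and_false, Bool.true_eq_false,
            if_false, hl, false_and] at this
          exact this.1
        have h5 : ∀ l, l ≠ k → (v k 0).1 < (v l 0).1 := fun l hl => h1.trans (h4 l hl)
        have hr := resp_zero k h5
        refine ⟨(hg.mem_lateEvent hlam hstable).2 ⟨inCycle_zero k h5, by rw [hr]; exact h2.1⟩,
          fun h => ?_⟩
        have := ((hg.mem_lateEvent hlam hstable).1 h).2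
        rw [hr] at this
        exact absurd h2.2 (not_lt.2 this.le)

lemma lateEvent_antitone (k : Fin K) (n : ℕ) : Antitone fun γ => lateEvent k γ n :=
  fun _ _ h _ hv => ⟨hv.1, h.trans_lt hv.2⟩

/-- Strict monotonicity of the expected number of late jobs per cycle. -/
theorem exists_tsum_lateEvent_add_le (hlam : ∀ l, 0 < lam l) (hmu : ∀ l, 0 < mu l)
    (hstable : ∑ l, lam l / mu l < 1) (k : Fin K) (B : ℝ) :
    ∃ c : ℝ, 0 < c ∧ ∀ a b : ℝ, 0 ≤ a → a ≤ b → b ≤ B →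
      ∑' n, nominalLaw lam mu (lateEvent k b n) + ENNReal.ofReal (c * (b - a))
        ≤ ∑' n, nominalLaw lam mu (lateEvent k a n) := by
  obtain ⟨c, hc, h⟩ := exists_le_measure_lateEvent_sdiff hlam hmu hstable k B
  refine ⟨c, hc, fun a b ha hab hb => ?_⟩
  -- The whole increment is charged to the job with index 0; the other terms are merely monotone in
  -- the level.
  rw [← tsum_ite_eq (0 : ℕ) (fun _ => ENNReal.ofReal (c * (b - a))), ← ENNReal.tsum_add]
  refine ENNReal.tsum_le_tsum fun n => ?_
  split_ifs with hn
  · subst hn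
    calc _ ≤ nominalLaw lam mu (lateEvent k b 0)
          + nominalLaw lam mu (lateEvent k a 0 \ lateEvent k b 0) := by
          gcongr; exact h a b ha hb
      _ = _ := by
          rw [measure_add_sdiff (measurableSet_lateEvent k b 0).nullMeasurableSet,
            Set.union_eq_right.2 (lateEvent_antitone k 0 hab)]
  · rw [add_zero]
    exact measure_mono (lateEvent_antitone k n hab)

end PriorityQueue
end

noncomputable section
namespace PriorityQueue

/-! ### Limit theorems -/

section Limits

variable {Ω : Type*} [MeasurableSpace Ω] {P : Measure Ω} [IsProbabilityMeasure P]

/-- Convergence of distribution functions from convergence on sets between `{T < x}` and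
`{T ≤ x}`. -/
lemma tendsto_measureReal_le_of_sandwich {T : ℕ → Ω → ℝ} {η : Measure ℝ} [IsProbabilityMeasure η]
    {A : ℝ → ℕ → Set Ω} (h1 : ∀ x, ∀ᶠ m in atTop, {ω | T m ω < x} ⊆ A x m)
    (h2 : ∀ x, ∀ᶠ m in atTop, A x m ⊆ {ω | T m ω ≤ x})
    (h3 : ∀ x, Tendsto (fun m => P.real (A x m)) atTop (𝓝 (cdf η x))) (x : ℝ) :
    Tendsto (fun m => P.real {ω | T m ω ≤ x}) atTop (𝓝 (cdf η x)) := by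
  refine tendsto_order.2 ⟨fun a ha => ?_, fun a ha => ?_⟩
  · filter_upwards [(h3 x).eventually_const_lt ha, h2 x] with m hm1 hm2
    exact hm1.trans_le (measureReal_mono hm2)
  -- The upper bound uses the set at a slightly larger level `y`, at a cost controlled by right
  -- continuity.
  · have hr : Tendsto (cdf η) (𝓝[>] x) (𝓝 (cdf η x)) :=
      ((cdf η).right_continuous x).tendsto.mono_left
        (nhdsWithin_mono _ Set.Ioi_subset_Ici_self)
    obtain ⟨y, hy, hxy⟩ := ((hr.eventually_lt_const ha).and self_mem_nhdsWithin).exists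
    have hxy' : x < y := hxy
    filter_upwards [(h3 y).eventually_lt_const hy, h1 y] with m hm1 hm2
    exact (measureReal_mono (fun ω (hω : T m ω ≤ x) => hm2 (hω.trans_lt hxy'))).trans_lt hm1

/-- Convergence of distribution functions implies convergence in distribution. -/
theorem tendstoInDistribution_of_tendsto_cdf {T : ℕ → Ω → ℝ} (hT : ∀ m, AEMeasurable (T m) P)
    {η : Measure ℝ} [IsProbabilityMeasure η]
    (h : ∀ x, Tendsto (fun m => P.real {ω | T m ω ≤ x}) atTop (𝓝 (cdf η x))) :
    TendstoInDistribution T atTop id (fun _ => P) η where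
  forall_aemeasurable := hT
  aemeasurable_limit := aemeasurable_id
  tendsto := by
    -- Half-open intervals are stable under intersection and contain neighbourhoods at every scale,
    -- and their masses are differences of distribution functions.
    set S : Set (Set ℝ) := {s | ∃ a b : ℝ, s = Set.Ioc a b} with hS
    have hpi : IsPiSystem S := by
      rintro _ ⟨a, b, rfl⟩ _ ⟨a', b', rfl⟩ -
      exact ⟨_, _, Set.Ioc_inter_Ioc⟩
    refine hpi.tendsto_probabilityMeasure_of_tendsto_of_mem ?_ ?_ ?_
    · rintro _ ⟨a, b, rfl⟩
      exact measurableSet_Ioc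
    · intro u hu x hx
      obtain ⟨ε, hε, hball⟩ := Metric.isOpen_iff.1 hu x hx
      refine ⟨Set.Ioc (x - ε / 2) (x + ε / 2), ⟨_, _, rfl⟩,
        Ioc_mem_nhds (by linarith) (by linarith), fun y hy => hball ?_⟩
      rw [Metric.mem_ball, Real.dist_eq, abs_lt]
      constructor <;> linarith [hy.1, hy.2]
    · rintro _ ⟨a, b, rfl⟩
      have key : ∀ (κ : Measure ℝ) [IsProbabilityMeasure κ], κ.real (Set.Ioc a b)
          = cdf κ (max a b) - cdf κ a := fun κ _ => by
        rcases le_total a b with hab | hab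
        · rw [max_eq_right hab, cdf_eq_real, cdf_eq_real, ← Set.Iic_sdiff_Iic,
            measureReal_sdiff (Set.Iic_subset_Iic.2 hab) measurableSet_Iic]
        · rw [max_eq_left hab, Set.Ioc_eq_empty (not_lt.2 hab), measureReal_empty, sub_self]
      have hc : ∀ m x, cdf (P.map (T m)) x = P.real {ω | T m ω ≤ x} := fun m x => by
        have := Measure.isProbabilityMeasure_map (μ := P) (hT m)
        rw [cdf_eq_real, map_measureReal_apply_of_aemeasurable (hT m) measurableSet_Iic]
        rfl
      rw [← NNReal.tendsto_coe]
      have hmap : ∀ m, IsProbabilityMeasure (P.map (T m)) := fun m =>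
        Measure.isProbabilityMeasure_map (hT m)
      have e1 : Tendsto (fun m => (P.map (T m)).real (Set.Ioc a b)) atTop
          (𝓝 (η.real (Set.Ioc a b))) := by
        simp only [key, hc]
        exact (h _).sub (h _)
      have hid : (η.map id).real (Set.Ioc a b) = η.real (Set.Ioc a b) := by rw [Measure.map_id]
      rw [← hid] at e1
      exact e1

/-- A sequence that converges in distribution is bounded in probability. -/
theorem tendstoInMeasure_mul_of_tendsto_cdf {T : ℕ → Ω → ℝ} (hT : ∀ m, AEMeasurable (T m) P)
    {η : Measure ℝ} [IsProbabilityMeasure η]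
    (h : ∀ x, Tendsto (fun m => P.real {ω | T m ω ≤ x}) atTop (𝓝 (cdf η x))) {a : ℕ → ℝ}
    (ha : Tendsto a atTop (𝓝 0)) :
    TendstoInMeasure P (fun m ω => a m * T m ω) atTop (fun _ => 0) := by
  rw [tendstoInMeasure_iff_measureReal_norm]
  intro ε hε
  refine tendsto_order.2 ⟨fun b hb => Eventually.of_forall fun m => hb.trans_le measureReal_nonneg,
    fun δ hδ => ?_⟩
  have hlim : Tendsto (fun M : ℝ => cdf η (-M) + (1 - cdf η M)) atTop (𝓝 (0 + (1 - 1))) :=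
    ((tendsto_cdf_atBot η).comp tendsto_neg_atTop_atBot).add
      (tendsto_const_nhds.sub (tendsto_cdf_atTop η))
  -- `M` bounds the limit mass outside the interval from -M to M by `δ`; on the complement the
  -- product is below `ε` as soon as |a m| M is.
  obtain ⟨M, hM, hM0⟩ := ((hlim.eventually_lt_const (by linarith)).and
    (eventually_gt_atTop (0 : ℝ))).exists
  have hMa : ∀ᶠ m in atTop, |a m| * M < ε := by
    have := ha.abs.mul_const M
    rw [abs_zero, zero_mul] at this
    exact this.eventually_lt_const hε
  have hm := ((h (-M)).add ((h M).const_sub 1)).eventually_lt_const hM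
  filter_upwards [hMa, hm] with m h1 h2
  refine lt_of_le_of_lt ?_ h2
  have hnull : NullMeasurableSet {ω | T m ω ≤ M} P :=
    nullMeasurableSet_le (hT m) aemeasurable_const
  rw [← probReal_compl_eq_one_sub₀ hnull]
  refine (measureReal_mono fun ω hω => ?_).trans (measureReal_union_le _ _)
  by_contra hcon
  simp only [Set.mem_union, Set.mem_ofPred_eq, Set.mem_compl_iff, not_or, not_le] at hcon
  have hω' : ε ≤ ‖a m * T m ω - 0‖ := hω
  rw [sub_zero, norm_mul, Real.norm_eq_abs, Real.norm_eq_abs] at hω'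
  have : |T m ω| ≤ M := abs_le.2 ⟨hcon.1.le, not_lt.1 hcon.2⟩
  linarith [mul_le_mul_of_nonneg_left this (abs_nonneg (a m))]

variable {𝒱 : Type*} [MeasurableSpace 𝒱] {μ : Measure 𝒱} [IsProbabilityMeasure μ]
  {V : ℕ → Ω → 𝒱}

lemma memLp_comp_of_hasLaw {X : Ω → 𝒱} (hX : HasLaw X μ P) {f : 𝒱 → ℝ} {p : ENNReal}
    (hf : MemLp f p μ) : MemLp (fun ω => f (X ω)) p P := by
  rw [← hX.map_eq] at hf
  exact hf.comp_of_map hX.aemeasurable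

lemma variance_comp_of_hasLaw {X : Ω → 𝒱} (hX : HasLaw X μ P) {f : 𝒱 → ℝ}
    (hf : Measurable f) : variance (fun ω => f (X ω)) P = variance f μ := by
  rw [← hX.map_eq, variance_map hf.aemeasurable hX.aemeasurable]
  rfl

lemma integral_comp_of_hasLaw {X : Ω → 𝒱} (hX : HasLaw X μ P) {f : 𝒱 → ℝ}
    (hf : Measurable f) : ∫ ω, f (X ω) ∂P = ∫ x, f x ∂μ :=
  hX.integral_comp hf.aestronglyMeasurable

/-- Normalized sums of i.i.d. centered random variables with vanishing second moments. -/
lemma tendstoInMeasure_sum_div_sqrt (hV : ∀ i, HasLaw (V i) μ P) (hind : iIndepFun V P)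
    {f : ℕ → 𝒱 → ℝ} (hf : ∀ m, Measurable (f m)) (h2 : ∀ᶠ m in atTop, MemLp (f m) 2 μ)
    (h0 : ∀ᶠ m in atTop, ∫ x, f m x ∂μ = 0)
    (hlim : Tendsto (fun m => ∫ x, f m x ^ 2 ∂μ) atTop (𝓝 0)) :
    TendstoInMeasure P (fun (m : ℕ) ω => (√(m : ℝ))⁻¹ * ∑ i ∈ Finset.range m, f m (V i ω)) atTop
      (fun _ => 0) := by
  rw [tendstoInMeasure_iff_norm]
  intro ε hε
  have hb : Tendsto (fun m => ENNReal.ofReal ((∫ x, f m x ^ 2 ∂μ) / ε ^ 2)) atTop (𝓝 0) := by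
    rw [← ENNReal.ofReal_zero]
    refine ENNReal.tendsto_ofReal ?_
    simpa using hlim.div_const (ε ^ 2)
  refine tendsto_of_tendsto_of_tendsto_of_le_of_le' tendsto_const_nhds hb
    (Eventually.of_forall fun _ => bot_le) ?_
  filter_upwards [h2, h0, eventually_gt_atTop 0] with m hm2 hm0 hm
  have hmpos : (0 : ℝ) < m := by exact_mod_cast hm
  have hL : ∀ i, MemLp (fun ω => f m (V i ω)) 2 P := fun i => memLp_comp_of_hasLaw (hV i) hm2
  have hS : MemLp (fun ω => (√(m : ℝ))⁻¹ * ∑ i ∈ Finset.range m, f m (V i ω)) 2 P :=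
    (memLp_finsetSum _ fun i _ => hL i).const_mul _
  have hE : ∫ ω, (√(m : ℝ))⁻¹ * ∑ i ∈ Finset.range m, f m (V i ω) ∂P = 0 := by
    rw [integral_const_mul, integral_finsetSum _ fun i _ => (hL i).integrable one_le_two]
    simp only [integral_comp_of_hasLaw (hV _) (hf m), hm0, Finset.sum_const_zero, mul_zero]
  have hvar : variance (fun ω => (√(m : ℝ))⁻¹ * ∑ i ∈ Finset.range m, f m (V i ω)) P
      = ∫ x, f m x ^ 2 ∂μ := by
    have hs := IndepFun.variance_sum (μ := P) (X := fun i ω => f m (V i ω)) (s := Finset.range m)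
      (fun i _ => hL i) (fun i _ j _ hij =>
        (hind.indepFun hij).comp (hf m) (hf m))
    have hs' : variance (fun ω => ∑ i ∈ Finset.range m, f m (V i ω)) P
        = ∑ i ∈ Finset.range m, variance (fun ω => f m (V i ω)) P := by
      rw [← hs]
      congr 1
      ext ω
      simp
    rw [variance_const_mul, hs']
    simp only [variance_comp_of_hasLaw (hV _) (hf m), Finset.sum_const, Finset.card_range,
      nsmul_eq_mul]
    rw [variance_of_integral_eq_zero (hf m).aemeasurable hm0, inv_pow, Real.sq_sqrt hmpos.le,
      ← mul_assoc, inv_mul_cancel₀ hmpos.ne', one_mul]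
  -- Chebyshev: by independence the variance of the normalized sum is one second moment.
  have := meas_ge_le_variance_div_sq hS hε
  rw [hE, hvar] at this
  simpa using this

/-- The strong law of large numbers. -/
lemma ae_tendsto_mean (hV : ∀ i, HasLaw (V i) μ P) (hind : iIndepFun V P) {f : 𝒱 → ℝ}
    (hf : Measurable f) (hi : Integrable f μ) :
    ∀ᵐ ω ∂P, Tendsto (fun m : ℕ => (m : ℝ)⁻¹ * ∑ i ∈ Finset.range m, f (V i ω)) atTop
      (𝓝 (∫ x, f x ∂μ)) := by
  have h := strong_law_ae (μ := P) (fun i ω => f (V i ω))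
    ((memLp_comp_of_hasLaw (hV 0) (memLp_one_iff_integrable.2 hi)).integrable le_rfl)
    (fun i j hij => (hind.indepFun hij).comp hf hf)
    (fun i => ((hV i).identDistrib (hV 0)).comp hf)
  simpa only [smul_eq_mul, integral_comp_of_hasLaw (hV 0) hf] using h

end Limits

end PriorityQueue
end

noncomputable section
namespace PriorityQueue

/-! ### Quantiles of ratio estimators -/

section Quantiles

variable {𝒱 : Type*} [MeasurableSpace 𝒱] {μ : Measure 𝒱} [IsProbabilityMeasure μ]
  {y : ℝ → 𝒱 → ℝ} {al : 𝒱 → ℝ} {q : ℝ → ℝ} {Q Ea : ℝ}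

/-- A monotone process whose mean is continuous at a point is almost surely continuous there. -/
lemma ae_continuousAt_of_antitone (hanti : ∀ v, Antitone fun γ => y γ v)
    (hint : ∀ᶠ γ in 𝓝 Q, Integrable (y γ) μ)
    (hcont : ContinuousAt (fun γ => ∫ v, y γ v ∂μ) Q) :
    ∀ᵐ v ∂μ, ContinuousAt (fun γ => y γ v) Q := by
  obtain ⟨δ, hδ, hball⟩ := Metric.eventually_nhds_iff.1 hint
  set e : ℕ → ℝ := fun j => (δ / 2) / ((j : ℝ) + 1) with he
  have hpos : ∀ j, 0 < e j := fun j => by positivity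
  have hlt : ∀ j, e j < δ := fun j => by
    have : e j ≤ δ / 2 := div_le_self (by positivity) (by
      have : (0 : ℝ) ≤ j := j.cast_nonneg
      linarith)
    linarith
  have hmono : Antitone e := fun i j hij =>
    div_le_div_of_nonneg_left (by positivity) (by positivity) (by
      have : (i : ℝ) ≤ j := by exact_mod_cast hij
      linarith)
  have hm : ∀ j, Integrable (y (Q - e j)) μ := fun j => hball (by
    rw [Real.dist_eq, sub_sub_cancel_left, abs_neg, abs_of_pos (hpos j)]
    exact hlt j)
  have hp : ∀ j, Integrable (y (Q + e j)) μ := fun j => hball (by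
    rw [Real.dist_eq, add_sub_cancel_left, abs_of_pos (hpos j)]
    exact hlt j)
  have he0 : Tendsto e atTop (𝓝 0) := by
    simpa [he, div_eq_mul_inv] using (tendsto_one_div_add_atTop_nhds_zero_nat (𝕜 := ℝ)).const_mul (δ / 2)
  have hlim : Tendsto (fun j => ∫ v, (y (Q - e j) v - y (Q + e j) v) ∂μ) atTop (𝓝 (∫ _, 0 ∂μ)) := by
    have h1 : Tendsto (fun j => Q - e j) atTop (𝓝 Q) := by simpa using he0.const_sub Q
    have h2 : Tendsto (fun j => Q + e j) atTop (𝓝 Q) := by simpa using he0.const_add Q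
    have := (hcont.tendsto.comp h1).sub (hcont.tendsto.comp h2)
    rw [sub_self] at this
    rw [integral_zero]
    refine this.congr fun j => ?_
    exact (integral_sub (hm j) (hp j)).symm
  -- The oscillations around `Q` are nonnegative, decrease along `e j`, and their means tend to 0;
  -- hence they tend to 0 almost surely.
  have key := tendsto_of_integral_tendsto_of_antitone (μ := μ)
    (f := fun j v => y (Q - e j) v - y (Q + e j) v) (F := fun _ => 0)
    (fun j => (hm j).sub (hp j)) (integrable_zero _ _ _) hlim
    (ae_of_all _ fun v i j hij => sub_le_sub (hanti v (by linarith [hmono hij]))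
      (hanti v (by linarith [hmono hij])))
    (ae_of_all _ fun v j => sub_nonneg.2 (hanti v (by linarith [hpos j])))
  filter_upwards [key] with v hv
  refine Metric.tendsto_nhds.2 fun η hη => ?_
  obtain ⟨j, hj⟩ := (hv.eventually_lt_const hη).exists
  filter_upwards [Metric.ball_mem_nhds Q (hpos j)] with γ hγ
  rw [Metric.mem_ball, Real.dist_eq, abs_lt] at hγ
  have a1 := hanti v (show Q - e j ≤ γ by linarith [hγ.1])
  have a2 := hanti v (show γ ≤ Q + e j by linarith [hγ.2])
  have b1 := hanti v (show Q - e j ≤ Q by linarith [hpos j])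
  have b2 := hanti v (show Q ≤ Q + e j by linarith [hpos j])
  rw [Real.dist_eq, abs_lt]
  constructor <;> linarith

/-- Mean square continuity of `y γ - q γ * al`. -/
lemma tendsto_integral_sq_sub (hy : ∀ γ, Measurable (y γ)) (hal : Measurable al)
    (hanti : ∀ v, Antitone fun γ => y γ v) (hal2 : MemLp al 2 μ)
    (hq : ContinuousAt q Q)
    (hy2 : ∀ᶠ γ in 𝓝 Q, MemLp (y γ) 2 μ ∧ ∫ v, y γ v ∂μ = q γ * Ea) :
    Tendsto (fun γ => ∫ v, ((y γ v - q γ * al v) - (y Q v - q Q * al v)) ^ 2 ∂μ) (𝓝 Q) (𝓝 0) := by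
  have hc : ∀ᵐ v ∂μ, ContinuousAt (fun γ => y γ v) Q := by
    refine ae_continuousAt_of_antitone hanti
      (hy2.mono fun γ h => h.1.integrable one_le_two) ?_
    have h1 : ContinuousAt (fun γ => q γ * Ea) Q := hq.mul continuousAt_const
    exact h1.congr (hy2.mono fun γ h => h.2.symm)
  obtain ⟨δ, hδ, hball⟩ := Metric.eventually_nhds_iff.1 hy2
  have h1 : MemLp (y (Q - δ / 2)) 2 μ := (hball (by
    rw [Real.dist_eq, sub_sub_cancel_left, abs_neg, abs_of_pos (by positivity)]; linarith)).1
  have h2 : MemLp (y (Q + δ / 2)) 2 μ := (hball (by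
    rw [Real.dist_eq, add_sub_cancel_left, abs_of_pos (by positivity)]; linarith)).1
  -- By monotonicity the first part dominates |y γ - y Q| uniformly for γ near `Q`; the second
  -- covers the change of q, which is at most 1 there.
  have hint : Integrable (fun v => ((y (Q - δ / 2) v - y (Q + δ / 2) v) + |al v|) ^ 2) μ :=
    ((h1.sub h2).add hal2.norm).integrable_sq
  have hlim := tendsto_integral_filter_of_dominated_convergence (μ := μ) (l := 𝓝 Q)
    (F := fun γ v => ((y γ v - q γ * al v) - (y Q v - q Q * al v)) ^ 2) (f := fun _ => 0) _
    (Eventually.of_forall fun γ => ((((hy γ).sub (hal.const_mul _)).sub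
      ((hy Q).sub (hal.const_mul _))).pow_const 2).aestronglyMeasurable) ?_ hint ?_
  · simpa using hlim
  · filter_upwards [Metric.ball_mem_nhds Q (half_pos hδ),
      hq.tendsto.eventually (Metric.ball_mem_nhds (q Q) one_pos)] with γ hγ hqγ
    refine ae_of_all _ fun v => ?_
    rw [Metric.mem_ball, Real.dist_eq, abs_lt] at hγ
    rw [Real.dist_eq] at hqγ
    have a1 := hanti v (show Q - δ / 2 ≤ γ by linarith [hγ.1])
    have a2 := hanti v (show γ ≤ Q + δ / 2 by linarith [hγ.2])
    have b1 := hanti v (show Q - δ / 2 ≤ Q by linarith)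
    have b2 := hanti v (show Q ≤ Q + δ / 2 by linarith)
    have c1 : |y γ v - y Q v| ≤ y (Q - δ / 2) v - y (Q + δ / 2) v := by
      rw [abs_le]
      constructor <;> simp only at a1 a2 b1 b2 <;> linarith
    have c2 : |(q γ - q Q) * al v| ≤ |al v| := by
      rw [abs_mul]
      exact mul_le_of_le_one_left (abs_nonneg _) hqγ.le
    rw [Real.norm_eq_abs, abs_pow]
    refine pow_le_pow_left₀ (abs_nonneg _) ?_ 2
    have e1 : (y γ v - q γ * al v) - (y Q v - q Q * al v)
        = (y γ v - y Q v) - (q γ - q Q) * al v := by ring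
    rw [e1]
    exact (abs_sub _ _).trans (add_le_add c1 c2)
  · filter_upwards [hc] with v hv
    have h0 : ContinuousAt (fun γ => ((y γ v - q γ * al v) - (y Q v - q Q * al v)) ^ 2) Q :=
      ((hv.sub (hq.mul continuousAt_const)).sub continuousAt_const).pow 2
    simpa [ContinuousAt] using h0

variable {Ω : Type*} [MeasurableSpace Ω] {P : Measure Ω} [IsProbabilityMeasure P]
  {V : ℕ → Ω → 𝒱}

lemma aemeasurable_sum_comp (hV : ∀ i, HasLaw (V i) μ P) {f : 𝒱 → ℝ} (hf : Measurable f) (m : ℕ) :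
    AEMeasurable (fun ω => ∑ i ∈ Finset.range m, f (V i ω)) P :=
  Finset.aemeasurable_fun_sum _ fun i _ => hf.comp_aemeasurable (hV i).aemeasurable

/-- The central limit theorem for the events that the empirical version of `y γ` is smaller than
the empirical version of `q Q * al`, at levels `γ` approaching `Q`. -/
lemma tendsto_measureReal_sum_lt (hV : ∀ i, HasLaw (V i) μ P) (hind : iIndepFun V P)
    (hy : ∀ γ, Measurable (y γ)) (hal : Measurable al)
    (hanti : ∀ v, Antitone fun γ => y γ v) (hal2 : MemLp al 2 μ) (hEa : ∫ v, al v ∂μ = Ea) (hE0 : 0 < Ea)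
    (hq : ContinuousAt q Q)
    (hy2 : ∀ᶠ γ in 𝓝 Q, MemLp (y γ) 2 μ ∧ ∫ v, y γ v ∂μ = q γ * Ea) {σ : ℝ} (hσ : 0 < σ)
    (hvar : variance (fun v => y Q v - q Q * al v) μ = σ ^ 2) {g : ℕ → ℝ}
    (hg : Tendsto g atTop (𝓝 Q)) {x : ℝ}
    (hgx : Tendsto (fun m : ℕ => √(m : ℝ) * (q (g m) - q Q) / σ * Ea) atTop (𝓝 (-x))) :
    Tendsto (fun m => P.real {ω | ∑ i ∈ Finset.range m, y (g m) (V i ω)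
      < q Q * ∑ i ∈ Finset.range m, al (V i ω)}) atTop (𝓝 (cdf (gaussianReal 0 1) x)) := by
  set f : ℝ → 𝒱 → ℝ := fun γ v => y γ v - q γ * al v with hf
  have hfm : ∀ γ, Measurable (f γ) := fun γ => (hy γ).sub (hal.const_mul _)
  have hf2 : ∀ᶠ γ in 𝓝 Q, MemLp (f γ) 2 μ ∧ ∫ v, f γ v ∂μ = 0 := by
    filter_upwards [hy2] with γ h
    refine ⟨h.1.sub (hal2.const_mul _), ?_⟩
    rw [hf]
    simp only
    rw [integral_sub (h.1.integrable one_le_two) ((hal2.integrable one_le_two).const_mul _),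
      integral_const_mul, h.2, hEa, sub_self]
  have hfQ := hf2.self_of_nhds
  have hclt := tendstoInDistribution_inv_sqrt_mul_sum (P := P) (P' := gaussianReal 0 1)
    (X := fun i ω => f Q (V i ω) / σ) (Y := id) HasLaw.id ?_ ?_
    (hind.comp (fun _ v => f Q v / σ) fun _ => (hfm Q).div_const σ)
    (fun i => ((hV i).identDistrib (hV 0)).comp ((hfm Q).div_const σ))
  rotate_left
  · rw [integral_div, integral_comp_of_hasLaw (hV 0) (hfm Q), hfQ.2, zero_div]
  · have : ∫ ω, (f Q (V 0 ω) / σ) ^ 2 ∂P = 1 := by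
      simp only [div_pow]
      rw [integral_div, integral_comp_of_hasLaw (f := fun v => f Q v ^ 2) (hV 0)
        ((hfm Q).pow_const 2), ← variance_of_integral_eq_zero (hfm Q).aemeasurable hfQ.2, hvar,
        div_self (by positivity)]
    exact this
  -- Replacing the moving level by `Q` costs a centered sum with vanishing second moment, so the
  -- central limit theorem is needed at the fixed level only.
  have hT2 := tendstoInMeasure_sum_div_sqrt (P := P) hV hind
    (f := fun m v => (f (g m) v - f Q v) / σ)
    (fun m => ((hfm _).sub (hfm _)).div_const σ)
    ((hg.eventually hf2).mono fun m h => by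
      simp only [div_eq_mul_inv]
      exact (h.1.sub hfQ.1).mul_const σ⁻¹)
    ((hg.eventually hf2).mono fun m h => by
      rw [integral_div, integral_sub (h.1.integrable one_le_two) (hfQ.1.integrable one_le_two),
        h.2, hfQ.2, sub_zero, zero_div])
    (by
      have := ((tendsto_integral_sq_sub hy hal hanti hal2 hq hy2).comp hg).div_const (σ ^ 2)
      rw [zero_div] at this
      refine this.congr fun m => ?_
      simp only [div_pow, Function.comp]
      rw [integral_div])
  -- The drift: the sum is centered with q(g m), while the event compares with q(Q).
  have hT3 : TendstoInMeasure P (fun (m : ℕ) ω => √(m : ℝ) * (q (g m) - q Q) / σ *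
      ((m : ℝ)⁻¹ * ∑ i ∈ Finset.range m, al (V i ω))) atTop (fun _ => -x) := by
    refine tendstoInMeasure_of_tendsto_ae (fun m =>
      (((aemeasurable_sum_comp hV hal m).const_mul _).const_mul _).aestronglyMeasurable) ?_
    filter_upwards [ae_tendsto_mean hV hind hal (hal2.integrable one_le_two)] with ω hω
    rw [hEa] at hω
    have h1 := (hgx.div_const Ea).mul hω
    rw [div_mul_cancel₀ _ hE0.ne'] at h1
    refine h1.congr fun m => ?_
    rw [mul_div_cancel_right₀ _ hE0.ne']
  have hsum := (hclt.add_of_tendstoInMeasure_const hT2 fun m =>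
    (aemeasurable_sum_comp hV (((hfm _).sub (hfm _)).div_const σ) m).const_mul _
      ).add_of_tendstoInMeasure_const hT3 fun m =>
    ((aemeasurable_sum_comp hV hal m).const_mul _).const_mul _
  have hmeas := hsum.tendsto
  -- The three terms together converge to a normal variable minus `x`, and the boundary case of a
  -- vanishing sum has limit probability 0.
  have hnull : (gaussianReal 0 1).map (fun z => id z + 0 + -x) (frontier (Set.Iio 0)) = 0 := by
    rw [frontier_Iio, Measure.map_apply (by fun_prop) (measurableSet_singleton _)]
    have : (fun z => id z + 0 + -x) ⁻¹' {(0 : ℝ)} = {x} := by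
      ext z
      simp only [id, add_zero, Set.mem_preimage, Set.mem_singleton_iff]
      constructor <;> intro h <;> linarith
    rw [this]
    have := nullSingletonClass_gaussianReal (μ := 0) (v := 1) one_ne_zero
    exact measure_singleton x
  have hport := ProbabilityMeasure.tendsto_measure_of_null_frontier_of_tendsto' hmeas
    (E := Set.Iio 0) hnull
  have hport' := (ENNReal.tendsto_toReal (measure_ne_top ((gaussianReal 0 1).map _) _)).comp hport
  have hlim : ((gaussianReal 0 1).map (fun z => id z + 0 + -x) (Set.Iio 0)).toReal
      = cdf (gaussianReal 0 1) x := by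
    have := nullSingletonClass_gaussianReal (μ := 0) (v := 1) one_ne_zero
    rw [cdf_eq_real, Measure.real, Measure.map_apply (by fun_prop) measurableSet_Iio,
      ← measure_congr (Iio_ae_eq_Iic (μ := gaussianReal 0 1) (a := x))]
    congr 2
    ext z
    simp only [id, add_zero, Set.mem_preimage, Set.mem_Iio]
    constructor <;> intro h <;> linarith
  refine (hlim ▸ hport').congr' ?_
  filter_upwards [eventually_gt_atTop 0] with m hm
  have hm' : (0 : ℝ) < √(m : ℝ) := Real.sqrt_pos.2 (by exact_mod_cast hm)
  change ((P.map _) (Set.Iio 0)).toReal = _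
  rw [Measure.map_apply_of_aemeasurable (hsum.forall_aemeasurable m) measurableSet_Iio, Measure.real]
  congr 2
  ext ω
  simp only [Set.mem_preimage, Set.mem_Iio, Set.mem_ofPred_eq, Pi.add_apply]
  have : (√(m : ℝ))⁻¹ * ∑ i ∈ Finset.range m, f Q (V i ω) / σ
      + (√(m : ℝ))⁻¹ * ∑ i ∈ Finset.range m, (f (g m) (V i ω) - f Q (V i ω)) / σ
      + √(m : ℝ) * (q (g m) - q Q) / σ * ((m : ℝ)⁻¹ * ∑ i ∈ Finset.range m, al (V i ω))
      = (√(m : ℝ))⁻¹ / σ * (∑ i ∈ Finset.range m, y (g m) (V i ω)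
        - q Q * ∑ i ∈ Finset.range m, al (V i ω)) := by
    simp only [hf, ← Finset.sum_div, Finset.sum_sub_distrib, ← Finset.mul_sum]
    generalize hs : √(m : ℝ) = s at hm'
    have hm2 : (m : ℝ) = s * s := by rw [← hs, Real.mul_self_sqrt (by positivity)]
    rw [hm2]
    field_simp
    ring
  have hpos : 0 < (√(m : ℝ))⁻¹ / σ := by positivity
  rw [this, ← smul_eq_mul, smul_neg_iff_of_pos_left hpos, sub_neg]

/-- The levels with `h` below `t` form an up-set of the half-line, whose infimum need not belong to
it. So inversion holds with a strict inequality one way and a weak one, in `sInf_le_of_lt`, the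
other way. -/
lemma lt_of_sInf_lt {h : ℝ → ℝ} (hanti : Antitone h) {t : ℝ}
    (hex : ∃ γ, 0 ≤ γ ∧ h γ < t) {x : ℝ} (hx : sInf {γ | 0 ≤ γ ∧ h γ < t} < x) : h x < t := by
  obtain ⟨s, hs, hsx⟩ := exists_lt_of_csInf_lt (s := {γ | 0 ≤ γ ∧ h γ < t}) hex hx
  exact (hanti hsx.le).trans_lt hs.2

lemma sInf_le_of_lt {h : ℝ → ℝ} {t x : ℝ} (h0 : 0 ≤ x) (hx : h x < t) :
    sInf {γ | 0 ≤ γ ∧ h γ < t} ≤ x :=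
  csInf_le ⟨0, fun _ h => h.1⟩ ⟨h0, hx⟩

/-- The ratio of the empirical means of `y γ` and `al`. -/
def ratioMean (y : ℝ → 𝒱 → ℝ) (al : 𝒱 → ℝ) (v : ℕ → 𝒱) (m : ℕ) (γ : ℝ) : ℝ :=
  ((m : ℝ)⁻¹ * ∑ i ∈ Finset.range m, y γ (v i)) / ((m : ℝ)⁻¹ * ∑ i ∈ Finset.range m, al (v i))

/-- The smallest nonnegative level at which the ratio of the empirical means is below `t`. -/
def ratioQuantile (y : ℝ → 𝒱 → ℝ) (al : 𝒱 → ℝ) (t : ℝ) (v : ℕ → 𝒱) (m : ℕ) : ℝ :=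
  sInf {γ | 0 ≤ γ ∧ ratioMean y al v m γ < t}

lemma ratioMean_antitone (hal0 : ∀ v, 0 ≤ al v) (hanti : ∀ v, Antitone fun γ => y γ v)
    (v : ℕ → 𝒱) (m : ℕ) : Antitone (ratioMean y al v m) := fun a b hab =>
  div_le_div_of_nonneg_right (mul_le_mul_of_nonneg_left
    (Finset.sum_le_sum fun i _ => hanti (v i) hab) (by positivity))
    (mul_nonneg (by positivity) (Finset.sum_nonneg fun i _ => hal0 _))

lemma exists_ratioMean_lt (h0 : ∀ v, ∀ᶠ γ in atTop, y γ v = 0) {t : ℝ} (ht : 0 < t)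
    (v : ℕ → 𝒱) (m : ℕ) : ∃ γ, 0 ≤ γ ∧ ratioMean y al v m γ < t := by
  have : ∀ᶠ γ in atTop, ∀ i ∈ Finset.range m, y γ (v i) = 0 :=
    (Finset.eventually_all _).2 fun i _ => h0 (v i)
  obtain ⟨γ, h, hγ⟩ := (this.and (eventually_ge_atTop 0)).exists
  refine ⟨γ, hγ, ?_⟩
  rw [ratioMean, Finset.sum_eq_zero h, mul_zero, zero_div]
  exact ht

lemma measurable_ratioMean (hy : ∀ γ, Measurable (y γ)) (hal : Measurable al) (m : ℕ) (γ : ℝ) :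
    Measurable fun v : ℕ → 𝒱 => ratioMean y al v m γ :=
  ((Finset.measurable_fun_sum _ fun i _ => (hy γ).comp (measurable_pi_apply i)).const_mul _).div
    ((Finset.measurable_fun_sum _ fun i _ => hal.comp (measurable_pi_apply i)).const_mul _)

/-- By monotonicity in the level, rational levels suffice. -/
lemma measurable_ratioQuantile (hy : ∀ γ, Measurable (y γ)) (hal : Measurable al)
    (hal0 : ∀ v, 0 ≤ al v) (hanti : ∀ v, Antitone fun γ => y γ v)
    (h0 : ∀ v, ∀ᶠ γ in atTop, y γ v = 0) {t : ℝ} (ht : 0 < t) (m : ℕ) :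
    Measurable fun v : ℕ → 𝒱 => ratioQuantile y al t v m := by
  refine measurable_of_Iio fun x => ?_
  have : (fun v : ℕ → 𝒱 => ratioQuantile y al t v m) ⁻¹' Set.Iio x
      = ⋃ r : ℚ, ⋃ _ : (0 : ℝ) ≤ r ∧ (r : ℝ) < x, {v | ratioMean y al v m r < t} := by
    ext v
    simp only [Set.mem_preimage, Set.mem_Iio, Set.mem_iUnion, Set.mem_ofPred_eq, exists_prop]
    constructor
    · intro h
      obtain ⟨r, hr1, hr2⟩ := exists_rat_btwn h
      exact ⟨r, ⟨(Real.sInf_nonneg fun γ hγ => hγ.1).trans hr1.le, hr2⟩,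
        lt_of_sInf_lt (ratioMean_antitone hal0 hanti v m) (exists_ratioMean_lt h0 ht v m) hr1⟩
    · rintro ⟨r, ⟨hr0, hrx⟩, hr⟩
      exact (sInf_le_of_lt hr0 hr).trans_lt hrx
  rw [this]
  exact MeasurableSet.iUnion fun r => MeasurableSet.iUnion fun _ =>
    measurableSet_lt (measurable_ratioMean hy hal m r) measurable_const

/-- The probability that the ratio of the empirical means is below `q Q`, at levels
approaching `Q`. -/
lemma tendsto_measureReal_ratioMean_lt (hV : ∀ i, HasLaw (V i) μ P) (hind : iIndepFun V P)
    (hal : Measurable al) (hal2 : MemLp al 2 μ) (hEa : ∫ v, al v ∂μ = Ea) (hE0 : 0 < Ea)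
    {g : ℕ → ℝ} {ℓ : ℝ}
    (h : Tendsto (fun m => P.real {ω | ∑ i ∈ Finset.range m, y (g m) (V i ω)
      < q Q * ∑ i ∈ Finset.range m, al (V i ω)}) atTop (𝓝 ℓ)) :
    Tendsto (fun m => P.real {ω | ratioMean y al (fun i => V i ω) m (g m) < q Q}) atTop
      (𝓝 ℓ) := by
  -- Outside this vanishing event the mean of `al` is positive and the ratio inequality can be
  -- cleared of its denominator.
  have hN : Tendsto (fun m : ℕ => P.real {ω | Ea ≤
      ‖(m : ℝ)⁻¹ * ∑ i ∈ Finset.range m, al (V i ω) - Ea‖}) atTop (𝓝 0) := by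
    have := tendstoInMeasure_of_tendsto_ae (μ := P)
      (fun m : ℕ => ((aemeasurable_sum_comp hV hal m).const_mul (m : ℝ)⁻¹).aestronglyMeasurable)
      (ae_tendsto_mean hV hind hal (hal2.integrable one_le_two))
    rw [hEa, tendstoInMeasure_iff_measureReal_norm] at this
    exact this Ea hE0
  have key : ∀ m : ℕ, 0 < m → ∀ ω, ω ∉ {ω | Ea ≤
      ‖(m : ℝ)⁻¹ * ∑ i ∈ Finset.range m, al (V i ω) - Ea‖} →
      (ratioMean y al (fun i => V i ω) m (g m) < q Q ↔
        ∑ i ∈ Finset.range m, y (g m) (V i ω) < q Q * ∑ i ∈ Finset.range m, al (V i ω)) := by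
    intro m hm ω hω
    have hm' : (0 : ℝ) < (m : ℝ)⁻¹ := inv_pos.2 (by exact_mod_cast hm)
    rw [Set.mem_ofPred_eq, not_le, Real.norm_eq_abs, abs_lt] at hω
    have hS : 0 < (m : ℝ)⁻¹ * ∑ i ∈ Finset.range m, al (V i ω) := by linarith [hω.1]
    rw [ratioMean, div_lt_iff₀ hS, mul_left_comm, mul_lt_mul_iff_right₀ hm']
  have hlo := h.sub hN
  have hhi := h.add hN
  rw [sub_zero] at hlo
  rw [add_zero] at hhi
  refine tendsto_of_tendsto_of_tendsto_of_le_of_le' hlo hhi ?_ ?_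
  · filter_upwards [eventually_gt_atTop 0] with m hm
    rw [sub_le_iff_le_add]
    refine (measureReal_mono fun ω hω => ?_).trans (measureReal_union_le _ _)
    by_contra hcon
    rw [Set.mem_union, not_or] at hcon
    exact hcon.1 ((key m hm ω hcon.2).2 hω)
  · filter_upwards [eventually_gt_atTop 0] with m hm
    refine (measureReal_mono fun ω hω => ?_).trans (measureReal_union_le _ _)
    by_contra hcon
    rw [Set.mem_union, not_or] at hcon
    exact hcon.1 ((key m hm ω hcon.2).1 hω)

/-- The central limit theorem for quantiles of ratio estimators. -/
theorem ratioQuantile_clt (hV : ∀ i, HasLaw (V i) μ P) (hind : iIndepFun V P)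
    (hy : ∀ γ, Measurable (y γ)) (hal : Measurable al) (hal0 : ∀ v, 0 ≤ al v)
    (hanti : ∀ v, Antitone fun γ => y γ v) (h0 : ∀ v, ∀ᶠ γ in atTop, y γ v = 0)
    (hal2 : MemLp al 2 μ) (hEa : ∫ v, al v ∂μ = Ea) (hE0 : 0 < Ea)
    (hQ : 0 < Q) (hqQ : 0 < q Q) {d : ℝ} (hd : 0 < d) (hq : HasDerivAt q (-d) Q)
    (hy2 : ∀ᶠ γ in 𝓝 Q, MemLp (y γ) 2 μ ∧ ∫ v, y γ v ∂μ = q γ * Ea) {σ : ℝ} (hσ : 0 < σ)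
    (hvar : variance (fun v => y Q v - q Q * al v) μ = σ ^ 2) :
    TendstoInDistribution (fun (m : ℕ) ω =>
      √(m : ℝ) * (ratioQuantile y al (q Q) (fun i => V i ω) m - Q) / (σ / (Ea * d)))
      atTop id (fun _ => P) (gaussianReal 0 1) ∧
    TendstoInMeasure P (fun m ω => ratioQuantile y al (q Q) (fun i => V i ω) m) atTop
      (fun _ => Q) := by
  set c : ℝ := σ / (Ea * d) with hc
  have hcpos : 0 < c := by positivity
  set R : ℕ → Ω → ℝ := fun m ω => ratioQuantile y al (q Q) (fun i => V i ω) m with hR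
  have hRm : ∀ m, AEMeasurable (R m) P := fun m =>
    (measurable_ratioQuantile hy hal hal0 hanti h0 hqQ m).comp_aemeasurable
      (aemeasurable_pi_lambda _ fun i => (hV i).aemeasurable)
  set T : ℕ → Ω → ℝ := fun m ω => √(m : ℝ) * (R m ω - Q) / c with hT
  have hTm : ∀ m, AEMeasurable (T m) P := fun m =>
    (((hRm m).sub_const Q).const_mul _).div_const c
  -- The level corresponding to the value `x` of the normalized estimator.
  set g : ℝ → ℕ → ℝ := fun x m => Q + c * x / √(m : ℝ) with hg
  have hsqrt : Tendsto (fun m : ℕ => √(m : ℝ)) atTop atTop :=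
    Real.tendsto_sqrt_atTop.comp tendsto_natCast_atTop_atTop
  have hgQ : ∀ x, Tendsto (g x) atTop (𝓝 Q) := fun x => by
    simpa using (hsqrt.const_div_atTop (c * x)).const_add Q
  have hiff : ∀ m : ℕ, 0 < m → ∀ x z : ℝ, √(m : ℝ) * (z - Q) / c < x ↔ z < g x m :=
    fun m hm x z => by
    have : (0 : ℝ) < √(m : ℝ) := Real.sqrt_pos.2 (by exact_mod_cast hm)
    rw [div_lt_iff₀ hcpos, ← lt_div_iff₀' this, sub_lt_iff_lt_add', mul_comm x]
  have hiff' : ∀ m : ℕ, 0 < m → ∀ x z : ℝ, √(m : ℝ) * (z - Q) / c ≤ x ↔ z ≤ g x m :=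
    fun m hm x z => by
    have : (0 : ℝ) < √(m : ℝ) := Real.sqrt_pos.2 (by exact_mod_cast hm)
    rw [div_le_iff₀ hcpos, ← le_div_iff₀' this, sub_le_iff_le_add', mul_comm x]
  have hcdf := tendsto_measureReal_le_of_sandwich (P := P) (T := T) (η := gaussianReal 0 1)
    (A := fun x m => {ω | ratioMean y al (fun i => V i ω) m (g x m) < q Q}) ?_ ?_ ?_
  · refine ⟨tendstoInDistribution_of_tendsto_cdf hTm hcdf, ?_⟩
    have ha : Tendsto (fun m : ℕ => c / √(m : ℝ)) atTop (𝓝 0) := hsqrt.const_div_atTop c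
    have hmul := tendstoInMeasure_mul_of_tendsto_cdf hTm hcdf ha
    rw [tendstoInMeasure_iff_norm] at hmul ⊢
    intro ε hε
    refine (hmul ε hε).congr' ?_
    filter_upwards [eventually_gt_atTop 0] with m hm
    have : (0 : ℝ) < √(m : ℝ) := Real.sqrt_pos.2 (by exact_mod_cast hm)
    have e : ∀ ω, c / √(m : ℝ) * T m ω - 0 = R m ω - Q := fun ω => by
      simp only [hT]
      field_simp
      ring
    simp only [e]
  · intro x
    filter_upwards [eventually_gt_atTop 0] with m hm ω hω
    exact lt_of_sInf_lt (ratioMean_antitone hal0 hanti _ m) (exists_ratioMean_lt h0 hqQ _ m)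
      ((hiff m hm x _).1 hω)
  · intro x
    -- The estimator searches nonnegative levels only, so the level must be positive; this holds
    -- eventually since Q > 0.
    filter_upwards [eventually_gt_atTop 0, (hgQ x).eventually (lt_mem_nhds hQ)] with m hm hpos ω hω
    exact (hiff' m hm x _).2 (sInf_le_of_lt hpos.le hω)
  · intro x
    refine tendsto_measureReal_ratioMean_lt hV hind hal hal2 hEa hE0
      (tendsto_measureReal_sum_lt hV hind hy hal hanti hal2 hEa hE0 hq.continuousAt hy2 hσ hvar
        (hgQ x) ?_)
    have h1 := (hq.hasFDerivAt.lim_real (c * x)).comp hsqrt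
    have h2 := (h1.div_const σ).mul_const Ea
    -- The choice c = σ/(Ea d) makes the drift exactly -x.
    have e : (ContinuousLinearMap.toSpanSingleton ℝ (-d)) (c * x) / σ * Ea = -x := by
      simp only [ContinuousLinearMap.toSpanSingleton_apply, smul_eq_mul, hc]
      field_simp
    rw [e] at h2
    refine h2.congr fun m => ?_
    simp only [Function.comp, smul_eq_mul, hg]
    rw [div_eq_inv_mul (c * x)]

end Quantiles

end PriorityQueue
end

noncomputable section
namespace PriorityQueue
variable {K : ℕ}

/-! ### The steady-state distribution near the quantile -/

section Cdf

variable {ν : Measure ℝ} [IsProbabilityMeasure ν]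

lemma measureReal_Ioi_eq (ν : Measure ℝ) [IsProbabilityMeasure ν] (γ : ℝ) :
    ν.real (Set.Ioi γ) = 1 - cdf ν γ := by
  rw [cdf_eq_real, ← probReal_compl_eq_one_sub measurableSet_Iic, Set.compl_Iic]

lemma measure_singleton_eq_zero_of_continuousAt_cdf {γ : ℝ} (h : ContinuousAt (cdf ν) γ) :
    ν {γ} = 0 := by
  rw [← measure_cdf ν, StieltjesFunction.measure_singleton,
    ContinuousWithinAt.leftLim_eq h.continuousWithinAt, sub_self, ENNReal.ofReal_zero]

lemma cdf_quantile {p : ℝ} (hp₀ : 0 < p) (hp₁ : p < 1)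
    (hc : ContinuousAt (cdf ν) (quantile ν p)) : cdf ν (quantile ν p) = p := by
  have hne : {γ : ℝ | p ≤ cdf ν γ}.Nonempty :=
    (((tendsto_cdf_atTop ν).eventually_const_lt hp₁).mono fun _ h => h.le).exists
  have hbdd : BddBelow {γ : ℝ | p ≤ cdf ν γ} := by
    obtain ⟨b, hb⟩ := ((tendsto_cdf_atBot ν).eventually_lt_const hp₀).exists
    refine ⟨b, fun γ hγ => ?_⟩
    by_contra hlt
    exact absurd ((monotone_cdf ν (not_le.1 hlt).le).trans_lt hb) (not_lt.2 hγ)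
  refine le_antisymm ?_ ?_
  · by_contra hlt
    obtain ⟨γ, hγ, hγQ⟩ := ((((hc.tendsto.eventually (lt_mem_nhds (not_le.1 hlt))).filter_mono
      nhdsWithin_le_nhds : ∀ᶠ γ in 𝓝[<] (quantile ν p), p < cdf ν γ)).and self_mem_nhdsWithin).exists
    exact absurd (csInf_le hbdd hγ.le) (not_le.2 hγQ)
  · by_contra hlt
    obtain ⟨γ, hγ, hγQ⟩ := ((((hc.tendsto.eventually (gt_mem_nhds (not_le.1 hlt))).filter_mono
      nhdsWithin_le_nhds : ∀ᶠ γ in 𝓝[>] (quantile ν p), cdf ν γ < p)).and self_mem_nhdsWithin).exists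
    obtain ⟨s, hs, hsγ⟩ := exists_lt_of_csInf_lt hne hγQ
    exact absurd ((monotone_cdf ν hsγ.le).trans_lt hγ) (not_lt.2 hs)

/-- If the quantile were not positive, the distribution function would vanish to its left, and
continuity would force p = 0. -/
lemma quantile_pos {p : ℝ} (hp₀ : 0 < p) (hp₁ : p < 1)
    (hc : ContinuousAt (cdf ν) (quantile ν p)) (hν : ν (Set.Iio 0) = 0) : 0 < quantile ν p := by
  by_contra hle
  have hz : ∀ᶠ γ in 𝓝[<] (quantile ν p), cdf ν γ = 0 := by
    filter_upwards [self_mem_nhdsWithin] with γ hγ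
    have hγ' : γ < quantile ν p := hγ
    rw [cdf_eq_real, measureReal_eq_zero_iff]
    exact measure_mono_null (Set.Iic_subset_Iio.2 (by linarith)) hν
  have h1 : Tendsto (cdf ν) (𝓝[<] (quantile ν p)) (𝓝 p) := by
    have := hc.tendsto.mono_left (nhdsWithin_le_nhds (s := Set.Iio (quantile ν p)))
    rwa [cdf_quantile hp₀ hp₁ hc] at this
  have h2 := tendsto_nhds_unique (h1.congr' hz) tendsto_const_nhds
  exact hp₀.ne' h2

end Cdf

section Steady

variable {lam mu : Fin K → ℝ} {k : Fin K} {Ω : Type*} [MeasurableSpace Ω] {P : Measure Ω}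
  [IsProbabilityMeasure P] {W : Ω → Drive K} {ν : Measure ℝ} [IsProbabilityMeasure ν]

lemma tendsto_measure_of_steady
    (hν : TendstoInDistribution (fun (n : ℕ) ω => responseTime k (nominalPath k (W ω)) n)
      atTop id (fun _ => P) ν) {γ : ℝ} (hγ : ν {γ} = 0) (hW : HasLaw W (nominalLaw lam mu) P) :
    Tendsto (fun n => (nominalLaw lam mu).real (respEvent k γ n)) atTop
      (𝓝 (ν.real (Set.Ioi γ))) := by
  have hport := ProbabilityMeasure.tendsto_measure_of_null_frontier_of_tendsto' hν.tendsto
    (E := Set.Ioi γ) (by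
      change (ν.map id) (frontier (Set.Ioi γ)) = 0
      rw [Measure.map_id, frontier_Ioi, hγ])
  have hlim := (ENNReal.tendsto_toReal (measure_ne_top (ν.map id) _)).comp hport
  have e : (ν.map id (Set.Ioi γ)).toReal = ν.real (Set.Ioi γ) := by rw [Measure.map_id]; rfl
  refine (e ▸ hlim).congr fun n => ?_
  change (P.map _ (Set.Ioi γ)).toReal = _
  rw [Measure.map_apply_of_aemeasurable (hν.forall_aemeasurable n) measurableSet_Ioi,
    ← hW.map_eq, Measure.real,
    Measure.map_apply_of_aemeasurable hW.aemeasurable (measurableSet_respEvent k γ n)]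
  rfl

lemma ae_responseTime_pos (hlam : ∀ l, 0 < lam l) (hmu : ∀ l, 0 < mu l)
    (hstable : ∑ l, lam l / mu l < 1) (k : Fin K) (n : ℕ) :
    ∀ᵐ v ∂nominalLaw lam mu, 0 < responseTime k (nominalPath k v) n := by
  filter_upwards [ae_good hlam hmu] with v hv
  rw [responseTime_nominalPath]
  exact resp_pos k hv.pos n (exists_lt_ent hlam hstable k hv k n)

/-- Response times are almost surely positive, and the portmanteau inequality on the open negative
half-line passes this to the limit. -/
lemma steady_Iio_zero (hlam : ∀ l, 0 < lam l) (hmu : ∀ l, 0 < mu l)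
    (hstable : ∑ l, lam l / mu l < 1)
    (hν : TendstoInDistribution (fun (n : ℕ) ω => responseTime k (nominalPath k (W ω)) n)
      atTop id (fun _ => P) ν) (hW : HasLaw W (nominalLaw lam mu) P) :
    ν (Set.Iio 0) = 0 := by
  have h := ProbabilityMeasure.le_liminf_measure_open_of_tendsto hν.tendsto
    (G := Set.Iio 0) isOpen_Iio
  change (ν.map id) (Set.Iio 0) ≤ liminf (fun n => P.map _ (Set.Iio 0)) atTop at h
  rw [Measure.map_id] at h
  refine le_antisymm (h.trans_eq ?_) bot_le
  have : ∀ n, P.map (fun ω => responseTime k (nominalPath k (W ω)) n) (Set.Iio 0) = 0 := fun n => by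
    rw [Measure.map_apply_of_aemeasurable (hν.forall_aemeasurable n) measurableSet_Iio]
    have hae := ae_responseTime_pos hlam hmu hstable k n
    rw [← hW.map_eq] at hae
    refine measure_mono_null (fun ω hω => ?_) (ae_iff.1 (ae_of_ae_map hW.aemeasurable hae))
    exact not_lt.2 (le_of_lt hω)
  simp only [this, liminf_const]

end Steady

/-! ### Second moments of the two independent terms -/

section Moments

variable {α β : Type*} [MeasurableSpace α] [MeasurableSpace β] {μ : Measure α} {η : Measure β}
  [IsProbabilityMeasure μ] [IsProbabilityMeasure η]

/-- If the difference of independent random variables is square integrable, so are both. -/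
lemma memLp_two_of_memLp_sub {f : α → ℝ} {g : β → ℝ} (hf : Measurable f) (hg : Measurable g)
    (h : MemLp (fun z : α × β => f z.1 - g z.2) 2 (μ.prod η)) : MemLp f 2 μ ∧ MemLp g 2 η := by
  have hsq := h.integrable_sq
  -- By Fubini almost every section is square integrable, so one variable can be frozen at a
  -- suitable value.
  obtain ⟨b, hb⟩ := hsq.prod_left_ae.exists
  obtain ⟨a, ha⟩ := hsq.prod_right_ae.exists
  have h1 : MemLp (fun x => f x - g b) 2 μ :=
    (memLp_two_iff_integrable_sq (hf.sub_const _).aestronglyMeasurable).2 hb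
  have h2 : MemLp (fun y => f a - g y) 2 η :=
    (memLp_two_iff_integrable_sq (hg.const_sub _).aestronglyMeasurable).2 ha
  constructor
  · exact (h1.add (memLp_const (g b))).ae_eq (ae_of_all _ fun x => sub_add_cancel _ _)
  · exact ((memLp_const (f a)).sub h2).ae_eq (ae_of_all _ fun y => sub_sub_cancel _ _)

lemma memLp_two_of_lintegral_rpow_lt_top {f : α → ℝ} (hf : Measurable f) {ε : ℝ} (hε : 0 < ε)
    (h : ∫⁻ x, ENNReal.ofReal (|f x| ^ (2 + ε)) ∂μ < ⊤) : MemLp f 2 μ := by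
  have hp : MemLp f (ENNReal.ofReal (2 + ε)) μ := by
    refine ⟨hf.aestronglyMeasurable, ?_⟩
    rw [eLpNorm_lt_top_iff_lintegral_rpow_enorm_lt_top (by simp; linarith) ENNReal.ofReal_ne_top,
      ENNReal.toReal_ofReal (by linarith)]
    refine lt_of_eq_of_lt (lintegral_congr fun x => ?_) h
    rw [← ofReal_norm, Real.norm_eq_abs, ENNReal.ofReal_rpow_of_nonneg (abs_nonneg _) (by linarith)]
  refine hp.mono_exponent ?_
  rw [← ENNReal.ofReal_ofNat 2]
  exact ENNReal.ofReal_le_ofReal (by linarith)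

/-- The difference of independent random variables has positive variance if one of them is not
almost surely constant. -/
lemma variance_sub_pos {f : α → ℝ} {g : β → ℝ}
    (h : MemLp (fun z : α × β => f z.1 - g z.2) 2 (μ.prod η)) {s t : Set β} (hs : η s ≠ 0)
    (ht : η t ≠ 0) (hst : ∀ x ∈ s, ∀ y ∈ t, g x ≠ g y) :
    0 < variance (fun z : α × β => f z.1 - g z.2) (μ.prod η) := by
  refine (variance_nonneg _ _).lt_of_ne' fun h0 => ?_
  -- With zero variance, freezing the first variable makes `g` almost surely constant, but it takes
  -- distinct values on two sets of positive measure.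
  obtain ⟨a, ha⟩ := (Measure.ae_ae_of_ae_prod (ae_eq_integral_of_variance_eq_zero h h0)).exists
  obtain ⟨x, hx, hxs⟩ := (ha.and_frequently (frequently_ae_iff.2 hs)).exists
  obtain ⟨y, hy, hyt⟩ := (ha.and_frequently (frequently_ae_iff.2 ht)).exists
  refine hst x hxs y hyt ?_
  simp only at hx hy
  linarith

end Moments

section Cycles

variable {lam mu : Fin K → ℝ} {gA gS : Fin K → ℝ → ℝ} {k : Fin K} {γmax : ℝ}

lemma measurable_nominal_cycleCount (k : Fin K) :
    Measurable fun v : Drive K => (cycleCount k (nominalPath k v) : ℝ) :=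
  measurable_from_top.comp (measurable_cycleCount k (measurable_nominalPath k))

lemma integral_cycleCount_pos (hlam : ∀ l, 0 < lam l) (hmu : ∀ l, 0 < mu l) (k : Fin K)
    (hi : Integrable (fun v => (cycleCount k (nominalPath k v) : ℝ)) (nominalLaw lam mu)) :
    0 < ∫ v, (cycleCount k (nominalPath k v) : ℝ) ∂nominalLaw lam mu := by
  rw [integral_pos_iff_support_of_nonneg (fun _ => Nat.cast_nonneg _) hi]
  refine (pos_iff_ne_zero.2 (measure_cycleCount_eq_one hlam hmu k)).trans_le
    (measure_mono fun v hv => ?_)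
  have hv' : cycleCount k (nominalPath k v) = 1 := hv
  simp [hv']

lemma integral_weightedCount (hlam : ∀ l, 0 < lam l) (hmu : ∀ l, 0 < mu l)
    (hstable : ∑ l, lam l / mu l < 1) (hgA : ∀ l, IsSamplingDensity (gA l))
    (hgS : ∀ l, IsSamplingDensity (gS l)) (k : Fin K) (γmax γ : ℝ) {c : ℝ}
    (h : ∑' n, nominalLaw lam mu (lateEvent k γ n) = ENNReal.ofReal c) (hc : 0 ≤ c) :
    ∫ u, weightedCount lam mu gA gS k γmax u γ ∂((driveLaw gA gS).prod (nominalLaw lam mu)) = c := by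
  rw [integral_eq_lintegral_of_nonneg_ae
    (ae_of_all _ fun u => weightedCount_nonneg hlam hmu hgA hgS k γmax u γ)
    (measurable_weightedCount hlam hmu hgA hgS k γmax γ).aestronglyMeasurable,
    lintegral_weightedCount hlam hmu hstable hgA hgS, h, ENNReal.toReal_ofReal hc]

/-- The density of the steady-state response time is positive at interior points. -/
lemma deriv_cdf_pos (hlam : ∀ l, 0 < lam l) (hmu : ∀ l, 0 < mu l)
    (hstable : ∑ l, lam l / mu l < 1) (k : Fin K) {ν : Measure ℝ} [IsProbabilityMeasure ν]
    {Q Ea : ℝ} (hQ : 0 < Q) (hEa : 0 < Ea) (hd : DifferentiableAt ℝ (cdf ν) Q)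
    (h : ∀ᶠ γ in 𝓝 Q, ∑' n, nominalLaw lam mu (lateEvent k γ n)
      = ENNReal.ofReal (ν.real (Set.Ioi γ) * Ea)) : 0 < deriv (cdf ν) Q := by
  obtain ⟨c, hc, hcB⟩ := exists_tsum_lateEvent_add_le hlam hmu hstable k (Q + 1)
  have hslope : Tendsto (slope (cdf ν) Q) (𝓝[>] Q) (𝓝 (deriv (cdf ν) Q)) := (hasDerivAt_iff_tendsto_slope.1 hd.hasDerivAt).mono_left
    (nhdsWithin_mono Q fun x (hx : Q < x) => hx.ne')
  refine (div_pos hc hEa).trans_le (ge_of_tendsto hslope ?_)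
  -- Divided by the mean number of jobs per cycle, the increment bound for the expected number of
  -- late jobs becomes a lower bound c/Ea for the slope of the distribution function to the right of
  -- `Q`.
  filter_upwards [self_mem_nhdsWithin, h.filter_mono nhdsWithin_le_nhds,
    (gt_mem_nhds (lt_add_one Q)).filter_mono nhdsWithin_le_nhds] with b hb hbh hb1
  have hb' : Q < b := hb
  have key := hcB Q b hQ.le hb'.le (le_of_lt hb1)
  rw [hbh, h.self_of_nhds, ← ENNReal.ofReal_add (by positivity)
    (mul_nonneg hc.le (by linarith)), ENNReal.ofReal_le_ofReal_iff (by positivity),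
    measureReal_Ioi_eq, measureReal_Ioi_eq] at key
  rw [slope_def_field, div_le_div_iff₀ hEa (by linarith)]
  linarith

end Cycles

end PriorityQueue
end

/-! ### Assembly of the theorem -/

theorem mainTheorem1 {K : ℕ} (lam mu : Fin K → ℝ)
    (hlam : ∀ l, 0 < lam l) (hmu : ∀ l, 0 < mu l)
    -- stability of the queue
    (hstable : ∑ l, lam l / mu l < 1)
    (k : Fin K) (p : ℝ) (hp₀ : 0 < p) (hp₁ : p < 1)
    -- importance sampling densities and switching threshold
    (gA gS : Fin K → ℝ → ℝ)
    (hgA : ∀ l, PriorityQueue.IsSamplingDensity (gA l))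
    (hgS : ∀ l, PriorityQueue.IsSamplingDensity (gS l))
    (γmax : ℝ)
    {Ω : Type*} [MeasurableSpace Ω] (P : Measure Ω) [IsProbabilityMeasure P]
    -- `ν` is the law of the steady-state response time of class `k`: the limit in distribution of
    -- the response times of the successive class-`k` jobs in the original system
    (W : Ω → PriorityQueue.Drive K) (hW : HasLaw W (PriorityQueue.nominalLaw lam mu) P)
    (ν : Measure ℝ) [IsProbabilityMeasure ν]
    (hν : TendstoInDistribution
      (fun (n : ℕ) ω => PriorityQueue.responseTime k (PriorityQueue.nominalPath k (W ω)) n)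
      atTop id (fun _ => P) ν)
    -- independent inputs of the importance sampling cycles `U i` and the original cycles `X i`
    (U : ℕ → Ω → PriorityQueue.Drive K × PriorityQueue.Drive K)
    (X : ℕ → Ω → PriorityQueue.Drive K)
    (hU : ∀ i, HasLaw (U i)
      ((PriorityQueue.driveLaw gA gS).prod (PriorityQueue.nominalLaw lam mu)) P)
    (hX : ∀ i, HasLaw (X i) (PriorityQueue.nominalLaw lam mu) P)
    (hUX : ∀ i, IndepFun (U i) (X i) P)
    (hindep : iIndepFun (fun i ω => (U i ω, X i ω)) P)
    -- regularity near the quantile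
    (ε M : ℝ) (hε : 0 < ε) (hM : 0 < M)
    (hreg : ∀ᶠ γ in 𝓝 (PriorityQueue.quantile ν p),
      DifferentiableAt ℝ (cdf ν) γ ∧ DifferentiableAt ℝ (deriv (cdf ν)) γ ∧
      |deriv (deriv (cdf ν)) γ| ≤ M ∧
      ∫⁻ ω, ENNReal.ofReal
        (|PriorityQueue.centered lam mu gA gS k γmax ν (U 0 ω) (X 0 ω) γ| ^ (2 + ε)) ∂P
          ≤ ENNReal.ofReal M) :
    let Q : ℝ := PriorityQueue.quantile ν p
    let Qhat : ℕ → Ω → ℝ := fun m ω => PriorityQueue.quantileEstimator lam mu gA gS k γmax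
      (fun i => U i ω) (fun i => X i ω) m m p
    let σ : ℝ → ℝ := fun γ => Real.sqrt
      (variance (fun ω => PriorityQueue.centered lam mu gA gS k γmax ν (U 0 ω) (X 0 ω) γ) P)
    let Eα : ℝ := ∫ ω, (PriorityQueue.cycleCount k (PriorityQueue.nominalPath k (X 0 ω)) : ℝ) ∂P
    TendstoInDistribution
      (fun (m : ℕ) ω => Real.sqrt m * (Qhat m ω - Q) / (σ Q / (Eα * deriv (cdf ν) Q)))
      atTop id (fun _ => P) (gaussianReal 0 1) ∧
    TendstoInMeasure P Qhat atTop (fun _ => Q) := by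
  intro Q Qhat σ Eα
  have hN := PriorityQueue.isProbabilityMeasure_nominalLaw hlam hmu
  have hD := PriorityQueue.isProbabilityMeasure_driveLaw hgA hgS
  set N := PriorityQueue.nominalLaw lam mu with hNdef
  set D := (PriorityQueue.driveLaw gA gS).prod N with hDdef
  set V : ℕ → Ω → (PriorityQueue.Drive K × PriorityQueue.Drive K) × PriorityQueue.Drive K :=
    fun i ω => (U i ω, X i ω) with hVdef
  have hV : ∀ i, HasLaw (V i) (D.prod N) P := fun i => (hUX i).hasLaw_prod (hU i) (hX i)
  set q : ℝ → ℝ := fun γ => ν.real (Set.Ioi γ) with hqdef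
  set A : PriorityQueue.Drive K → ℝ :=
    fun v => (PriorityQueue.cycleCount k (PriorityQueue.nominalPath k v) : ℝ) with hAdef
  set Y : ℝ → PriorityQueue.Drive K × PriorityQueue.Drive K → ℝ :=
    fun γ u => PriorityQueue.weightedCount lam mu gA gS k γmax u γ with hYdef
  have hAm : Measurable A := PriorityQueue.measurable_nominal_cycleCount k
  have hYm : ∀ γ, Measurable (Y γ) := fun γ =>
    PriorityQueue.measurable_weightedCount hlam hmu hgA hgS k γmax γ
  have hZm : ∀ γ, Measurable fun z : (PriorityQueue.Drive K × PriorityQueue.Drive K) ×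
      PriorityQueue.Drive K => Y γ z.1 - q γ * A z.2 := fun γ =>
    ((hYm γ).comp measurable_fst).sub ((hAm.comp measurable_snd).const_mul _)
  have hdQ : DifferentiableAt ℝ (cdf ν) Q := hreg.self_of_nhds.1
  have hcdf : cdf ν Q = p := PriorityQueue.cdf_quantile hp₀ hp₁ hdQ.continuousAt
  have hQpos : 0 < Q := PriorityQueue.quantile_pos hp₀ hp₁ hdQ.continuousAt
    (PriorityQueue.steady_Iio_zero hlam hmu hstable hν hW)
  have hqcdf : ∀ γ, q γ = 1 - cdf ν γ := PriorityQueue.measureReal_Ioi_eq ν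
  have hqQ : q Q = 1 - p := by rw [hqcdf, hcdf]
  have hq : HasDerivAt q (-deriv (cdf ν) Q) Q := by
    rw [show q = fun γ => 1 - cdf ν γ from funext hqcdf]
    exact hdQ.hasDerivAt.const_sub 1
  have hqpos : ∀ᶠ γ in 𝓝 Q, 0 < q γ :=
    hq.continuousAt.eventually (lt_mem_nhds (by rw [hqQ]; linarith))
  have hZ2 : ∀ᶠ γ in 𝓝 Q, MemLp (fun z : (PriorityQueue.Drive K × PriorityQueue.Drive K) ×
      PriorityQueue.Drive K => Y γ z.1 - q γ * A z.2) 2 (D.prod N) := by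
    filter_upwards [hreg] with γ h
    refine PriorityQueue.memLp_two_of_lintegral_rpow_lt_top (hZm γ) hε ?_
    rw [← (hV 0).lintegral_comp (((hZm γ).abs.pow_const _).ennreal_ofReal.aemeasurable)]
    exact h.2.2.2.trans_lt ENNReal.ofReal_lt_top
  have hYA : ∀ᶠ γ in 𝓝 Q, MemLp (Y γ) 2 D ∧ MemLp (fun v => q γ * A v) 2 N :=
    hZ2.mono fun γ h => PriorityQueue.memLp_two_of_memLp_sub (hYm γ) (hAm.const_mul _) h
  -- The factor q(Q) = 1 - p is nonzero and can be cancelled.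
  have hA2 : MemLp A 2 N := by
    have h := hYA.self_of_nhds.2.const_mul (q Q)⁻¹
    simpa only [inv_mul_cancel_left₀ hqpos.self_of_nhds.ne'] using h
  have hAi : Integrable A N := hA2.integrable one_le_two
  have hEα : Eα = ∫ v, A v ∂N := PriorityQueue.integral_comp_of_hasLaw (hX 0) hAm
  have hEpos : 0 < Eα := by
    rw [hEα]
    exact PriorityQueue.integral_cycleCount_pos hlam hmu k hAi
  -- Near `Q` the distribution function is continuous, so these levels carry no atom and the tail
  -- probabilities of the successive response times converge there.
  have hlate : ∀ᶠ γ in 𝓝 Q, ∑' n, N (PriorityQueue.lateEvent k γ n)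
      = ENNReal.ofReal (q γ * Eα) := by
    filter_upwards [hreg] with γ h
    rw [hEα]
    exact PriorityQueue.tsum_measure_lateEvent hlam hmu hstable k γ hAi
      (PriorityQueue.tendsto_measure_of_steady hν
        (PriorityQueue.measure_singleton_eq_zero_of_continuousAt_cdf h.1.continuousAt) hW)
  have hdpos : 0 < deriv (cdf ν) Q :=
    PriorityQueue.deriv_cdf_pos hlam hmu hstable k hQpos hEpos hdQ hlate
  have hVar : 0 < variance (fun z : (PriorityQueue.Drive K × PriorityQueue.Drive K) ×
      PriorityQueue.Drive K => Y Q z.1 - q Q * A z.2) (D.prod N) := by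
    refine PriorityQueue.variance_sub_pos (f := Y Q) (g := fun v => q Q * A v) hZ2.self_of_nhds
      (PriorityQueue.measure_cycleCount_eq_one hlam hmu k)
      (PriorityQueue.measure_one_lt_cycleCount hlam hmu hstable k) fun v hv v' hv' h => ?_
    have h1 : PriorityQueue.cycleCount k (PriorityQueue.nominalPath k v) = 1 := hv
    have h2 : 1 < PriorityQueue.cycleCount k (PriorityQueue.nominalPath k v') := hv'
    have h3 : A v = A v' := mul_left_cancel₀ hqpos.self_of_nhds.ne' h
    have h4 : PriorityQueue.cycleCount k (PriorityQueue.nominalPath k v)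
        = PriorityQueue.cycleCount k (PriorityQueue.nominalPath k v') := Nat.cast_injective (R := ℝ) h3
    omega
  have hσ : σ Q = Real.sqrt (variance (fun z : (PriorityQueue.Drive K × PriorityQueue.Drive K) ×
      PriorityQueue.Drive K => Y Q z.1 - q Q * A z.2) (D.prod N)) := by
    rw [← PriorityQueue.variance_comp_of_hasLaw (hV 0) (hZm Q)]
    rfl
  -- One sample is a pair of an importance sampling cycle and an original cycle; numerator and
  -- denominator each see one component.
  have key := PriorityQueue.ratioQuantile_clt (μ := D.prod N) (y := fun γ z => Y γ z.1)
    (al := fun z => A z.2) (q := q) (Q := Q) (Ea := Eα) (d := deriv (cdf ν) Q) (σ := σ Q) hV hindep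
    (fun γ => (hYm γ).comp measurable_fst) (hAm.comp measurable_snd) (fun _ => Nat.cast_nonneg _)
    (fun z => PriorityQueue.weightedCount_antitone hlam hmu hgA hgS k γmax z.1)
    (fun z => PriorityQueue.weightedCount_eventually_eq_zero k γmax z.1)
    (hA2.comp_snd D) (by rw [hEα, integral_fun_snd]; simp) hEpos hQpos hqpos.self_of_nhds
    hdpos hq
    (by
      filter_upwards [hYA, hlate, hqpos] with γ h hl hpos
      refine ⟨h.1.comp_fst N, ?_⟩
      rw [integral_fun_fst, PriorityQueue.integral_weightedCount hlam hmu hstable hgA hgS k γmax γ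
        hl (by positivity)]
      simp)
    (by rw [hσ]; exact Real.sqrt_pos.2 hVar)
    (by rw [hσ, Real.sq_sqrt hVar.le])
  rw [hqQ] at key
  exact key
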